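/- Notation. Let $\Lambda$ be the von Mangoldt function. Put $h(x)=\exp\bigl(-\tfrac1{x(1-x)}\bigr)$ for $0<x<1$ and $h(x)=0$ otherwise, $H(y)=\bigl(\int_0^1 h\bigr)^{-1}\int_{-\infty}^y h(x)\,dx$, and $w_0(x)=H(2x-1)-H(x-1)$. For real $Y>1$, a zero $\rho_0=\beta_0+i\gamma_0$ of the Riemann zeta function $\zeta$ is called $Y$-half-isolated if every zero $\rho'=\beta'+i\gamma'$ of $\zeta$ with $|\rho'-\rho_0|\le(\log|\gamma_0|)^2$ satisfies at least one of (1) $|\beta'-\beta_0|\le\frac1{10\log Y}$ and $\gamma'\ge\gamma_0$; (2) $\beta'\le\beta_0-\frac{(\log\log|\gamma_0|)^2}{\log Y}$. The zero $\rho_0$ is called half-isolated if it is $Y$-half-isolated for some $Y>1$ with $(\log\log|\gamma_0|)^3\le\log Y\le\frac{\log|\gamma_0|}{\log\log|\gamma_0|}$. For $T$ large put $\mathcal U(T)=[\exp((\log\log T)^3),T^2]\cap\{(1+(\log T)^{-150})^j:j\in\mathbb Z\}$. Theorem. The function $w_0$ is smooth, non-negative and supported in $[1/2,2]$, and the following hold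 (unconditionally). (a) There is an absolute constant $C\ge1$ such that for all sufficiently large $T$ and every half-isolated zero $\rho_0=\beta_0+i\gamma_0$ with $\gamma_0\in[T,2T]$ there is a real $Y\in[T^{(\log\log T)^3/\log T},\,T^{5/\log\log T}]$ with $$\Bigl|\sum_n\frac{\Lambda(n)}{n^{\rho_0}}\,w_0\Bigl(\frac nY\Bigr)\Bigr|\ge(\log T)^{-C}.$$ (b) There is an absolute constant $c>0$ such that for all sufficiently large $T$ the set $\mathcal U(T)\subseteq[\exp((\log\log T)^3),T^2]$ is finite with $\#\mathcal U(T)\le(\log T)^{152}$, and for every $Y>1$ with $(\log\log T)^3\le\log Y\le\log T$ and every $Y$-half-isolated zero $\rho_0=\beta_0+i\gamma_0$ with $\gamma_0\in[T,2T]$ there is $U\in\mathcal U(T)\cap[Y,Y^2]$ with $$\Bigl|\sum_n\frac{\Lambda(n)}{n^{\rho_0}}\,w_0\Bigl(\frac nU\Bigr)\Bigr|\ge c\,(\log T)^{-100}.$$ -/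

import Mathlib

open scoped ContDiff

noncomputable section

namespace HalfIsolated

/-- `ρ₀` is a `Y`-half-isolated zero of the Riemann zeta function (used for real `Y > 1`). -/
def IsYHalfIsolated (Y : ℝ) (ρ₀ : ℂ) : Prop :=
  riemannZeta ρ₀ = 0 ∧
    ∀ ρ' : ℂ, riemannZeta ρ' = 0 → ‖ρ' - ρ₀‖ ≤ Real.log |ρ₀.im| ^ 2 →
      (|ρ'.re - ρ₀.re| ≤ 1 / (10 * Real.log Y) ∧ ρ₀.im ≤ ρ'.im) ∨
        ρ'.re ≤ ρ₀.re - Real.log (Real.log |ρ₀.im|) ^ 2 / Real.log Y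

/-- `ρ₀` is a half-isolated zero of the Riemann zeta function. -/
def IsHalfIsolated (ρ₀ : ℂ) : Prop :=
  ∃ Y : ℝ, 1 < Y ∧
    Real.log (Real.log |ρ₀.im|) ^ 3 ≤ Real.log Y ∧
    Real.log Y ≤ Real.log |ρ₀.im| / Real.log (Real.log |ρ₀.im|) ∧
    IsYHalfIsolated Y ρ₀

/-- The bump function `exp (-1 / (x (1 - x)))` on `(0, 1)`, extended by zero. -/
def bump (x : ℝ) : ℝ :=
  open Classical in
  if x ∈ Set.Ioo (0 : ℝ) 1 then Real.exp (-1 / (x * (1 - x))) else 0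

/-- The normalised primitive of `bump`, a smooth step from `0` to `1`. -/
def step (y : ℝ) : ℝ :=
  (1 / ∫ x in (0 : ℝ)..1, bump x) * ∫ x in Set.Iic y, bump x

/-- The smooth weight `w₀`. -/
def w₀ (x : ℝ) : ℝ := step (2 * x - 1) - step (x - 1)

/-- The Dirichlet polynomial `∑ n, Λ(n) n ^ (-s) w₀(n / Y)`; since `w₀` has compact support, the
sum is finite when `Y > 0`. -/
def detector (Y : ℝ) (s : ℂ) : ℂ :=
  ∑' n : ℕ, (ArithmeticFunction.vonMangoldt n : ℂ) / (n : ℂ) ^ s * (w₀ ((n : ℝ) / Y) : ℂ)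

/-- The integer powers of `1 + (log T) ^ (-150)` lying in `[exp ((log log T) ^ 3), T ^ 2]`. -/
def lengths (T : ℝ) : Set ℝ :=
  Set.Icc (Real.exp (Real.log (Real.log T) ^ 3)) (T ^ 2) ∩
    Set.range fun j : ℤ => (1 + 1 / Real.log T ^ 150) ^ j

end HalfIsolated

end

/-! Write `W` for the Mellin transform of `w₀`, `L = log Y` and `g = log γ₀`. Mellin inversion and a
contour shift past the zeros near `ρ₀` (`explicit_formula`) give, for `U = exp y`, that the detector
equals minus the sum of `m(ρ) W(ρ - ρ₀) exp((ρ - ρ₀) y)` over zeros within `g²` of `ρ₀`, up to a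
negligible error. Truncation at height `g²` suffices because `W` decays like `exp(-√|t|)`. This
beats `U ^ (1.01 - β₀)` for `U ≤ T ^ (8/5)`, since reflecting `ρ₀` in the critical line forces `β₀ ≥
0.49` (`re_ge_of_isYHalfIsolated`).

For `y ≥ L` the zeros of type (2) contribute a factor at most `exp(-(log g)²)`, smaller than any
fixed power of `1 / log T`. What remains is an exponential sum `f(w) = ∑ aᵢ exp(sᵢ L w)` at `w = y /
L`, with `sᵢ = ρ - ρ₀`, `Im sᵢ ≥ 0` and `|Re sᵢ| L ≤ 1/10`. On the real axis such a sum could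
cancel, but at `w = 1.3 i` it cannot: nearby zeros give terms of positive real part, since their
phases are small and `W` is close to `W(0) > 0`, and the others are exponentially damped
(`exists_norm_sum_imag_ge`).

To return to real `w`, use the two-constants theorem. One-sidedness makes `f` bounded on a large
rectangle in the upper half-plane, and `[1, 1.6]` has harmonic measure bounded below as seen from
`1.3 i`. If `f` were tiny on that interval it would be small at `1.3 i` (`exists_norm_sum_exp_ge`).
The loss is a fixed power of the number of zeros, which is `O((log T)³)`. Since `f` is Lipschitz
with a constant polynomial in `log T`, the good point can be rounded to the logarithmic grid of
spacing `log(1 + (log T)^(-150))` (`exists_grid_sum_ge`).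

`exists_detector_ge` combines these and proves both (a) and (b); in (a) the range of `U` follows
from `Y ≤ U ≤ Y²`. -/

namespace HalfIsolated

/-! ### Factoring out zeros, Jensen's bound and Landau's partial fraction about the origin. -/

section Factorization

open Complex Metric Set Filter Topology

/-- The multiplicity-weighted sum of `1 / (z - ρ)` over a finite set of points, with the
multiplicities given by the orders of vanishing of `f`. -/
noncomputable def polePart (f : ℂ → ℂ) (Z : Finset ℂ) (z : ℂ) : ℂ :=
  ∑ ρ ∈ Z, (analyticOrderNatAt f ρ : ℂ) / (z - ρ)

lemma analyticOrderAt_ne_top_of_entire {f : ℂ → ℂ} (hf : Differentiable ℂ f) {c : ℂ}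
    (hc : f c ≠ 0) (z : ℂ) : analyticOrderAt f z ≠ ⊤ := by
  intro h
  rw [analyticOrderAt_eq_top] at h
  have han : AnalyticOnNhd ℂ f univ := fun x _ => hf.analyticAt x
  have := han.eqOn_zero_of_preconnected_of_eventuallyEq_zero isPreconnected_univ (mem_univ z) h
  exact hc (this (mem_univ c))

/-- The divided slope at a zero is again entire and has order one less there, so induction yields a
cofactor valid on the whole plane and not only near `ρ`. -/
lemma exists_eq_pow_mul {f : ℂ → ℂ} (hf : Differentiable ℂ f) (ρ : ℂ) (n : ℕ)
    (hn : analyticOrderAt f ρ = n) :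
    ∃ g : ℂ → ℂ, Differentiable ℂ g ∧ g ρ ≠ 0 ∧ ∀ z, f z = (z - ρ) ^ n * g z := by
  induction n generalizing f with
  | zero =>
    refine ⟨f, hf, ?_, by simp⟩
    exact ((hf.analyticAt ρ).analyticOrderAt_eq_zero).1 (by simpa using hn)
  | succ n ih =>
    have h0 : f ρ = 0 := by
      by_contra h
      have := ((hf.analyticAt ρ).analyticOrderAt_eq_zero).2 h
      rw [this] at hn
      exact absurd hn (by simpa using (Nat.cast_ne_zero (R := ℕ∞)).2 (Nat.succ_ne_zero n) |>.symm)
    have hd : Differentiable ℂ (dslope f ρ) := by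
      rw [← differentiableOn_univ, differentiableOn_dslope univ_mem, differentiableOn_univ]
      exact hf
    have hmul : f = (fun z => z - ρ) * dslope f ρ := by
      ext z
      have := sub_smul_dslope f ρ z
      simp only [smul_eq_mul, h0, sub_zero] at this
      simp [this]
    have hone : analyticOrderAt (fun z : ℂ => z - ρ) ρ = (1 : ℕ) := by
      rw [AnalyticAt.analyticOrderAt_eq_natCast (by fun_prop)]
      exact ⟨fun _ => 1, analyticAt_const, one_ne_zero, by simp⟩
    have hord : analyticOrderAt (dslope f ρ) ρ = n := by
      have h2 := analyticOrderAt_mul (f := fun z : ℂ => z - ρ) (g := dslope f ρ) (z₀ := ρ)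
        (by fun_prop) (hd.analyticAt ρ)
      rw [← hmul, hn, hone] at h2
      push_cast at h2
      rw [add_comm (1 : ℕ∞)] at h2
      exact (WithTop.add_right_cancel ENat.one_ne_top h2).symm
    obtain ⟨g, hg, hg0, hgz⟩ := ih hd hord
    refine ⟨g, hg, hg0, fun z => ?_⟩
    have : f z = (z - ρ) * dslope f ρ z := by
      conv_lhs => rw [hmul]
      rfl
    rw [this, hgz z]; ring

/-- The factors already removed do not vanish at a new point `ρ`, so the cofactor has the same order
at `ρ` as `f`. A single nonzero value of `f` makes all orders finite. -/
lemma exists_factor {f : ℂ → ℂ} (hf : Differentiable ℂ f) {c : ℂ} (hc : f c ≠ 0)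
    (Z : Finset ℂ) :
    ∃ g : ℂ → ℂ, Differentiable ℂ g ∧ (∀ ρ ∈ Z, g ρ ≠ 0) ∧
      ∀ z, f z = (∏ ρ ∈ Z, (z - ρ) ^ analyticOrderNatAt f ρ) * g z := by
  classical
  induction Z using Finset.induction_on with
  | empty => exact ⟨f, hf, by simp, by simp⟩
  | insert ρ Z hρ ih =>
    obtain ⟨g, hg, hg0, hgz⟩ := ih
    set P : ℂ → ℂ := fun z => ∏ ρ ∈ Z, (z - ρ) ^ analyticOrderNatAt f ρ with hP
    have hPd : Differentiable ℂ P := by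
      rw [hP]; fun_prop
    have hPρ : P ρ ≠ 0 := by
      rw [hP]
      refine Finset.prod_ne_zero_iff.2 fun a ha => pow_ne_zero _ (sub_ne_zero.2 ?_)
      rintro rfl
      exact hρ ha
    have hfg : f = P * g := by ext z; exact hgz z
    have hord : analyticOrderAt f ρ = analyticOrderAt g ρ := by
      conv_lhs => rw [hfg]
      rw [analyticOrderAt_mul (hPd.analyticAt ρ) (hg.analyticAt ρ),
        ((hPd.analyticAt ρ).analyticOrderAt_eq_zero).2 hPρ, zero_add]
    have hn : analyticOrderAt g ρ = analyticOrderNatAt f ρ := by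
      rw [← hord]
      exact (Nat.cast_analyticOrderNatAt (analyticOrderAt_ne_top_of_entire hf hc ρ)).symm
    obtain ⟨h, hh, hh0, hhz⟩ := exists_eq_pow_mul hg ρ _ hn
    refine ⟨h, hh, ?_, fun z => ?_⟩
    · intro a ha
      rcases Finset.mem_insert.1 ha with rfl | ha
      · exact hh0
      · intro h0
        exact hg0 a ha (by rw [hhz, h0, mul_zero])
    · rw [hgz z, hhz z, Finset.prod_insert hρ]; ring

lemma logDeriv_prod_pow (Z : Finset ℂ) (m : ℂ → ℕ) {z : ℂ} (hz : z ∉ Z) :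
    logDeriv (fun z => ∏ ρ ∈ Z, (z - ρ) ^ m ρ) z = ∑ ρ ∈ Z, (m ρ : ℂ) / (z - ρ) := by
  have hne : ∀ ρ ∈ Z, z - ρ ≠ 0 := fun ρ hρ => sub_ne_zero.2 (by rintro rfl; exact hz hρ)
  rw [logDeriv_prod (f := fun ρ z => (z - ρ) ^ m ρ) (fun ρ hρ => pow_ne_zero _ (hne ρ hρ))
    (fun ρ _ => by fun_prop)]
  refine Finset.sum_congr rfl fun ρ hρ => ?_
  rw [logDeriv_fun_pow (f := fun z => z - ρ) (by fun_prop)]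
  simp [logDeriv_apply, div_eq_mul_inv]

lemma logDeriv_eq_polePart_add {f g : ℂ → ℂ} (hg : Differentiable ℂ g)
    {Z : Finset ℂ} (h : ∀ z, f z = (∏ ρ ∈ Z, (z - ρ) ^ analyticOrderNatAt f ρ) * g z)
    {z : ℂ} (hz : z ∉ Z) (hgz : g z ≠ 0) :
    logDeriv f z = polePart f Z z + logDeriv g z := by
  have hfe : f = fun z => (∏ ρ ∈ Z, (z - ρ) ^ analyticOrderNatAt f ρ) * g z := funext h
  have hne : (∏ ρ ∈ Z, (z - ρ) ^ analyticOrderNatAt f ρ) ≠ 0 :=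
    Finset.prod_ne_zero_iff.2 fun a ha => pow_ne_zero _ (sub_ne_zero.2 (by rintro rfl; exact hz ha))
  conv_lhs => rw [hfe]
  rw [logDeriv_mul (f := fun z => ∏ ρ ∈ Z, (z - ρ) ^ analyticOrderNatAt f ρ) z hne hgz
    (by fun_prop) (hg z), logDeriv_prod_pow Z _ hz, polePart]

/-- On the circle `R² = conj z * z`, so the numerator is `conj (z - ρ) * z`. This is the Blaschke
reflection: it moves a zero out of the disc without changing moduli on the circle. -/
lemma norm_sq_sub_conj_mul {R : ℝ} (hR : 0 < R) {z : ℂ} (hz : ‖z‖ = R) (ρ : ℂ) :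
    ‖((R : ℂ) ^ 2 - (starRingEnd ℂ) ρ * z) / R‖ = ‖z - ρ‖ := by
  have h1 : (R : ℂ) ^ 2 = (starRingEnd ℂ) z * z := by
    rw [Complex.conj_mul', hz]
  rw [h1, ← sub_mul, norm_div, norm_mul, ← map_sub, RCLike.norm_conj, hz, Complex.norm_real,
    Real.norm_of_nonneg hR.le, mul_div_assoc, div_self hR.ne', mul_one]

/-- An entire function without zeros in a disc about the origin, bounded by `exp M` times its
value at the origin, has logarithmic derivative `O(M)` in a smaller disc. -/
lemma norm_logDeriv_le_of_ne_zero {G : ℂ → ℂ} (hG : Differentiable ℂ G) {r₁ r₂ M : ℝ}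
    (h₁ : 0 < r₁) (h₂ : r₁ < r₂) (hM : 0 < M) (h0 : ∀ z ∈ ball (0 : ℂ) r₂, G z ≠ 0)
    (hb : ∀ z ∈ ball (0 : ℂ) r₂, ‖G z‖ ≤ Real.exp M * ‖G 0‖) {z : ℂ} (hz : ‖z‖ ≤ r₁) :
    ‖logDeriv G z‖ ≤ 8 * r₂ / (r₂ - r₁) ^ 2 * M := by
  have hr₂ : 0 < r₂ := h₁.trans h₂
  have hmem0 : (0 : ℂ) ∈ ball (0 : ℂ) r₂ := mem_ball_self hr₂
  have hdL : DifferentiableOn ℂ (logDeriv G) (ball 0 r₂) := by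
    intro w hw
    have h1 : DifferentiableAt ℂ (deriv G) w := (hG.analyticAt w).deriv.differentiableAt
    exact (h1.div (hG w) (h0 w hw)).differentiableWithinAt
  obtain ⟨H0, hH0⟩ := hdL.isExactOn_ball
  -- `H` serves as `log (G / G 0)`: it is a primitive of `G'/G` normalised at the origin, and `G *
  -- exp (-H)` has zero derivative. The bound on `G` becomes `Re H ≤ M`, the input of
  -- Borel–Carathéodory.
  set H : ℂ → ℂ := fun w => H0 w - H0 0 with hH
  have hHd : ∀ w ∈ ball (0 : ℂ) r₂, HasDerivAt H (logDeriv G w) w := fun w hw =>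
    (hH0 w hw).sub_const _
  have hHdiff : DifferentiableOn ℂ H (ball 0 r₂) := fun w hw =>
    (hHd w hw).differentiableAt.differentiableWithinAt
  have hconst : ∀ w ∈ ball (0 : ℂ) r₂, G w * exp (-H w) = G 0 := by
    intro w hw
    have hd : ∀ w ∈ ball (0 : ℂ) r₂, HasDerivAt (fun w => G w * exp (-H w)) 0 w := by
      intro w hw
      have := (hG w).hasDerivAt.mul ((hHd w hw).neg.cexp)
      refine this.congr_deriv ?_
      simp only [Pi.neg_apply, logDeriv_apply]
      have := h0 w hw
      field_simp
      ring
    have := (convex_ball (0 : ℂ) r₂).is_const_of_fderivWithin_eq_zero (𝕜 := ℂ)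
      (f := fun w => G w * exp (-H w))
      (fun w hw => (hd w hw).differentiableAt.differentiableWithinAt)
      (fun w hw => by
        rw [fderivWithin_of_isOpen isOpen_ball hw]
        have := (hd w hw).hasFDerivAt.fderiv
        rw [this]
        ext; simp) hw hmem0
    simpa [hH] using this
  have hG0 : 0 < ‖G 0‖ := norm_pos_iff.2 (h0 0 hmem0)
  have hre : MapsTo H (ball 0 r₂) {w | w.re ≤ M} := by
    intro w hw
    have h1 : G w = G 0 * exp (H w) := by
      rw [← hconst w hw, mul_assoc, ← Complex.exp_add]; simp
    have h2 := hb w hw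
    rw [h1, norm_mul, Complex.norm_exp, mul_comm] at h2
    exact Real.exp_le_exp.1 (le_of_mul_le_mul_right h2 hG0)
  have hH00 : H 0 = 0 := by simp [hH]
  -- With half the gap as radius, Cauchy's estimate uses a circle on which Borel–Carathéodory still
  -- has distance at least `(r₂ - r₁) / 2` to the boundary.
  set d := (r₂ - r₁) / 2 with hd
  have hdpos : 0 < d := by rw [hd]; linarith
  have hsph : ∀ w ∈ sphere z d, ‖H w‖ ≤ 4 * r₂ / (r₂ - r₁) * M := by
    intro w hw
    have hw1 : ‖w‖ ≤ r₁ + d := by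
      have : ‖w - z‖ = d := by simpa [dist_eq_norm] using hw
      calc ‖w‖ = ‖z + (w - z)‖ := by ring_nf
        _ ≤ ‖z‖ + ‖w - z‖ := norm_add_le _ _
        _ ≤ r₁ + d := by linarith
    have hw2 : ‖w‖ < r₂ := by rw [hd] at hw1; linarith
    have := borelCaratheodory_zero hM hHdiff hre hr₂ (mem_ball_zero_iff.2 hw2) hH00
    refine this.trans ?_
    have h3 : (r₂ - r₁) / 2 ≤ r₂ - ‖w‖ := by rw [hd] at hw1; linarith
    have h4 : 0 < r₂ - r₁ := by linarith
    calc 2 * M * ‖w‖ / (r₂ - ‖w‖) ≤ 2 * M * r₂ / ((r₂ - r₁) / 2) := by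
          gcongr
      _ = 4 * r₂ / (r₂ - r₁) * M := by field_simp; ring
  have hsub : closedBall z d ⊆ ball 0 r₂ := by
    intro w hw
    have : ‖w - z‖ ≤ d := by simpa [dist_eq_norm] using hw
    rw [mem_ball_zero_iff]
    calc ‖w‖ = ‖z + (w - z)‖ := by ring_nf
        _ ≤ ‖z‖ + ‖w - z‖ := norm_add_le _ _
        _ < r₂ := by rw [hd] at this; linarith
  have hdc : DiffContOnCl ℂ H (ball z d) := by
    refine DifferentiableOn.diffContOnCl (hHdiff.mono ?_)
    rw [closure_ball z hdpos.ne']; exact hsub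
  have hzin : z ∈ ball (0 : ℂ) r₂ := hsub (mem_closedBall_self hdpos.le)
  have := norm_deriv_le_of_forall_mem_sphere_norm_le hdpos hdc hsph
  rw [(hHd z hzin).deriv] at this
  refine this.trans (le_of_eq ?_)
  have h4 : r₂ - r₁ ≠ 0 := by linarith
  rw [hd]; field_simp; ring

/-- Jensen's bound for the number of zeros and Landau's approximate partial fraction for the
logarithmic derivative, in discs about the origin. -/
lemma landau_zero {f : ℂ → ℂ} (hf : Differentiable ℂ f) {r₁ r₂ R M : ℝ} (h₁ : 0 < r₁)
    (h₂ : r₁ < r₂) (h₃ : r₂ < R) (hM : 0 < M) (h0 : f 0 ≠ 0)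
    (hb : ∀ z ∈ closedBall (0 : ℂ) R, ‖f z‖ ≤ Real.exp M * ‖f 0‖) {Z : Finset ℂ}
    (hZ : ∀ z, z ∈ Z ↔ f z = 0 ∧ ‖z‖ ≤ r₂) :
    (∑ ρ ∈ Z, (analyticOrderNatAt f ρ : ℝ)) * Real.log (R / r₂) ≤ M ∧
    ∀ z, ‖z‖ ≤ r₁ → f z ≠ 0 → ‖logDeriv f z - polePart f Z z‖ ≤
      (8 * r₂ / (r₂ - r₁) ^ 2 + 1 / ((R - r₂) * Real.log (R / r₂))) * M := by
  obtain ⟨g, hg, hgZ, hfg⟩ := exists_factor hf h0 Z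
  have hr₂ : 0 < r₂ := h₁.trans h₂
  have hR : 0 < R := hr₂.trans h₃
  set m := analyticOrderNatAt f with hm
  -- Replacing each `z - ρ` by its reflected factor turns `f` into `G = B g`, which has no zeros in
  -- the disc of radius `r₂` and the same modulus as `f` on the circle of radius `R`.
  set B : ℂ → ℂ := fun z => ∏ ρ ∈ Z, (((R : ℂ) ^ 2 - (starRingEnd ℂ) ρ * z) / R) ^ m ρ with hB
  have hBd : Differentiable ℂ B := by rw [hB]; fun_prop
  set G : ℂ → ℂ := fun z => B z * g z with hG
  have hGd : Differentiable ℂ G := hBd.mul hg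
  have hfac : ∀ ρ ∈ Z, ∀ z : ℂ, ‖z‖ ≤ R → (R - r₂) * R ≤ ‖(R : ℂ) ^ 2 - (starRingEnd ℂ) ρ * z‖ := by
    intro ρ hρ z hz
    have h1 : ‖(starRingEnd ℂ) ρ * z‖ ≤ r₂ * R := by
      rw [norm_mul, RCLike.norm_conj]
      exact mul_le_mul ((hZ ρ).1 hρ).2 hz (norm_nonneg _) hr₂.le
    have h2 := norm_sub_norm_le ((R : ℂ) ^ 2) ((starRingEnd ℂ) ρ * z)
    have h3 : ‖(R : ℂ) ^ 2‖ = R ^ 2 := by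
      rw [norm_pow, Complex.norm_real, Real.norm_of_nonneg hR.le]
    nlinarith
  have hRr : 0 < (R - r₂) * R := mul_pos (by linarith) hR
  have hfacne : ∀ ρ ∈ Z, ∀ z : ℂ, ‖z‖ ≤ R → (R : ℂ) ^ 2 - (starRingEnd ℂ) ρ * z ≠ 0 :=
    fun ρ hρ z hz => norm_pos_iff.1 (hRr.trans_le (hfac ρ hρ z hz))
  have hRc : (R : ℂ) ≠ 0 := by exact_mod_cast hR.ne'
  have hBne : ∀ z : ℂ, ‖z‖ ≤ R → B z ≠ 0 := fun z hz =>
    Finset.prod_ne_zero_iff.2 fun ρ hρ => pow_ne_zero _ (div_ne_zero (hfacne ρ hρ z hz) hRc)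
  have hsphere : ∀ z : ℂ, ‖z‖ = R → ‖G z‖ = ‖f z‖ := by
    intro z hz
    rw [hG, hfg z, norm_mul, norm_mul, hB, norm_prod, norm_prod]
    congr 1
    refine Finset.prod_congr rfl fun ρ _ => ?_
    rw [norm_pow, norm_pow, norm_sq_sub_conj_mul hR hz]
  have hGb : ∀ z ∈ closedBall (0 : ℂ) R, ‖G z‖ ≤ Real.exp M * ‖f 0‖ := by
    intro z hz
    refine norm_le_of_forall_mem_frontier_norm_le (U := ball (0 : ℂ) R) isBounded_ball
      hGd.diffContOnCl (fun w hw => ?_) (by rwa [closure_ball _ hR.ne'])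
    rw [frontier_ball _ hR.ne', mem_sphere_zero_iff_norm] at hw
    rw [hsphere w hw]
    exact hb w (by simp [hw])
  have hmne : ∀ ρ ∈ Z, ρ ≠ 0 := by
    rintro ρ hρ rfl
    exact h0 ((hZ 0).1 hρ).1
  set N : ℝ := ∑ ρ ∈ Z, (m ρ : ℝ) with hN
  have hlogpos : 0 < Real.log (R / r₂) := Real.log_pos ((one_lt_div hr₂).2 h₃)
  -- At the origin a reflected factor has modulus `R` and the original one has modulus at most `r₂`,
  -- so each zero gains `R / r₂`. Against the maximum principle for `G` this is Jensen's bound on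
  -- the count.
  have hG0 : ‖f 0‖ * Real.exp (N * Real.log (R / r₂)) ≤ ‖G 0‖ := by
    have e1 : ‖G 0‖ = (∏ ρ ∈ Z, R ^ m ρ) * ‖g 0‖ := by
      rw [hG, norm_mul, hB, norm_prod]
      congr 1
      refine Finset.prod_congr rfl fun ρ _ => ?_
      rw [norm_pow, mul_zero, sub_zero, norm_div, norm_pow, Complex.norm_real,
        Real.norm_of_nonneg hR.le]
      congr 1
      field_simp
    have e2 : ‖f 0‖ = (∏ ρ ∈ Z, ‖ρ‖ ^ m ρ) * ‖g 0‖ := by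
      rw [hfg 0, norm_mul, norm_prod]
      congr 1
      refine Finset.prod_congr rfl fun ρ _ => ?_
      rw [norm_pow, zero_sub, norm_neg]
    have e3 : Real.exp (N * Real.log (R / r₂)) = ∏ ρ ∈ Z, (R / r₂) ^ m ρ := by
      rw [hN, Finset.sum_mul, Real.exp_sum]
      refine Finset.prod_congr rfl fun ρ _ => ?_
      rw [mul_comm, Real.exp_mul, Real.exp_log (by positivity), Real.rpow_natCast]
    rw [e1, e2, e3, mul_right_comm, ← Finset.prod_mul_distrib]
    refine mul_le_mul_of_nonneg_right (Finset.prod_le_prod (fun _ _ => by positivity) ?_)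
      (norm_nonneg _)
    intro ρ hρ
    rw [← mul_pow]
    refine pow_le_pow_left₀ (by positivity) ?_ _
    have := ((hZ ρ).1 hρ).2
    rw [mul_div_assoc', div_le_iff₀ hr₂]
    nlinarith
  have hf0 : 0 < ‖f 0‖ := norm_pos_iff.2 h0
  have hN0 : 0 ≤ N := Finset.sum_nonneg fun _ _ => by positivity
  have hcount : N * Real.log (R / r₂) ≤ M := by
    have h1 := hG0.trans (hGb 0 (by simp [hR.le]))
    rw [mul_comm (‖f 0‖)] at h1
    exact Real.exp_le_exp.1 (le_of_mul_le_mul_right h1 hf0)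
  refine ⟨hcount, fun z hz hfz => ?_⟩
  have hgne : ∀ w ∈ ball (0 : ℂ) r₂, g w ≠ 0 := by
    intro w hw hgw
    have : f w = 0 := by rw [hfg, hgw, mul_zero]
    exact hgZ w ((hZ w).2 ⟨this, (mem_ball_zero_iff.1 hw).le⟩) hgw
  have hGne : ∀ w ∈ ball (0 : ℂ) r₂, G w ≠ 0 := fun w hw =>
    mul_ne_zero (hBne w ((mem_ball_zero_iff.1 hw).le.trans h₃.le)) (hgne w hw)
  have hfG0 : ‖f 0‖ ≤ ‖G 0‖ := by
    refine le_trans ?_ hG0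
    exact le_mul_of_one_le_right hf0.le (Real.one_le_exp (by positivity))
  have hlG := norm_logDeriv_le_of_ne_zero hGd h₁ h₂ hM hGne
    (fun w hw => (hGb w (by
      rw [mem_closedBall_zero_iff]; exact (mem_ball_zero_iff.1 hw).le.trans h₃.le)).trans
      (by gcongr)) hz
  have hzZ : z ∉ Z := fun h => hfz ((hZ z).1 h).1
  have hzr₂ : z ∈ ball (0 : ℂ) r₂ := mem_ball_zero_iff.2 (hz.trans_lt h₂)
  have hzR : ‖z‖ ≤ R := by linarith
  have e1 := logDeriv_eq_polePart_add hg hfg hzZ (hgne z hzr₂)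
  have e2 : logDeriv G z = logDeriv B z + logDeriv g z :=
    logDeriv_mul z (hBne z hzR) (hgne z hzr₂) (hBd z) (hg z)
  have e3 : logDeriv B z = ∑ ρ ∈ Z, (m ρ : ℂ) *
      (-(starRingEnd ℂ) ρ / ((R : ℂ) ^ 2 - (starRingEnd ℂ) ρ * z)) := by
    rw [hB, logDeriv_prod (f := fun ρ z => (((R : ℂ) ^ 2 - (starRingEnd ℂ) ρ * z) / R) ^ m ρ)
      (fun ρ hρ => pow_ne_zero _ (div_ne_zero (hfacne ρ hρ z hzR) hRc)) (fun ρ _ => by fun_prop)]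
    refine Finset.sum_congr rfl fun ρ hρ => ?_
    rw [logDeriv_fun_pow (f := fun z => ((R : ℂ) ^ 2 - (starRingEnd ℂ) ρ * z) / R) (by fun_prop)]
    congr 1
    rw [logDeriv_apply]
    have hd : HasDerivAt (fun z => ((R : ℂ) ^ 2 - (starRingEnd ℂ) ρ * z) / R)
        (-(starRingEnd ℂ) ρ / R) z := by
      have := (((hasDerivAt_id z).const_mul ((starRingEnd ℂ) ρ)).const_sub ((R : ℂ) ^ 2)).div_const
        (R : ℂ)
      simpa using this
    rw [hd.deriv]
    have := hfacne ρ hρ z hzR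
    field_simp
  have e4 : ‖logDeriv B z‖ ≤ N * (1 / (R - r₂)) := by
    rw [e3, hN, Finset.sum_mul]
    refine (norm_sum_le _ _).trans (Finset.sum_le_sum fun ρ hρ => ?_)
    rw [norm_mul, Complex.norm_natCast, norm_div, norm_neg, RCLike.norm_conj]
    refine mul_le_mul_of_nonneg_left ?_ (by positivity)
    have h1 := hfac ρ hρ z hzR
    have h2 := ((hZ ρ).1 hρ).2
    have h3 : 0 < R - r₂ := by linarith
    rw [div_le_div_iff₀ (hRr.trans_le h1) h3]
    nlinarith [norm_nonneg ρ]
  have e5 : N * (1 / (R - r₂)) ≤ 1 / ((R - r₂) * Real.log (R / r₂)) * M := by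
    have h3 : 0 < R - r₂ := by linarith
    have h5 : N ≤ M / Real.log (R / r₂) := by rwa [le_div_iff₀ hlogpos]
    calc N * (1 / (R - r₂)) ≤ M / Real.log (R / r₂) * (1 / (R - r₂)) := by gcongr
      _ = 1 / ((R - r₂) * Real.log (R / r₂)) * M := by field_simp
  have e6 : logDeriv f z - polePart f Z z = logDeriv G z - logDeriv B z := by
    rw [e1, e2]; ring
  rw [e6, add_mul]
  exact (norm_sub_le _ _).trans (add_le_add hlG (e4.trans e5))

end Factorization

end HalfIsolated

namespace HalfIsolated

/-! ### Translation of Landau's lemma to discs with arbitrary centre. -/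

section Landau

open Complex Metric Set Filter Topology

lemma analyticOrderNatAt_comp_add_left (f : ℂ → ℂ) (c ρ : ℂ) :
    analyticOrderNatAt (fun z => f (c + z)) ρ = analyticOrderNatAt f (c + ρ) := by
  have hg : AnalyticAt ℂ (fun z : ℂ => c + z) ρ := by fun_prop
  have hd : deriv (fun z : ℂ => c + z) ρ ≠ 0 := by simp
  have := analyticOrderAt_comp_of_deriv_ne_zero (f := f) hg hd
  rw [analyticOrderNatAt, analyticOrderNatAt, ← this]
  rfl

lemma landau {f : ℂ → ℂ} (hf : Differentiable ℂ f) {r₁ r₂ R M : ℝ} (h₁ : 0 < r₁)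
    (h₂ : r₁ < r₂) (h₃ : r₂ < R) (hM : 0 < M) (c : ℂ) (h0 : f c ≠ 0)
    (hb : ∀ z ∈ closedBall c R, ‖f z‖ ≤ Real.exp M * ‖f c‖) {Z : Finset ℂ}
    (hZ : ∀ z, z ∈ Z ↔ f z = 0 ∧ ‖z - c‖ ≤ r₂) :
    (∑ ρ ∈ Z, (analyticOrderNatAt f ρ : ℝ)) * Real.log (R / r₂) ≤ M ∧
    ∀ z, ‖z - c‖ ≤ r₁ → f z ≠ 0 → ‖logDeriv f z - polePart f Z z‖ ≤
      (8 * r₂ / (r₂ - r₁) ^ 2 + 1 / ((R - r₂) * Real.log (R / r₂))) * M := by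
  classical
  have hfd : Differentiable ℂ (fun z => f (c + z)) := by fun_prop
  have hinj : Function.Injective (fun z : ℂ => c + z) := add_right_injective c
  set Z' : Finset ℂ := Z.image (fun z => z - c) with hZ'
  have hZeq : Z = Z'.map ⟨fun z => c + z, hinj⟩ := by
    ext z
    simp [hZ']
  have key := landau_zero hfd h₁ h₂ h₃ hM (by simpa using h0) (fun z hz => by
    simpa using hb (c + z) (by simpa [dist_eq_norm] using hz)) (Z := Z') (by
      intro z
      have h : z ∈ Z' ↔ c + z ∈ Z := by
        rw [hZ', Finset.mem_image]
        constructor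
        · rintro ⟨w, hw, rfl⟩; simpa using hw
        · intro h; exact ⟨_, h, by ring⟩
      rw [h, hZ]
      simp)
  constructor
  · rw [hZeq, Finset.sum_map]
    simpa [analyticOrderNatAt_comp_add_left] using key.1
  · intro z hz hfz
    have := key.2 (z - c) hz (by simpa using hfz)
    have e1 : logDeriv (fun z => f (c + z)) (z - c) = logDeriv f z := by
      rw [logDeriv_apply, logDeriv_apply, deriv_comp_const_add]
      simp
    have e2 : polePart (fun z => f (c + z)) Z' (z - c) = polePart f Z z := by
      rw [polePart, polePart]
      conv_rhs => rw [hZeq]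
      rw [Finset.sum_map]
      refine Finset.sum_congr rfl fun ρ _ => ?_
      rw [analyticOrderNatAt_comp_add_left]
      simp only [Function.Embedding.coeFn_mk]
      congr 1; ring
    rwa [e1, e2] at this

end Landau

/-! ### Cauchy's theorem and the residue theorem on rectangles. -/

section Rectangle

open Complex Set

/-- The integral of `F` along the boundary of `[a, b] × [c, d]`, counterclockwise. -/
noncomputable def rectInt (F : ℂ → ℂ) (a b c d : ℝ) : ℂ :=
  (∫ x : ℝ in a..b, F (x + c * I)) - (∫ x : ℝ in a..b, F (x + d * I)) +
    I * (∫ y : ℝ in c..d, F (b + y * I)) - I * ∫ y : ℝ in c..d, F (a + y * I)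

/-- The boundary of the rectangle `[a, b] × [c, d]`. -/
def rectBoundary (a b c d : ℝ) : Set ℂ :=
  {z | z ∈ Icc a b ×ℂ Icc c d ∧ (z.re = a ∨ z.re = b ∨ z.im = c ∨ z.im = d)}

variable {a b c d : ℝ}

lemma mem_rectBoundary_horizontal (hcd : c ≤ d) {x y : ℝ} (hx : x ∈ Icc a b)
    (hy : y = c ∨ y = d) : (x : ℂ) + y * I ∈ rectBoundary a b c d := by
  refine ⟨?_, ?_⟩
  · rw [mem_reProdIm]
    rcases hy with rfl | rfl <;> simp [hcd, hx.1, hx.2]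
  · rcases hy with rfl | rfl <;> simp

lemma mem_rectBoundary_vertical (hab : a ≤ b) {x y : ℝ} (hy : y ∈ Icc c d)
    (hx : x = a ∨ x = b) : (x : ℂ) + y * I ∈ rectBoundary a b c d := by
  refine ⟨?_, ?_⟩
  · rw [mem_reProdIm]
    rcases hx with rfl | rfl <;> simp [hab, hy.1, hy.2]
  · rcases hx with rfl | rfl <;> simp

lemma rectInt_congr (hab : a ≤ b) (hcd : c ≤ d) {F G : ℂ → ℂ}
    (h : EqOn F G (rectBoundary a b c d)) : rectInt F a b c d = rectInt G a b c d := by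
  have h1 : ∀ y, y = c ∨ y = d → (∫ x : ℝ in a..b, F (x + y * I)) = ∫ x : ℝ in a..b, G (x + y * I) := by
    intro y hy
    refine intervalIntegral.integral_congr fun x hx => ?_
    rw [uIcc_of_le hab] at hx
    exact h (mem_rectBoundary_horizontal hcd hx hy)
  have h2 : ∀ x, x = a ∨ x = b → (∫ y : ℝ in c..d, F (x + y * I)) = ∫ y : ℝ in c..d, G (x + y * I) := by
    intro y hy
    refine intervalIntegral.integral_congr fun x hx => ?_
    rw [uIcc_of_le hcd] at hx
    exact h (mem_rectBoundary_vertical hab hx hy)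
  rw [rectInt, rectInt, h1 c (Or.inl rfl), h1 d (Or.inr rfl), h2 a (Or.inl rfl), h2 b (Or.inr rfl)]

lemma intervalIntegrable_horizontal (hab : a ≤ b) (hcd : c ≤ d) {F : ℂ → ℂ}
    (h : ContinuousOn F (rectBoundary a b c d)) {y : ℝ} (hy : y = c ∨ y = d) :
    IntervalIntegrable (fun x : ℝ => F (x + y * I)) MeasureTheory.volume a b := by
  refine ContinuousOn.intervalIntegrable ?_
  rw [uIcc_of_le hab]
  exact h.comp (by fun_prop) fun x hx => mem_rectBoundary_horizontal hcd hx hy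

lemma intervalIntegrable_vertical (hab : a ≤ b) (hcd : c ≤ d) {F : ℂ → ℂ}
    (h : ContinuousOn F (rectBoundary a b c d)) {x : ℝ} (hx : x = a ∨ x = b) :
    IntervalIntegrable (fun y : ℝ => F (x + y * I)) MeasureTheory.volume c d := by
  refine ContinuousOn.intervalIntegrable ?_
  rw [uIcc_of_le hcd]
  exact h.comp (by fun_prop) fun y hy => mem_rectBoundary_vertical hab hy hx

lemma rectInt_add (hab : a ≤ b) (hcd : c ≤ d) {F G : ℂ → ℂ}
    (hF : ContinuousOn F (rectBoundary a b c d)) (hG : ContinuousOn G (rectBoundary a b c d)) :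
    rectInt (fun z => F z + G z) a b c d = rectInt F a b c d + rectInt G a b c d := by
  unfold rectInt
  have h1 := fun y (hy : y = c ∨ y = d) => intervalIntegral.integral_add
    (intervalIntegrable_horizontal hab hcd hF hy) (intervalIntegrable_horizontal hab hcd hG hy)
  have h2 := fun x (hx : x = a ∨ x = b) => intervalIntegral.integral_add
    (intervalIntegrable_vertical hab hcd hF hx) (intervalIntegrable_vertical hab hcd hG hx)
  rw [h1 c (Or.inl rfl), h1 d (Or.inr rfl), h2 a (Or.inl rfl), h2 b (Or.inr rfl)]
  ring

lemma rectInt_const_mul (k : ℂ) (F : ℂ → ℂ) :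
    rectInt (fun z => k * F z) a b c d = k * rectInt F a b c d := by
  simp only [rectInt, intervalIntegral.integral_const_mul]
  ring

lemma rectInt_finset_sum (hab : a ≤ b) (hcd : c ≤ d) {ι : Type*} (s : Finset ι) (F : ι → ℂ → ℂ)
    (hF : ∀ i ∈ s, ContinuousOn (F i) (rectBoundary a b c d)) :
    rectInt (fun z => ∑ i ∈ s, F i z) a b c d = ∑ i ∈ s, rectInt (F i) a b c d := by
  classical
  induction s using Finset.induction_on with
  | empty => simp [rectInt]
  | insert i s hi ih =>
    simp only [Finset.sum_insert hi]
    rw [rectInt_add hab hcd (hF i (by simp)), ih (fun j hj => hF j (by simp [hj]))]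
    exact continuousOn_finsetSum _ fun j hj => hF j (by simp [hj])

lemma rectInt_eq_zero (hab : a ≤ b) (hcd : c ≤ d) {F : ℂ → ℂ}
    (h : DifferentiableOn ℂ F (Icc a b ×ℂ Icc c d)) : rectInt F a b c d = 0 := by
  have := integral_boundary_rect_eq_zero_of_differentiableOn F (a + c * I) (b + d * I)
    (by simpa [uIcc_of_le hab, uIcc_of_le hcd] using h)
  simpa [rectInt] using this

lemma log_neg_of_im_pos {z : ℂ} (hz : 0 < z.im) : log (-z) = log z - Real.pi * I := by
  rw [log, log, norm_neg, arg_neg_eq_arg_sub_pi_of_im_pos hz]; push_cast; ring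

lemma log_neg_of_im_neg {z : ℂ} (hz : z.im < 0) : log (-z) = log z + Real.pi * I := by
  rw [log, log, norm_neg, arg_neg_eq_arg_add_pi_of_im_neg hz]; push_cast; ring

/-- Three sides avoid the branch cut and have `log (z - ρ)` as primitive. The left side crosses the
cut, so `log (-(z - ρ))` is used there; the two primitives differ by `±π i` at the left corners,
which adds up to `2 π i`. -/
lemma rectInt_inv_sub {ρ : ℂ} (h₁ : a < ρ.re) (h₂ : ρ.re < b) (h₃ : c < ρ.im) (h₄ : ρ.im < d) :
    rectInt (fun z => 1 / (z - ρ)) a b c d = 2 * Real.pi * I := by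
  have hor : ∀ y : ℝ, y ≠ ρ.im → (∫ x : ℝ in a..b, 1 / ((x : ℂ) + y * I - ρ)) =
      log (b + y * I - ρ) - log (a + y * I - ρ) := by
    intro y hy
    have hs : ∀ x : ℝ, (x : ℂ) + y * I - ρ ∈ slitPlane := fun x =>
      Or.inr (by simpa [sub_eq_zero] using hy)
    refine intervalIntegral.integral_eq_sub_of_hasDerivAt
      (f := fun x : ℝ => log ((x : ℂ) + y * I - ρ)) (fun x _ => ?_) ?_
    · have h : HasDerivAt (fun x : ℝ => (x : ℂ) + y * I - ρ) 1 x :=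
        ((ofRealCLM.hasDerivAt).add_const _).sub_const _
      exact h.clog_real (hs x)
    · refine ContinuousOn.intervalIntegrable (ContinuousOn.div continuousOn_const
        (by fun_prop) fun x _ => slitPlane_ne_zero (hs x))
  have hver : (∫ y : ℝ in c..d, 1 / ((b : ℂ) + y * I - ρ)) =
      -I * (log (b + d * I - ρ) - log (b + c * I - ρ)) := by
    have hs : ∀ y : ℝ, (b : ℂ) + y * I - ρ ∈ slitPlane := fun x => Or.inl (by simpa using h₂)
    rw [mul_sub]
    refine intervalIntegral.integral_eq_sub_of_hasDerivAt
      (f := fun y : ℝ => -I * log ((b : ℂ) + y * I - ρ)) (fun x _ => ?_) ?_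
    · have h : HasDerivAt (fun y : ℝ => (b : ℂ) + y * I - ρ) I x := by
        have := (((ofRealCLM.hasDerivAt (x := x)).mul_const I).const_add (b : ℂ)).sub_const ρ
        simpa using this
      refine ((h.clog_real (hs x)).const_mul (-I)).congr_deriv ?_
      rw [← mul_div_assoc]; simp
    · refine ContinuousOn.intervalIntegrable (ContinuousOn.div continuousOn_const
        (by fun_prop) fun x _ => slitPlane_ne_zero (hs x))
  have hvel : (∫ y : ℝ in c..d, 1 / ((a : ℂ) + y * I - ρ)) =
      -I * (log (-(a + d * I - ρ)) - log (-(a + c * I - ρ))) := by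
    have hs : ∀ y : ℝ, -((a : ℂ) + y * I - ρ) ∈ slitPlane := fun x => Or.inl (by simpa using h₁)
    rw [mul_sub]
    refine intervalIntegral.integral_eq_sub_of_hasDerivAt
      (f := fun y : ℝ => -I * log (-((a : ℂ) + y * I - ρ))) (fun x _ => ?_) ?_
    · have h : HasDerivAt (fun y : ℝ => -((a : ℂ) + y * I - ρ)) (-I) x := by
        have h1 : HasDerivAt (fun y : ℝ => (a : ℂ) + y * I - ρ) I x := by
          simpa using (((ofRealCLM.hasDerivAt (x := x)).mul_const I).const_add (a : ℂ)).sub_const ρ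
        exact h1.fun_neg
      refine ((h.clog_real (hs x)).const_mul (-I)).congr_deriv ?_
      rw [← mul_div_assoc, neg_mul_neg, I_mul_I, neg_div_neg_eq]
    · refine ContinuousOn.intervalIntegrable (ContinuousOn.div continuousOn_const
        (by fun_prop) fun x _ => ?_)
      exact neg_ne_zero.1 (slitPlane_ne_zero (hs x))
  rw [rectInt, hor c h₃.ne, hor d h₄.ne', hver, hvel,
    log_neg_of_im_pos (z := a + d * I - ρ) (by simpa using h₄),
    log_neg_of_im_neg (z := a + c * I - ρ) (by simpa using h₃)]
  linear_combination (log (b + c * I - ρ) - log (a + c * I - ρ) - log (b + d * I - ρ) +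
    log (a + d * I - ρ) - 2 * Real.pi * I) * I_sq

/-- Subtracting `φ ρ / (z - ρ)` leaves the divided slope of `φ`, which is holomorphic across `ρ` and
integrates to zero. -/
lemma rectInt_div_sub (hab : a ≤ b) (hcd : c ≤ d) {φ : ℂ → ℂ} {U : Set ℂ} (hU : IsOpen U)
    (hsub : Icc a b ×ℂ Icc c d ⊆ U) (hφ : DifferentiableOn ℂ φ U) {ρ : ℂ}
    (h₁ : a < ρ.re) (h₂ : ρ.re < b) (h₃ : c < ρ.im) (h₄ : ρ.im < d) :
    rectInt (fun z => φ z / (z - ρ)) a b c d = 2 * Real.pi * I * φ ρ := by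
  have hρU : ρ ∈ U := hsub ⟨⟨h₁.le, h₂.le⟩, ⟨h₃.le, h₄.le⟩⟩
  have hds : DifferentiableOn ℂ (dslope φ ρ) U :=
    (differentiableOn_dslope (hU.mem_nhds hρU)).2 hφ
  have hne : ∀ z ∈ rectBoundary a b c d, z - ρ ≠ 0 := by
    rintro z ⟨_, hz⟩ h
    rw [sub_eq_zero] at h
    subst h
    rcases hz with h | h | h | h <;> linarith
  have hbU : rectBoundary a b c d ⊆ U := fun z hz => hsub hz.1
  have hcong : EqOn (fun z => φ z / (z - ρ)) (fun z => dslope φ ρ z + φ ρ * (1 / (z - ρ)))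
      (rectBoundary a b c d) := by
    intro z hz
    have := sub_smul_dslope φ ρ z
    simp only [smul_eq_mul] at this
    have h0 := hne z hz
    field_simp
    linear_combination -this
  have hcont : ContinuousOn (fun z => φ ρ * (1 / (z - ρ))) (rectBoundary a b c d) :=
    continuousOn_const.mul (ContinuousOn.div continuousOn_const (by fun_prop) hne)
  rw [rectInt_congr hab hcd hcong, rectInt_add hab hcd (hds.continuousOn.mono hbU) hcont,
    rectInt_eq_zero hab hcd (hds.mono hsub), rectInt_const_mul, rectInt_inv_sub h₁ h₂ h₃ h₄]
  ring

/-- The residue theorem for `φ f'/f` on a rectangle whose boundary contains no zero of `f`. -/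
lemma rectInt_mul_logDeriv (hab : a ≤ b) (hcd : c ≤ d) {φ f : ℂ → ℂ} {U : Set ℂ} (hU : IsOpen U)
    (hsub : Icc a b ×ℂ Icc c d ⊆ U) (hφ : DifferentiableOn ℂ φ U) (hf : Differentiable ℂ f)
    {Z : Finset ℂ} (hZ : ∀ z, z ∈ Z ↔ f z = 0 ∧ z ∈ Icc a b ×ℂ Icc c d)
    (hbd : ∀ z ∈ rectBoundary a b c d, f z ≠ 0) :
    rectInt (fun z => φ z * logDeriv f z) a b c d =
      2 * Real.pi * I * ∑ ρ ∈ Z, (analyticOrderNatAt f ρ : ℂ) * φ ρ := by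
  have hne : f (a + c * I) ≠ 0 :=
    hbd _ (mem_rectBoundary_horizontal hcd (left_mem_Icc.2 hab) (Or.inl rfl))
  obtain ⟨g, hg, hgZ, hfg⟩ := exists_factor hf hne Z
  have hgne : ∀ z ∈ Icc a b ×ℂ Icc c d, g z ≠ 0 := by
    intro z hz h
    exact hgZ z ((hZ z).2 ⟨by rw [hfg, h, mul_zero], hz⟩) h
  have hint : ∀ ρ ∈ Z, a < ρ.re ∧ ρ.re < b ∧ c < ρ.im ∧ ρ.im < d := by
    intro ρ hρ
    obtain ⟨h0, hρm⟩ := (hZ ρ).1 hρ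
    have hnb : ¬ (ρ.re = a ∨ ρ.re = b ∨ ρ.im = c ∨ ρ.im = d) := fun h => hbd ρ ⟨hρm, h⟩ h0
    obtain ⟨⟨p1, p2⟩, ⟨p3, p4⟩⟩ := hρm
    simp only [not_or] at hnb
    obtain ⟨n1, n2, n3, n4⟩ := hnb
    exact ⟨lt_of_le_of_ne p1 (Ne.symm n1), lt_of_le_of_ne p2 n2, lt_of_le_of_ne p3 (Ne.symm n3),
      lt_of_le_of_ne p4 n4⟩
  have hbZ : ∀ z ∈ rectBoundary a b c d, z ∉ Z := fun z hz h => hbd z hz ((hZ z).1 h).1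
  have hbU : rectBoundary a b c d ⊆ U := fun z hz => hsub hz.1
  have hlg : DifferentiableOn ℂ (fun z => φ z * logDeriv g z) (Icc a b ×ℂ Icc c d) := by
    refine (hφ.mono hsub).mul fun z hz => ?_
    have h1 : DifferentiableAt ℂ (deriv g) z := (hg.analyticAt z).deriv.differentiableAt
    exact (h1.div (hg z) (hgne z hz)).differentiableWithinAt
  have hcong : EqOn (fun z => φ z * logDeriv f z) (fun z =>
      (∑ ρ ∈ Z, (analyticOrderNatAt f ρ : ℂ) * (φ z / (z - ρ))) + φ z * logDeriv g z)
      (rectBoundary a b c d) := by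
    intro z hz
    simp only
    rw [logDeriv_eq_polePart_add hg hfg (hbZ z hz) (hgne z hz.1), mul_add, polePart,
      Finset.mul_sum]
    congr 1
    exact Finset.sum_congr rfl fun ρ _ => by ring
  have hcont : ∀ ρ ∈ Z, ContinuousOn (fun z => (analyticOrderNatAt f ρ : ℂ) * (φ z / (z - ρ)))
      (rectBoundary a b c d) := by
    intro ρ hρ
    refine continuousOn_const.mul ((hφ.continuousOn.mono hbU).div (by fun_prop) fun z hz => ?_)
    rw [sub_ne_zero]
    rintro rfl
    exact hbZ z hz hρ
  rw [rectInt_congr hab hcd hcong, rectInt_add hab hcd (continuousOn_finsetSum _ hcont)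
    (hlg.continuousOn.mono fun z hz => hz.1), rectInt_eq_zero hab hcd hlg, add_zero,
    rectInt_finset_sum hab hcd _ _ hcont, Finset.mul_sum]
  refine Finset.sum_congr rfl fun ρ hρ => ?_
  obtain ⟨i1, i2, i3, i4⟩ := hint ρ hρ
  rw [rectInt_const_mul, rectInt_div_sub hab hcd hU hsub hφ i1 i2 i3 i4]
  ring

end Rectangle

end HalfIsolated

namespace HalfIsolated

/-! ### A two-constants theorem for one-sided exponential sums. -/

section OneSided

open Complex Metric Set Filter Topology

/-- The derivative of `arg (z - t)` in `t` is the Poisson kernel, so this is the mean value theorem.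
It makes subtended angles accessible to rational estimates. -/
lemma exists_arg_sub_arg_eq {z : ℂ} (hz : 0 < z.im) {a b : ℝ} (hab : a < b) :
    ∃ t ∈ Ioo a b, (z - b).arg - (z - a).arg =
      (b - a) * (z.im / (z.im ^ 2 + (z.re - t) ^ 2)) := by
  have hs : ∀ t : ℝ, z - t ∈ slitPlane := fun t => Or.inr (by simpa using hz.ne')
  have hd : ∀ t : ℝ, HasDerivAt (fun t : ℝ => (log (z - t)).im)
      (z.im / (z.im ^ 2 + (z.re - t) ^ 2)) t := by
    intro t
    have h1 : HasDerivAt (fun t : ℝ => z - (t : ℂ)) (-1) t := by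
      simpa using (ofRealCLM.hasDerivAt (x := t)).const_sub z
    have h2 := h1.clog_real (hs t)
    have h3 := (imCLM.hasFDerivAt.comp_hasDerivAt t h2)
    refine h3.congr_deriv ?_
    simp only [imCLM_apply, div_im, neg_im, one_im, neg_re, one_re, sub_re, ofReal_re, sub_im,
      ofReal_im, normSq_apply]
    ring
  obtain ⟨t, ht, h⟩ := exists_hasDerivAt_eq_slope _ _ hab
    (fun t _ => (hd t).continuousAt.continuousWithinAt) (fun t _ => hd t)
  refine ⟨t, ht, ?_⟩
  rw [h]
  have : b - a ≠ 0 := by linarith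
  simp only [log_im]
  field_simp

/-- An approximate harmonic measure of `[1, 1.6]` in a rectangle of the upper half-plane, with its
value at `1.3 i` bounded below. -/
lemma exists_barrier : ∃ q : ℂ → ℂ, (∀ w : ℂ, 0 ≤ w.im → DifferentiableAt ℂ q w) ∧
    (∀ w : ℂ, 0 ≤ w.im → (q w).re ≤ 1) ∧ 0 ≤ (q (13 / 10 * I)).re ∧
    ∀ w : ℂ, 0 ≤ w.im → ((w.re ≤ 1 ∨ 8 / 5 ≤ w.re) ∧ w.im = 0 ∨ w.im = 50 ∨ |w.re| = 50) →
      (q w).re ≤ (q (13 / 10 * I)).re - 1 / 20 := by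
  -- The real part of `q` is the angle subtended by `[1.02, 1.58]` at `w + iη`, divided by `π`. The
  -- shift by `η` puts the branch points below the real axis, so `q` is holomorphic up to the
  -- boundary. The margin `1/50` inside `[1, 1.6]` keeps the kernel small on the rest of the axis.
  set η : ℝ := 1 / 100000 with hη
  set q : ℂ → ℂ := fun w => -(I / Real.pi) *
    (log (w + η * I - (79 / 50 : ℝ)) - log (w + η * I - (51 / 50 : ℝ))) with hq
  have hqre : ∀ w, (q w).re = ((w + η * I - (79 / 50 : ℝ)).arg -
      (w + η * I - (51 / 50 : ℝ)).arg) / Real.pi := by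
    intro w
    have : (-(I / Real.pi) : ℂ) = ((1 / Real.pi : ℝ) : ℂ) * (-I) := by push_cast; ring
    rw [hq]
    simp only
    rw [this, mul_assoc, re_ofReal_mul]
    simp only [neg_mul, neg_re, I_mul_re, neg_neg, sub_im, log_im]
    ring
  have hdq : ∀ w : ℂ, 0 ≤ w.im → DifferentiableAt ℂ q w := by
    intro w hw
    have h1 : ∀ t : ℝ, w + η * I - t ∈ slitPlane := fun t =>
      Or.inr (by simp; rw [hη]; positivity)
    have h2 : ∀ t : ℝ, DifferentiableAt ℂ (fun w : ℂ => log (w + η * I - t)) w := fun t =>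
      DifferentiableAt.clog (by fun_prop) (h1 t)
    exact ((h2 _).sub (h2 _)).const_mul _
  have hpi3 := Real.pi_gt_d2
  have hpi4 := Real.pi_lt_d2
  have hqle : ∀ w : ℂ, 0 ≤ w.im → (q w).re ≤ 1 := by
    intro w hw
    rw [hqre, div_le_one Real.pi_pos]
    have h1 := arg_le_pi (w + η * I - (79 / 50 : ℝ))
    have h2 : 0 ≤ (w + η * I - (51 / 50 : ℝ)).arg := by
      rw [arg_nonneg_iff]; simp; rw [hη]; positivity
    linarith
  have hker : ∀ w : ℂ, 0 ≤ w.im → ∃ t ∈ Ioo (51 / 50 : ℝ) (79 / 50), Real.pi * (q w).re =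
      14 / 25 * ((w.im + η) / ((w.im + η) ^ 2 + (w.re - t) ^ 2)) := by
    intro w hw
    obtain ⟨t, ht, h⟩ := exists_arg_sub_arg_eq (z := w + η * I) (by simp; rw [hη]; positivity)
      (show (51 / 50 : ℝ) < 79 / 50 by norm_num)
    refine ⟨t, ht, ?_⟩
    rw [hqre, mul_div_cancel₀ _ Real.pi_ne_zero, h]
    norm_num
  set w₁ : ℂ := 13 / 10 * I with hw₁
  have hw₁im : w₁.im = 13 / 10 := by rw [hw₁]; norm_num
  have hw₁re : w₁.re = 0 := by rw [hw₁]; norm_num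
  -- The value at `1.3 i` is at least `0.56 · 1.3 / (1.3² + 1.58²)` up to the shift by `η`. Off the
  -- interval the bound is `0.0142`, and the difference `0.1596` exceeds `π / 20`.
  have hpt : 0.1738 ≤ Real.pi * (q w₁).re := by
    obtain ⟨t, ht, h⟩ := hker w₁ (by rw [hw₁im]; norm_num)
    rw [h, hw₁im, hw₁re, hη, mul_div_assoc', le_div_iff₀ (by positivity)]
    have : t ^ 2 ≤ (79 / 50) ^ 2 := by
      have := ht.1; have := ht.2
      exact pow_le_pow_left₀ (by linarith) this.le 2
    nlinarith
  have hoff : ∀ w : ℂ, 0 ≤ w.im → ((w.re ≤ 1 ∨ 8 / 5 ≤ w.re) ∧ w.im = 0 ∨ w.im = 50 ∨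
      |w.re| = 50) → Real.pi * (q w).re ≤ 0.0142 := by
    intro w hw hcase
    obtain ⟨t, ht, h⟩ := hker w hw
    have ht1 := ht.1
    have ht2 := ht.2
    have hpos : 0 < (w.im + η) ^ 2 + (w.re - t) ^ 2 := by
      have : 0 < w.im + η := by rw [hη]; positivity
      positivity
    rw [h, mul_div_assoc', div_le_iff₀ hpos]
    rcases hcase with ⟨hre, him⟩ | him | hre
    · have : (1 / 50) ^ 2 ≤ (w.re - t) ^ 2 := by
        rcases hre with h1 | h1 <;> nlinarith
      rw [him, hη]
      nlinarith
    · rw [him, hη]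
      nlinarith [sq_nonneg (w.re - t)]
    · have h48 : 48 ^ 2 ≤ (w.re - t) ^ 2 := by
        rcases (abs_eq (by norm_num : (0 : ℝ) ≤ 50)).1 hre with h1 | h1 <;> rw [h1] <;> nlinarith
      nlinarith [sq_nonneg ((w.im + η) - 48)]
  refine ⟨q, hdq, hqle, ?_, fun w hw hcase => ?_⟩
  · by_contra! hne
    have := mul_neg_of_pos_of_neg Real.pi_pos hne
    linarith
  · by_contra! hne
    have h1 := hoff w hw hcase
    have h2 := mul_lt_mul_of_pos_left hne Real.pi_pos
    rw [mul_sub] at h2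
    linarith

/-- One-sidedness enters here: `Re (s w) = Re s Re w - Im s Im w` and the second product is
nonnegative, so only `Re s Re w ≤ 5` counts. -/
lemma norm_sum_exp_le {ι : Type*} (Z : Finset ι) (a s : ι → ℂ) {M : ℝ}
    (hs : ∀ i ∈ Z, 0 ≤ (s i).im ∧ |(s i).re| ≤ 1 / 10) (hM : ∑ i ∈ Z, ‖a i‖ ≤ M) {w : ℂ}
    (hw : 0 ≤ w.im) (hwre : |w.re| ≤ 50) :
    ‖∑ i ∈ Z, a i * exp (s i * w)‖ ≤ Real.exp 5 * M := by
  refine (norm_sum_le _ _).trans ?_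
  calc ∑ i ∈ Z, ‖a i * exp (s i * w)‖ ≤ ∑ i ∈ Z, ‖a i‖ * Real.exp 5 := by
        refine Finset.sum_le_sum fun i hi => ?_
        rw [norm_mul, Complex.norm_exp]
        refine mul_le_mul_of_nonneg_left (Real.exp_le_exp.2 ?_) (norm_nonneg _)
        rw [mul_re]
        have h1 := mul_nonneg (hs i hi).1 hw
        have h2 : (s i).re * w.re ≤ 1 / 10 * 50 := by
          refine (le_abs_self _).trans ?_
          rw [abs_mul]
          exact mul_le_mul (hs i hi).2 hwre (abs_nonneg _) (by norm_num)
        linarith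
    _ ≤ Real.exp 5 * M := by
        rw [← Finset.sum_mul, mul_comm]
        gcongr

/-- A sum of exponentials `∑ aᵢ exp (sᵢ w)` with `Im sᵢ ≥ 0` and `|Re sᵢ| ≤ 1/10` which is not
small at the point `1.3 i` is not small at some point of the interval `[1, 1.6]`. -/
lemma exists_norm_sum_exp_ge {ι : Type*} (Z : Finset ι) (a s : ι → ℂ) {M c₀ : ℝ}
    (hs : ∀ i ∈ Z, 0 ≤ (s i).im ∧ |(s i).re| ≤ 1 / 10) (hM : ∑ i ∈ Z, ‖a i‖ ≤ M) (hM1 : 1 ≤ M)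
    (hc₀ : 0 < c₀) (hc₁ : c₀ ≤ 1) (hc : c₀ ≤ ‖∑ i ∈ Z, a i * exp (s i * (13 / 10 * I))‖) :
    ∃ x ∈ Icc (1 : ℝ) (8 / 5),
      c₀ / 2 * (c₀ / (2 * Real.exp 5 * M)) ^ 20 ≤ ‖∑ i ∈ Z, a i * exp (s i * x)‖ := by
  by_contra! hcon
  obtain ⟨q, hdq, hqle, hκpos, hoff⟩ := exists_barrier
  generalize hw₁ : (13 / 10 * I : ℂ) = w₁ at *
  set B : ℝ := 2 * Real.exp 5 * M / c₀ with hB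
  have he5 : (1 : ℝ) ≤ Real.exp 5 := Real.one_le_exp (by norm_num)
  have hB1 : 1 ≤ B := by
    rw [hB, le_div_iff₀ hc₀]; nlinarith
  have hBpos : 0 < B := by linarith
  -- This weight gives `exp (A / 20) = B`. The drop of `1/20` in the barrier off the interval then
  -- exactly turns the trivial bound `e⁵ M` into `c₀ / 2`.
  obtain ⟨A, hA⟩ : ∃ A : ℝ, A = 20 * Real.log B := ⟨_, rfl⟩
  have hA0 : 0 ≤ A := hA ▸ mul_nonneg (by norm_num) (Real.log_nonneg hB1)
  obtain ⟨f, hf⟩ : ∃ f : ℂ → ℂ, f = fun w => ∑ i ∈ Z, a i * exp (s i * w) := ⟨_, rfl⟩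
  have hfd : Differentiable ℂ f := by rw [hf]; fun_prop
  obtain ⟨F, hF⟩ : ∃ F : ℂ → ℂ, F = fun w => f w * exp (A * q w) := ⟨_, rfl⟩
  have hnF : ∀ w, ‖F w‖ = ‖f w‖ * Real.exp (A * (q w).re) := by
    intro w
    rw [hF, norm_mul, Complex.norm_exp, re_ofReal_mul]
  obtain ⟨U, hU⟩ : ∃ U : Set ℂ, U = Ioo (-50 : ℝ) 50 ×ℂ Ioo (0 : ℝ) 50 := ⟨_, rfl⟩
  have hcl : closure U = Icc (-50 : ℝ) 50 ×ℂ Icc (0 : ℝ) 50 := by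
    rw [hU, closure_reProdIm, closure_Ioo (by norm_num), closure_Ioo (by norm_num)]
  have hdF : DiffContOnCl ℂ F U := by
    refine DifferentiableOn.diffContOnCl fun w hw => ?_
    rw [hcl] at hw
    rw [hF]
    exact ((hfd w).mul ((hdq w hw.2.1).const_mul _).cexp).differentiableWithinAt
  have hbdd : Bornology.IsBounded U := hU ▸ (isBounded_Ioo _ _).reProdIm (isBounded_Ioo _ _)
  obtain ⟨κ, hκ⟩ : ∃ κ : ℝ, κ = (q w₁).re := ⟨_, rfl⟩
  rw [← hκ] at hκpos hoff
  have hAB : Real.exp (A / 20) = B := by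
    rw [hA, mul_div_cancel_left₀ _ (by norm_num), Real.exp_log hBpos]
  have hexpA : Real.exp A = B ^ 20 := by
    rw [hA, mul_comm, Real.exp_mul, Real.exp_log hBpos]; norm_cast
  have hone : c₀ / 2 ≤ c₀ / 2 * Real.exp (A * κ) :=
    le_mul_of_one_le_right (by positivity) (Real.one_le_exp (by positivity))
  have hεA : c₀ / 2 * (c₀ / (2 * Real.exp 5 * M)) ^ 20 * Real.exp A = c₀ / 2 := by
    rw [hexpA, hB, mul_assoc, ← mul_pow]
    have : c₀ / (2 * Real.exp 5 * M) * (2 * Real.exp 5 * M / c₀) = 1 := by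
      field_simp
    rw [this, one_pow, mul_one]
  have hbound : ∀ w ∈ frontier U, ‖F w‖ ≤ c₀ / 2 * Real.exp (A * κ) := by
    intro w hw
    have hwU : w ∈ Icc (-50 : ℝ) 50 ×ℂ Icc (0 : ℝ) 50 := hcl ▸ frontier_subset_closure hw
    have hfr : |w.re| = 50 ∨ (w.im = 0 ∨ w.im = 50) := by
      by_contra hne
      simp only [not_or, abs_eq (by norm_num : (0 : ℝ) ≤ 50)] at hne
      have hin : w ∈ U := by
        rw [hU]
        exact ⟨⟨lt_of_le_of_ne hwU.1.1 (Ne.symm hne.1.2), lt_of_le_of_ne hwU.1.2 hne.1.1⟩,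
          ⟨lt_of_le_of_ne hwU.2.1 (Ne.symm hne.2.1), lt_of_le_of_ne hwU.2.2 hne.2.2⟩⟩
      have hopen : IsOpen U := hU ▸ isOpen_Ioo.reProdIm isOpen_Ioo
      rw [hopen.frontier_eq] at hw
      exact hw.2 hin
    have him0 : 0 ≤ w.im := hwU.2.1
    rw [hnF]
    -- On the interval the assumed smallness of `f` pays for the full factor `exp A`, and `κ ≥ 0`
    -- closes the comparison. On the remaining boundary the barrier is at most `κ - 1/20` and the
    -- trivial bound suffices.
    by_cases hch : w.im = 0 ∧ w.re ∈ Icc (1 : ℝ) (8 / 5)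
    · have hwx : w = (w.re : ℂ) := by
        apply Complex.ext <;> simp [hch.1]
      have h1 : ‖f w‖ ≤ c₀ / 2 * (c₀ / (2 * Real.exp 5 * M)) ^ 20 := by
        rw [hwx, hf]
        exact (hcon _ hch.2).le
      refine le_trans ?_ hone
      rw [← hεA]
      exact mul_le_mul h1 (Real.exp_le_exp.2 (mul_le_of_le_one_right hA0 (hqle w him0)))
        (Real.exp_pos _).le (by positivity)
    · have hdiff : (q w).re ≤ κ - 1 / 20 := by
        apply hoff w him0
        rcases hfr with h | h | h
        · exact Or.inr (Or.inr h)
        · left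
          refine ⟨?_, h⟩
          by_contra! hne
          exact hch ⟨h, hne.1.le, hne.2.le⟩
        · exact Or.inr (Or.inl h)
      have hfw : ‖f w‖ ≤ Real.exp 5 * M := by
        rw [hf]
        exact norm_sum_exp_le Z a s hs hM him0 (abs_le.2 hwU.1)
      calc ‖f w‖ * Real.exp (A * (q w).re)
          ≤ (Real.exp 5 * M) * Real.exp (A * (κ - 1 / 20)) :=
            mul_le_mul hfw (Real.exp_le_exp.2 (mul_le_mul_of_nonneg_left hdiff hA0))
              (Real.exp_pos _).le (by positivity)
        _ = c₀ / 2 * Real.exp (A * κ) := by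
            have : A * (κ - 1 / 20) = A * κ - A / 20 := by ring
            rw [this, Real.exp_sub, hAB, hB]
            field_simp
  have hw₁U : w₁ ∈ closure U := by
    rw [hcl, mem_reProdIm, ← hw₁]
    norm_num
  have hfin := norm_le_of_forall_mem_frontier_norm_le hbdd hdF hbound hw₁U
  rw [hnF, ← hκ] at hfin
  have h2 : ‖f w₁‖ ≤ c₀ / 2 := le_of_mul_le_mul_right hfin (Real.exp_pos _)
  rw [hf] at h2
  linarith

end OneSided

end HalfIsolated

namespace HalfIsolated

/-! ### Smoothness, positivity and support of the weight. -/

section Weight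

open Set MeasureTheory

/-- `x (1 - x)` is positive exactly on `(0, 1)`, so smoothness is inherited from the standard gluing
function. -/
lemma bump_eq (x : ℝ) : bump x = expNegInvGlue (x * (1 - x)) := by
  unfold bump expNegInvGlue
  by_cases hx : x ∈ Ioo (0 : ℝ) 1
  · have h : 0 < x * (1 - x) := mul_pos hx.1 (by linarith [hx.2])
    rw [if_pos hx, if_neg (not_le.2 h), neg_div, one_div]
  · have h : x * (1 - x) ≤ 0 := by
      by_contra! h
      apply hx
      constructor <;> nlinarith
    rw [if_neg hx, if_pos h]

lemma contDiff_bump : ContDiff ℝ ∞ bump := by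
  rw [show bump = fun x => expNegInvGlue (x * (1 - x)) from funext bump_eq]
  exact expNegInvGlue.contDiff.comp (by fun_prop)

lemma continuous_bump : Continuous bump := contDiff_bump.continuous

lemma bump_nonneg (x : ℝ) : 0 ≤ bump x := by
  rw [bump_eq]; exact expNegInvGlue.nonneg _

lemma bump_of_mem {x : ℝ} (hx : x ∈ Ioo (0 : ℝ) 1) : bump x = Real.exp (-1 / (x * (1 - x))) := by
  rw [bump, if_pos hx]

lemma bump_of_notMem {x : ℝ} (hx : x ∉ Ioo (0 : ℝ) 1) : bump x = 0 := by
  rw [bump, if_neg hx]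

lemma hasCompactSupport_bump : HasCompactSupport bump := by
  refine HasCompactSupport.intro (isCompact_Icc (a := (0 : ℝ)) (b := 1)) fun x hx => ?_
  exact bump_of_notMem fun h => hx ⟨h.1.le, h.2.le⟩

lemma integrable_bump : Integrable bump :=
  continuous_bump.integrable_of_hasCompactSupport hasCompactSupport_bump

/-- The total mass of `bump`. -/
noncomputable def bumpMass : ℝ := ∫ x in (0 : ℝ)..1, bump x

lemma bumpMass_pos : 0 < bumpMass := by
  refine intervalIntegral.intervalIntegral_pos_of_pos_on
    (continuous_bump.intervalIntegrable _ _) (fun x hx => ?_) one_pos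
  rw [bump_of_mem hx]
  exact Real.exp_pos _

lemma step_eq (y : ℝ) : step y = bumpMass⁻¹ * ∫ x in (0 : ℝ)..y, bump x := by
  have h0 : ∫ x in Iic (0 : ℝ), bump x = 0 := by
    refine setIntegral_eq_zero_of_forall_eq_zero fun x hx => bump_of_notMem fun h => ?_
    exact absurd h.1 (not_lt.2 hx)
  have h := intervalIntegral.integral_Iic_sub_Iic (f := bump) (μ := volume) (a := 0) (b := y)
    integrable_bump.integrableOn integrable_bump.integrableOn
  rw [h0, sub_zero] at h
  rw [step, h, one_div]
  rfl

lemma hasDerivAt_step (y : ℝ) : HasDerivAt step (bumpMass⁻¹ * bump y) y := by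
  rw [show step = fun y => bumpMass⁻¹ * ∫ x in (0 : ℝ)..y, bump x from funext step_eq]
  exact (continuous_bump.integral_hasStrictDerivAt 0 y).hasDerivAt.const_mul _

lemma contDiff_step : ContDiff ℝ ∞ step := by
  rw [contDiff_infty_iff_deriv]
  refine ⟨fun y => (hasDerivAt_step y).differentiableAt, ?_⟩
  rw [show deriv step = fun y => bumpMass⁻¹ * bump y from
    funext fun y => (hasDerivAt_step y).deriv]
  exact contDiff_const.mul contDiff_bump

lemma monotone_step : Monotone step := by
  refine monotone_of_deriv_nonneg (fun y => (hasDerivAt_step y).differentiableAt) fun y => ?_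
  rw [(hasDerivAt_step y).deriv]
  exact mul_nonneg (inv_nonneg.2 bumpMass_pos.le) (bump_nonneg y)

lemma step_of_nonpos {y : ℝ} (hy : y ≤ 0) : step y = 0 := by
  rw [step_eq, mul_eq_zero]
  right
  refine intervalIntegral.integral_zero_ae (Filter.Eventually.of_forall fun x hx => ?_)
  rw [uIoc_of_ge hy] at hx
  exact bump_of_notMem fun h => absurd h.1 (not_lt.2 hx.2)

lemma step_of_one_le {y : ℝ} (hy : 1 ≤ y) : step y = 1 := by
  rw [step_eq, ← intervalIntegral.integral_add_adjacent_intervals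
    (continuous_bump.intervalIntegrable 0 1) (continuous_bump.intervalIntegrable 1 y)]
  have : ∫ x in (1 : ℝ)..y, bump x = 0 := by
    refine intervalIntegral.integral_zero_ae (Filter.Eventually.of_forall fun x hx => ?_)
    rw [uIoc_of_le hy] at hx
    exact bump_of_notMem fun h => absurd h.2 (not_lt.2 hx.1.le)
  rw [this, add_zero]
  exact inv_mul_cancel₀ bumpMass_pos.ne'

lemma step_nonneg (y : ℝ) : 0 ≤ step y := by
  rw [← step_of_nonpos (min_le_right y 0)]
  exact monotone_step (min_le_left y 0)

lemma step_le_one (y : ℝ) : step y ≤ 1 := by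
  rw [← step_of_one_le (le_max_right y 1)]
  exact monotone_step (le_max_left y 1)

lemma contDiff_w₀ : ContDiff ℝ ∞ w₀ := by
  unfold w₀
  exact (contDiff_step.comp (by fun_prop)).sub (contDiff_step.comp (by fun_prop))

lemma continuous_w₀ : Continuous w₀ := contDiff_w₀.continuous

lemma w₀_nonneg (x : ℝ) : 0 ≤ w₀ x := by
  rw [w₀, sub_nonneg]
  by_cases hx : 0 ≤ x
  · exact monotone_step (by linarith)
  · rw [step_of_nonpos (y := x - 1) (by linarith)]
    exact step_nonneg _

lemma w₀_le_one (x : ℝ) : w₀ x ≤ 1 := by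
  have := step_le_one (2 * x - 1)
  have := step_nonneg (x - 1)
  rw [w₀]; linarith

lemma w₀_of_le {x : ℝ} (hx : x ≤ 1 / 2) : w₀ x = 0 := by
  rw [w₀, step_of_nonpos (by linarith), step_of_nonpos (by linarith), sub_zero]

lemma w₀_of_ge {x : ℝ} (hx : 2 ≤ x) : w₀ x = 0 := by
  rw [w₀, step_of_one_le (by linarith), step_of_one_le (by linarith), sub_self]

lemma w₀_one : w₀ 1 = 1 := by
  rw [w₀, step_of_one_le (by norm_num), step_of_nonpos (by norm_num), sub_zero]

lemma support_w₀_subset : Function.support w₀ ⊆ Icc (1 / 2 : ℝ) 2 := by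
  intro x hx
  rw [Function.mem_support] at hx
  by_contra h
  rw [mem_Icc, not_and_or, not_le, not_le] at h
  rcases h with h | h
  · exact hx (w₀_of_le h.le)
  · exact hx (w₀_of_ge h.le)

lemma tsupport_w₀_subset : tsupport w₀ ⊆ Icc (1 / 2 : ℝ) 2 :=
  closure_minimal support_w₀_subset isClosed_Icc

lemma hasDerivAt_w₀ (x : ℝ) :
    HasDerivAt w₀ (bumpMass⁻¹ * (2 * bump (2 * x - 1) - bump (x - 1))) x := by
  have h1 : HasDerivAt (fun x : ℝ => 2 * x - 1) 2 x := by
    simpa using ((hasDerivAt_id x).const_mul 2).sub_const 1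
  have h2 : HasDerivAt (fun x : ℝ => x - 1) 1 x := (hasDerivAt_id x).sub_const 1
  have := ((hasDerivAt_step (2 * x - 1)).comp x h1).sub ((hasDerivAt_step (x - 1)).comp x h2)
  refine this.congr_deriv ?_
  ring

end Weight

/-! ### The Mellin transform of the weight and its decay in vertical strips. -/

section MellinWeight

open Set MeasureTheory Complex Filter Topology

/-- The Mellin transform of `w₀`. -/
noncomputable def mellinWeight (s : ℂ) : ℂ := mellin (fun x => (w₀ x : ℂ)) s

/-- The normalised moments `∫ b(v) (1 + v) ^ s dv` of `bump`. -/
noncomputable def bumpMoment (s : ℂ) : ℂ :=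
  (bumpMass : ℂ)⁻¹ * ∫ v in (0 : ℝ)..1, (bump v : ℂ) * ((1 + v : ℝ) : ℂ) ^ s

lemma continuousOn_cpow_pos (s : ℂ) {S : Set ℝ} (hS : ∀ x ∈ S, 0 < x) :
    ContinuousOn (fun x : ℝ => (x : ℂ) ^ s) S := fun x hx =>
  (continuousAt_ofReal_cpow_const x s (Or.inr (hS x hx).ne')).continuousWithinAt

lemma mellinWeight_eq (s : ℂ) :
    mellinWeight s = ∫ x in (1 / 2 : ℝ)..2, (x : ℂ) ^ (s - 1) * (w₀ x : ℂ) := by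
  rw [mellinWeight, mellin, intervalIntegral.integral_of_le (by norm_num)]
  simp only [smul_eq_mul]
  refine setIntegral_eq_of_subset_of_forall_sdiff_eq_zero measurableSet_Ioi
    (fun x hx => lt_trans (by norm_num) hx.1) fun x hx => ?_
  have : w₀ x = 0 := by
    by_contra h
    have hm := support_w₀_subset h
    apply hx.2
    refine ⟨lt_of_le_of_ne hm.1 ?_, hm.2⟩
    rintro rfl
    exact h (w₀_of_le le_rfl)
  rw [this]; simp

/-- Integrate by parts: `w₀'` is a difference of two copies of the normalised bump, at `2x - 1` and
at `x - 1`. Substituting `x = (1 + v) / 2` and `x = 1 + v` turns both into the same moment, the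
first with an extra `2 ^ (-s)`. -/
lemma mul_mellinWeight (s : ℂ) :
    s * mellinWeight s = (1 - (2 : ℂ) ^ (-s)) * bumpMoment s := by
  rcases eq_or_ne s 0 with rfl | hs
  · simp
  have hpos : ∀ x ∈ uIcc (1 / 2 : ℝ) 2, 0 < x := by
    intro x hx
    rw [uIcc_of_le (by norm_num)] at hx
    linarith [hx.1]
  have hcb := continuous_bump
  have hparts := intervalIntegral.integral_mul_deriv_eq_deriv_mul (a := (1 / 2 : ℝ)) (b := 2)
    (u := fun x : ℝ => (w₀ x : ℂ))
    (u' := fun x => ((bumpMass⁻¹ * (2 * bump (2 * x - 1) - bump (x - 1)) : ℝ) : ℂ))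
    (v := fun x : ℝ => (x : ℂ) ^ s) (v' := fun x : ℝ => s * (x : ℂ) ^ (s - 1))
    (fun x _ => (hasDerivAt_w₀ x).ofReal_comp)
    (fun x hx => hasDerivAt_ofReal_cpow_const (hpos x hx).ne' hs)
    (Continuous.intervalIntegrable (by fun_prop) _ _)
    ((continuousOn_const.mul (continuousOn_cpow_pos _ hpos)).intervalIntegrable)
  set f : ℝ → ℂ := fun v => (bump v : ℂ) * ((1 + v : ℝ) : ℂ) ^ s with hf
  have hf0 : ∀ v, v ∉ Ioo (0 : ℝ) 1 → f v = 0 := fun v hv => by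
    rw [hf]; simp [bump_of_notMem hv]
  have hfc : ContinuousOn f (Icc (-1 / 2) 3) := by
    refine (Complex.continuous_ofReal.comp hcb).continuousOn.mul ?_
    exact (continuousOn_cpow_pos s (S := Ioi 0) fun x hx => hx).comp (by fun_prop)
      fun x hx => by have := hx.1; simp only [mem_Ioi]; linarith
  have hint : ∀ u v, u ∈ Icc (-1 / 2 : ℝ) 3 → v ∈ Icc (-1 / 2 : ℝ) 3 → IntervalIntegrable f volume u v :=
    fun u v hu hv => (hfc.mono (uIcc_subset_Icc hu hv)).intervalIntegrable
  -- For `x` in `[1/2, 2]` the two substitutions range over `[-1/2, 1]` and `[0, 3]`; the bump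
  -- vanishes on the excess.
  have hz1 : ∫ v in (-1 / 2 : ℝ)..1, f v = ∫ v in (0 : ℝ)..1, f v := by
    rw [← intervalIntegral.integral_add_adjacent_intervals (b := 0)
      (hint _ _ (by norm_num) (by norm_num)) (hint _ _ (by norm_num) (by norm_num))]
    rw [intervalIntegral.integral_zero_ae (a := -1 / 2) (b := 0), zero_add]
    refine Eventually.of_forall fun x hx => ?_
    rw [uIoc_of_le (by norm_num)] at hx
    exact hf0 x fun h => absurd h.1 (not_lt.2 hx.2)
  have hz2 : ∫ v in (0 : ℝ)..3, f v = ∫ v in (0 : ℝ)..1, f v := by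
    rw [← intervalIntegral.integral_add_adjacent_intervals (b := 1)
      (hint _ _ (by norm_num) (by norm_num)) (hint _ _ (by norm_num) (by norm_num))]
    rw [intervalIntegral.integral_zero_ae (a := 1) (b := 3), add_zero]
    refine Eventually.of_forall fun x hx => ?_
    rw [uIoc_of_le (by norm_num)] at hx
    exact hf0 x fun h => absurd h.2 (not_lt.2 hx.1.le)
  have hs1 : ∫ x in (1 / 2 : ℝ)..2, f (x - 1) = ∫ v in (0 : ℝ)..1, f v := by
    rw [intervalIntegral.integral_comp_sub_right, ← hz1]; norm_num
  have hs2 : (2 : ℝ) • ∫ x in (1 / 2 : ℝ)..2, f (2 * x - 1) = ∫ v in (0 : ℝ)..1, f v := by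
    rw [intervalIntegral.smul_integral_comp_mul_sub, ← hz2]; norm_num
  have hi1 : IntervalIntegrable (fun x => f (x - 1)) volume (1 / 2) 2 :=
    (hfc.comp (by fun_prop) fun x hx => by
      rw [uIcc_of_le (by norm_num)] at hx
      constructor <;> linarith [hx.1, hx.2]).intervalIntegrable
  have hi2 : IntervalIntegrable (fun x => f (2 * x - 1)) volume (1 / 2) 2 :=
    (hfc.comp (by fun_prop) fun x hx => by
      rw [uIcc_of_le (by norm_num)] at hx
      constructor <;> linarith [hx.1, hx.2]).intervalIntegrable
  have hpt : ∀ x ∈ uIcc (1 / 2 : ℝ) 2,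
      ((bumpMass⁻¹ * (2 * bump (2 * x - 1) - bump (x - 1)) : ℝ) : ℂ) * (x : ℂ) ^ s =
      (bumpMass : ℂ)⁻¹ * ((2 : ℂ) ^ (-s) * 2 * f (2 * x - 1) - f (x - 1)) := by
    intro x hx
    have h0 := hpos x hx
    have e1 : (((1 + (2 * x - 1) : ℝ) : ℂ)) ^ s = (2 : ℂ) ^ s * (x : ℂ) ^ s := by
      have := mul_cpow_ofReal_nonneg (show (0 : ℝ) ≤ 2 by norm_num) h0.le s
      rw [← show ((2 : ℝ) : ℂ) = 2 by norm_num, ← this]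
      congr 1
      push_cast; ring
    have e2 : ((1 + (x - 1) : ℝ) : ℂ) = x := by push_cast; ring
    have e3 : (2 : ℂ) ^ (-s) * (2 : ℂ) ^ s = 1 := by
      rw [← cpow_add _ _ two_ne_zero]; simp
    rw [hf]
    simp only
    rw [e1, e2]
    push_cast
    linear_combination (-(bumpMass : ℂ)⁻¹ * 2 * bump (2 * x - 1) * (x : ℂ) ^ s) * e3
  have hend : ∫ x in (1 / 2 : ℝ)..2,
      ((bumpMass⁻¹ * (2 * bump (2 * x - 1) - bump (x - 1)) : ℝ) : ℂ) * (x : ℂ) ^ s =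
      (bumpMass : ℂ)⁻¹ * ((2 : ℂ) ^ (-s) * (∫ v in (0 : ℝ)..1, f v) - ∫ v in (0 : ℝ)..1, f v) := by
    rw [intervalIntegral.integral_congr hpt, intervalIntegral.integral_const_mul,
      intervalIntegral.integral_sub (hi2.const_mul _) hi1, intervalIntegral.integral_const_mul, hs1]
    rw [← hs2]
    simp only [real_smul]
    push_cast
    ring
  have hlhs : s * mellinWeight s =
      ∫ x in (1 / 2 : ℝ)..2, (w₀ x : ℂ) * (s * (x : ℂ) ^ (s - 1)) := by
    rw [mellinWeight_eq, ← intervalIntegral.integral_const_mul]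
    congr 1
    ext x
    ring
  have hmom : bumpMoment s = (bumpMass : ℂ)⁻¹ * ∫ v in (0 : ℝ)..1, f v := rfl
  rw [hlhs, hparts, hend, w₀_of_ge le_rfl, w₀_of_le le_rfl, hmom, ofReal_zero]
  ring

lemma mellinConvergent_w₀ (s : ℂ) : MellinConvergent (fun x => (w₀ x : ℂ)) s := by
  refine mellinConvergent_of_isBigO_rpow (a := s.re + 1) (b := s.re - 1)
    ((Complex.continuous_ofReal.comp continuous_w₀).locallyIntegrable.locallyIntegrableOn _)
    ?_ (by linarith) ?_ (by linarith)
  · refine Asymptotics.IsBigO.of_bound 1 ?_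
    filter_upwards [eventually_ge_atTop 2] with x hx
    rw [w₀_of_ge hx]; simp
  · refine Asymptotics.IsBigO.of_bound 1 ?_
    filter_upwards [mem_nhdsWithin_of_mem_nhds (Iic_mem_nhds (show (0 : ℝ) < 1 / 2 by norm_num))]
      with x hx
    rw [w₀_of_le hx]; simp

lemma differentiable_mellinWeight : Differentiable ℂ mellinWeight := by
  intro s
  refine mellin_differentiableAt_of_isBigO_rpow (a := s.re + 1) (b := s.re - 1)
    ((Complex.continuous_ofReal.comp continuous_w₀).locallyIntegrable.locallyIntegrableOn _)
    ?_ (by linarith) ?_ (by linarith)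
  · refine Asymptotics.IsBigO.of_bound 1 ?_
    filter_upwards [eventually_ge_atTop 2] with x hx
    rw [w₀_of_ge hx]; simp
  · refine Asymptotics.IsBigO.of_bound 1 ?_
    filter_upwards [mem_nhdsWithin_of_mem_nhds (Iic_mem_nhds (show (0 : ℝ) < 1 / 2 by norm_num))]
      with x hx
    rw [w₀_of_le hx]; simp

/-- At `s = 0` the integrand is `w₀ x / x ≥ 0`. The positivity makes the term of `ρ₀` itself a
genuine main term. -/
lemma exists_mellinWeight_zero : ∃ c : ℝ, 0 < c ∧ mellinWeight 0 = c := by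
  have hpos : ∀ x ∈ Icc (1 / 2 : ℝ) 2, 0 < x := fun x hx => by linarith [hx.1]
  refine ⟨∫ x in (1 / 2 : ℝ)..2, x⁻¹ * w₀ x, ?_, ?_⟩
  · refine intervalIntegral.integral_pos (by norm_num) ?_ ?_ ⟨1, by norm_num, ?_⟩
    · exact (continuousOn_inv₀.mono fun x hx => (hpos x hx).ne').mul continuous_w₀.continuousOn
    · intro x hx
      have := hpos x ⟨hx.1.le, hx.2⟩
      exact mul_nonneg (by positivity) (w₀_nonneg x)
    · rw [w₀_one]; norm_num
  · rw [mellinWeight_eq, ← intervalIntegral.integral_ofReal]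
    refine intervalIntegral.integral_congr fun x _ => ?_
    simp [cpow_neg_one]

lemma norm_mellinWeight_le {s : ℂ} (hs : |s.re| ≤ 2) : ‖mellinWeight s‖ ≤ 12 := by
  rw [mellinWeight_eq]
  have := intervalIntegral.norm_integral_le_of_norm_le_const (a := (1 / 2 : ℝ)) (b := 2) (C := 8)
    (f := fun x : ℝ => (x : ℂ) ^ (s - 1) * (w₀ x : ℂ)) (fun x hx => by
      rw [uIoc_of_le (by norm_num)] at hx
      have hx0 : 0 < x := by linarith [hx.1]
      rw [norm_mul, norm_cpow_eq_rpow_re_of_pos hx0, Complex.norm_real,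
        Real.norm_of_nonneg (w₀_nonneg x)]
      have h1 : x ^ (s - 1).re ≤ 8 := by
        obtain ⟨h2, h3⟩ := abs_le.1 hs
        simp only [sub_re, one_re]
        rcases le_total 1 x with h | h
        · calc x ^ (s.re - 1) ≤ x ^ (3 : ℝ) := Real.rpow_le_rpow_of_exponent_le h (by linarith)
            _ ≤ 2 ^ (3 : ℝ) := Real.rpow_le_rpow hx0.le hx.2 (by norm_num)
            _ = 8 := by norm_num
        · calc x ^ (s.re - 1) ≤ x ^ (-3 : ℝ) :=
                Real.rpow_le_rpow_of_exponent_ge hx0 h (by linarith)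
            _ ≤ (1 / 2) ^ (-3 : ℝ) :=
                Real.rpow_le_rpow_of_nonpos (by norm_num) hx.1.le (by norm_num)
            _ = 8 := by
              rw [Real.rpow_neg (by norm_num)]; norm_num
      calc x ^ (s - 1).re * w₀ x ≤ 8 * 1 := mul_le_mul h1 (w₀_le_one x) (w₀_nonneg x) (by norm_num)
        _ = 8 := by norm_num)
  refine this.trans ?_
  norm_num


/-- Split `1 / (z (1 - z)) = 1 / z + 1 / (1 - z)`. Hence the exponential factor of the continued
bump has modulus at most one in the disc. -/
lemma inv_mul_one_sub_re_nonneg {z : ℂ} (hz : z ∈ Metric.ball (1 / 2 : ℂ) (1 / 2)) :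
    0 < z.re ∧ z.re < 1 ∧ 0 ≤ (1 / (z * (1 - z))).re := by
  have h1 : ‖z - 1 / 2‖ < 1 / 2 := by simpa [dist_eq_norm] using hz
  have h2 := (abs_re_le_norm (z - 1 / 2)).trans_lt h1
  have h3 : (z - 1 / 2).re = z.re - 1 / 2 := by simp
  rw [h3, abs_lt] at h2
  have ha : 0 < z.re := by linarith
  have hb : z.re < 1 := by linarith
  refine ⟨ha, hb, ?_⟩
  have hz0 : z ≠ 0 := fun h => by simp [h] at ha
  have hz1 : 1 - z ≠ 0 := fun h => by
    rw [sub_eq_zero] at h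
    rw [← h] at hb
    simp at hb
  have : 1 / (z * (1 - z)) = z⁻¹ + (1 - z)⁻¹ := by field_simp; ring
  rw [this, add_re, inv_re, inv_re]
  have : 0 ≤ (1 - z).re := by simp; linarith
  exact add_nonneg (div_nonneg ha.le (normSq_nonneg _)) (div_nonneg this (normSq_nonneg _))

lemma norm_cpow_eq_exp {z : ℂ} (hz : z ≠ 0) (s : ℂ) :
    ‖z ^ s‖ = Real.exp (s.re * Real.log ‖z‖ - s.im * z.arg) := by
  rw [cpow_def_of_ne_zero hz, norm_exp, mul_re, log_re, log_im]
  ring_nf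

/-- The holomorphic continuation of the integrand of `bumpMoment`. -/
noncomputable def bumpIntegrand (s z : ℂ) : ℂ := exp (-(1 / (z * (1 - z)))) * (1 + z) ^ s

lemma differentiableOn_bumpIntegrand (s : ℂ) :
    DifferentiableOn ℂ (bumpIntegrand s) (Metric.ball (1 / 2 : ℂ) (1 / 2)) := by
  intro z hz
  obtain ⟨h0, h1, -⟩ := inv_mul_one_sub_re_nonneg hz
  have hz0 : z ≠ 0 := fun h => by simp [h] at h0
  have hz1 : 1 - z ≠ 0 := fun h => by
    rw [sub_eq_zero] at h
    rw [← h] at h1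
    simp at h1
  have hsl : 1 + z ∈ slitPlane := Or.inl (by simp; linarith)
  have hne : z * (1 - z) ≠ 0 := mul_ne_zero hz0 hz1
  refine DifferentiableAt.differentiableWithinAt (DifferentiableAt.mul ?_ ?_)
  · fun_prop (disch := exact hne)
  · exact DifferentiableAt.cpow_const (by fun_prop) hsl

lemma norm_bumpIntegrand_le (s : ℂ) :
    ∃ K : ℝ, ∀ z ∈ Metric.ball (1 / 2 : ℂ) (1 / 2), ‖bumpIntegrand s z‖ ≤ K := by
  refine ⟨1 * Real.exp (|s.re| * Real.log 2 + |s.im| * Real.pi), fun z hz => ?_⟩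
  obtain ⟨h0, h1, h2⟩ := inv_mul_one_sub_re_nonneg hz
  have hre : 1 ≤ (1 + z).re := by simp; linarith
  have hne : 1 + z ≠ 0 := fun h => by rw [h] at hre; norm_num at hre
  have hn1 : 1 ≤ ‖1 + z‖ := hre.trans (re_le_norm _)
  have hn2 : ‖1 + z‖ ≤ 2 := by
    have h1 : ‖z - 1 / 2‖ < 1 / 2 := by simpa [dist_eq_norm] using hz
    calc ‖1 + z‖ = ‖(z - 1 / 2) + (3 / 2 : ℝ)‖ := by push_cast; ring_nf
      _ ≤ ‖z - 1 / 2‖ + ‖((3 / 2 : ℝ) : ℂ)‖ := norm_add_le _ _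
      _ ≤ 1 / 2 + 3 / 2 := by
        rw [Complex.norm_real, Real.norm_of_nonneg (by norm_num)]; linarith
      _ = 2 := by norm_num
  rw [bumpIntegrand, norm_mul, norm_exp, norm_cpow_eq_exp hne]
  refine mul_le_mul ?_ (Real.exp_le_exp.2 ?_) (Real.exp_pos _).le zero_le_one
  · rw [Real.exp_le_one_iff, neg_re]; linarith
  · have e1 : s.re * Real.log ‖1 + z‖ ≤ |s.re| * Real.log 2 :=
      mul_le_mul (le_abs_self _) (Real.log_le_log (by linarith) hn2) (Real.log_nonneg hn1)
        (abs_nonneg _)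
    have e2 : -(s.im * (1 + z).arg) ≤ |s.im| * Real.pi := by
      refine (neg_le_abs _).trans ?_
      rw [abs_mul]
      exact mul_le_mul_of_nonneg_left (abs_arg_le_pi _) (abs_nonneg _)
    linarith

/-- The path `v + i v (1 - v)` from `0` to `1`. -/
noncomputable def arcPath (v : ℝ) : ℂ := v + (v * (1 - v) : ℝ) * I

lemma arcPath_re (v : ℝ) : (arcPath v).re = v := by simp [arcPath]

lemma arcPath_im (v : ℝ) : (arcPath v).im = v * (1 - v) := by simp [arcPath]

lemma arcPath_mem {v : ℝ} (hv : v ∈ Ioo (0 : ℝ) 1) :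
    arcPath v ∈ Metric.ball (1 / 2 : ℂ) (1 / 2) := by
  have hp : 0 < v * (1 - v) := mul_pos hv.1 (by linarith [hv.2])
  have hp2 : v * (1 - v) ≤ 1 / 4 := by nlinarith [sq_nonneg (v - 1 / 2)]
  rw [Metric.mem_ball, dist_eq_norm, ← sq_lt_sq₀ (norm_nonneg _) (by norm_num),
    ← normSq_eq_norm_sq, normSq_apply]
  simp only [sub_re, sub_im, arcPath_re, arcPath_im]
  norm_num
  nlinarith

lemma hasDerivAt_arcPath (v : ℝ) : HasDerivAt arcPath (1 + (1 - 2 * v : ℝ) * I) v := by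
  have h1 : HasDerivAt (fun v : ℝ => v * (1 - v)) (1 - 2 * v) v := by
    have := (hasDerivAt_id v).mul ((hasDerivAt_id v).const_sub 1)
    refine this.congr_deriv ?_
    simp; ring
  exact ((ofRealCLM.hasDerivAt (x := v)).add ((h1.ofReal_comp).mul_const I)).congr_deriv (by simp)

/-- On the arc, with `p = v (1 - v)` and `t = Im s`, the bump contributes `exp (-1 / (2p))`. The
argument of `1 + z` is at least its sine, hence at least `p / 2`, so the power contributes `exp (-t
p / 2)`. By AM-GM the exponents add up to at least `√t`; the factor `4` is `2 ^ |Re s|`. -/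
lemma norm_bumpIntegrand_arcPath_le {s : ℂ} (hs : |s.re| ≤ 2) (ht : 0 ≤ s.im) {v : ℝ}
    (hv : v ∈ Ioo (0 : ℝ) 1) :
    ‖bumpIntegrand s (arcPath v)‖ ≤ 4 * Real.exp (-Real.sqrt s.im) := by
  set p := v * (1 - v) with hp
  have hv1 : 0 < 1 - v := by linarith [hv.2]
  have hp0 : 0 < p := mul_pos hv.1 hv1
  have hp4 : p ≤ 1 / 4 := by nlinarith [sq_nonneg (v - 1 / 2)]
  set z := arcPath v with hz
  have hzre : z.re = v := arcPath_re v
  have hzim : z.im = p := arcPath_im v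
  have hz0 : z ≠ 0 := fun h => by rw [h] at hzre; simp at hzre; linarith [hv.1]
  have hz1 : 1 - z ≠ 0 := fun h => by
    have : (1 - z).re = 0 := by rw [h]; simp
    simp [hzre] at this
    linarith
  have hw0 : 1 + z ≠ 0 := fun h => by
    have : (1 + z).re = 0 := by rw [h]; simp
    simp [hzre] at this
    linarith [hv.1]
  have hre : 1 / (2 * p) ≤ (1 / (z * (1 - z))).re := by
    have : 1 / (z * (1 - z)) = z⁻¹ + (1 - z)⁻¹ := by field_simp; ring
    rw [this, add_re, inv_re, inv_re]
    have n1 : normSq z = v ^ 2 * (1 + (1 - v) ^ 2) := by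
      rw [normSq_apply, hzre, hzim]; ring
    have n2 : normSq (1 - z) = (1 - v) ^ 2 * (1 + v ^ 2) := by
      rw [normSq_apply]; simp only [sub_re, sub_im, one_re, one_im, hzre, hzim]; ring
    have hv0 := hv.1
    have e1 : 1 / (2 * v) ≤ z.re / normSq z := by
      rw [n1, hzre, div_le_div_iff₀ (by positivity) (by positivity)]
      nlinarith [mul_nonneg (sq_nonneg v) (show 0 ≤ 1 - (1 - v) ^ 2 by nlinarith)]
    have e2 : 1 / (2 * (1 - v)) ≤ (1 - z).re / normSq (1 - z) := by
      rw [n2, sub_re, one_re, hzre, div_le_div_iff₀ (by positivity) (by positivity)]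
      nlinarith [mul_nonneg (sq_nonneg (1 - v)) (show 0 ≤ 1 - v ^ 2 by nlinarith)]
    have e3 : 1 / (2 * p) = 1 / (2 * v) + 1 / (2 * (1 - v)) := by
      rw [hp]; field_simp; ring
    linarith
  have hnsq : ‖1 + z‖ ^ 2 = (1 + v) ^ 2 + p ^ 2 := by
    rw [← normSq_eq_norm_sq, normSq_apply]
    simp only [add_re, add_im, one_re, one_im, hzre, hzim]; ring
  have hn2 : ‖1 + z‖ ≤ 2 := by
    rw [← sq_le_sq₀ (norm_nonneg _) (by norm_num), hnsq]
    nlinarith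
  have hn1 : 1 ≤ ‖1 + z‖ := by
    rw [← sq_le_sq₀ (by norm_num) (norm_nonneg _), hnsq]
    nlinarith [hv.1]
  have harg : p / 2 ≤ (1 + z).arg := by
    have h0 : 0 ≤ (1 + z).arg := by
      rw [arg_nonneg_iff]; simp [hzim, hp0.le]
    have h1 := Real.sin_le h0
    rw [sin_arg] at h1
    refine le_trans ?_ h1
    simp only [add_im, one_im, hzim, zero_add]
    exact div_le_div_of_nonneg_left hp0.le (by linarith) hn2
  rw [bumpIntegrand, norm_mul, norm_exp, norm_cpow_eq_exp hw0, ← Real.exp_add,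
    show (4 : ℝ) = Real.exp (2 * Real.log 2) by
      rw [mul_comm, Real.exp_mul, Real.exp_log (by norm_num)]; norm_num, ← Real.exp_add,
    Real.exp_le_exp, neg_re]
  have e1 : s.re * Real.log ‖1 + z‖ ≤ 2 * Real.log 2 :=
    mul_le_mul ((le_abs_self _).trans hs) (Real.log_le_log (by linarith) hn2)
      (Real.log_nonneg hn1) (by norm_num)
  have e2 : s.im * (p / 2) ≤ s.im * (1 + z).arg := mul_le_mul_of_nonneg_left harg ht
  have e3 : Real.sqrt s.im ≤ 1 / (2 * p) + s.im * (p / 2) := by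
    have h1 := Real.sq_sqrt ht
    set r := Real.sqrt s.im with hr
    rw [← h1]
    have : 1 / (2 * p) + r ^ 2 * (p / 2) - r = (1 - r * p) ^ 2 / (2 * p) := by
      field_simp; ring
    have : 0 ≤ (1 - r * p) ^ 2 / (2 * p) := by positivity
    linarith
  linarith

/-- Move the segment `[0, 1]` to the arc inside the disc. The endpoints are singular, so both paths
are cut at distance `ε` and compared through a primitive; the integrand is bounded, so the cuts cost
`O(ε)`, and `ε` tends to zero. -/
lemma norm_integral_bumpIntegrand_le {s : ℂ} (hs : |s.re| ≤ 2) (ht : 0 ≤ s.im) :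
    ‖∫ v in (0 : ℝ)..1, (bump v : ℂ) * ((1 + v : ℝ) : ℂ) ^ s‖ ≤ 8 * Real.exp (-Real.sqrt s.im) := by
  obtain ⟨G, hG⟩ := (differentiableOn_bumpIntegrand s).isExactOn_ball
  obtain ⟨K, hK⟩ := norm_bumpIntegrand_le s
  set f : ℝ → ℂ := fun v => (bump v : ℂ) * ((1 + v : ℝ) : ℂ) ^ s with hf
  have hfeq : ∀ v ∈ Ioo (0 : ℝ) 1, f v = bumpIntegrand s v := by
    intro v hv
    rw [hf, bumpIntegrand]
    simp only
    rw [bump_of_mem hv]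
    push_cast
    rw [neg_div]
  have hmem : ∀ v ∈ Ioo (0 : ℝ) 1, (v : ℂ) ∈ Metric.ball (1 / 2 : ℂ) (1 / 2) := by
    intro v hv
    rw [Metric.mem_ball, dist_eq_norm, show (v : ℂ) - 1 / 2 = ((v - 1 / 2 : ℝ) : ℂ) by push_cast; ring,
      Complex.norm_real, Real.norm_eq_abs, abs_lt]
    constructor <;> linarith [hv.1, hv.2]
  have hcont : Continuous f := by
    have hcb := continuous_bump
    -- Truncating the base at `1` changes nothing where the bump is nonzero and keeps the complex
    -- power continuous on all of `ℝ`.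
    have hf2 : f = fun v => (bump v : ℂ) * ((max (1 + v) 1 : ℝ) : ℂ) ^ s := by
      ext v
      rw [hf]
      by_cases hv : 0 ≤ v
      · simp only; rw [max_eq_left (by linarith)]
      · simp [bump_of_notMem (fun h => hv h.1.le)]
    rw [hf2]
    refine (Complex.continuous_ofReal.comp hcb).mul ?_
    refine continuous_iff_continuousAt.2 fun v => ?_
    have h1 := continuousAt_ofReal_cpow_const (max (1 + v) 1) s
      (Or.inr (by have := le_max_right (1 + v) (1 : ℝ); intro h; linarith))
    exact ContinuousAt.comp (f := fun v : ℝ => max (1 + v) 1) h1 (by fun_prop)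
  have hK0 : 0 ≤ K := (norm_nonneg _).trans (hK _ (hmem (1 / 2) (by norm_num)))
  have hfK : ∀ v ∈ Ioo (0 : ℝ) 1, ‖f v‖ ≤ K := fun v hv => by
    rw [hfeq v hv]; exact hK _ (hmem v hv)
  have key : ∀ ε ∈ Ioo (0 : ℝ) (1 / 2), ‖∫ v in (0 : ℝ)..1, f v‖ ≤
      8 * Real.exp (-Real.sqrt s.im) + 4 * K * ε := by
    intro ε hε
    have hε0 := hε.1
    have hε1 := hε.2
    have hsub : ∀ v ∈ uIcc ε (1 - ε), v ∈ Ioo (0 : ℝ) 1 := by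
      intro v hv
      rw [uIcc_of_le (by linarith)] at hv
      constructor <;> linarith [hv.1, hv.2]
    have i1 : ∫ v in ε..(1 - ε), f v = G (1 - ε : ℝ) - G (ε : ℝ) := by
      rw [intervalIntegral.integral_eq_sub_of_hasDerivAt (f := fun v : ℝ => G v) (f' := f)]
      · intro v hv
        have := (hG _ (hmem v (hsub v hv))).comp_ofReal
        rwa [← hfeq v (hsub v hv)] at this
      · exact hcont.intervalIntegrable _ _
    have hpd : ∀ v ∈ uIcc ε (1 - ε), HasDerivAt (fun v => G (arcPath v))
        (bumpIntegrand s (arcPath v) * (1 + (1 - 2 * v : ℝ) * I)) v := fun v hv =>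
      (hG _ (arcPath_mem (hsub v hv))).comp_of_eq v (hasDerivAt_arcPath v) rfl
    have hac : Continuous arcPath := by unfold arcPath; fun_prop
    have i2 : ∫ v in ε..(1 - ε), bumpIntegrand s (arcPath v) * (1 + (1 - 2 * v : ℝ) * I) =
        G (arcPath (1 - ε)) - G (arcPath ε) := by
      rw [intervalIntegral.integral_eq_sub_of_hasDerivAt hpd]
      refine ContinuousOn.intervalIntegrable (ContinuousOn.mul ?_ (by fun_prop))
      exact (differentiableOn_bumpIntegrand s).continuousOn.comp hac.continuousOn
        fun v hv => arcPath_mem (hsub v hv)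
    have b2 : ‖∫ v in ε..(1 - ε), bumpIntegrand s (arcPath v) * (1 + (1 - 2 * v : ℝ) * I)‖ ≤
        8 * Real.exp (-Real.sqrt s.im) := by
      have := intervalIntegral.norm_integral_le_of_norm_le_const (a := ε) (b := 1 - ε)
        (C := 8 * Real.exp (-Real.sqrt s.im))
        (f := fun v => bumpIntegrand s (arcPath v) * (1 + (1 - 2 * v : ℝ) * I)) (fun v hv => by
          have hv' := hsub v (uIoc_subset_uIcc hv)
          rw [norm_mul]
          have h1 := norm_bumpIntegrand_arcPath_le hs ht hv'
          have h2 : ‖1 + ((1 - 2 * v : ℝ) : ℂ) * I‖ ≤ 2 := by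
            refine (norm_add_le _ _).trans ?_
            rw [norm_one, norm_mul, norm_I, mul_one, Complex.norm_real, Real.norm_eq_abs]
            have : |1 - 2 * v| ≤ 1 := abs_le.2 ⟨by linarith [hv'.2], by linarith [hv'.1]⟩
            linarith
          calc _ ≤ 4 * Real.exp (-Real.sqrt s.im) * 2 :=
                mul_le_mul h1 h2 (norm_nonneg _) (by positivity)
            _ = _ := by ring)
      refine this.trans (mul_le_of_le_one_right (by positivity) ?_)
      rw [abs_of_nonneg (by linarith)]; linarith
    have hlip : ∀ v ∈ Ioo (0 : ℝ) 1, ‖G (arcPath v) - G (v : ℝ)‖ ≤ K * (v * (1 - v)) := by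
      intro v hv
      have := (convex_ball (1 / 2 : ℂ) (1 / 2)).norm_image_sub_le_of_norm_hasDerivWithin_le
        (fun z hz => (hG z hz).hasDerivWithinAt) hK (hmem v hv) (arcPath_mem hv)
      refine this.trans (le_of_eq ?_)
      congr 1
      rw [arcPath, add_sub_cancel_left, norm_mul, norm_I, mul_one, Complex.norm_real,
        Real.norm_of_nonneg (mul_nonneg hv.1.le (by linarith [hv.2]))]
    have l1 := hlip ε ⟨hε0, by linarith⟩
    have l2 := hlip (1 - ε) ⟨by linarith, by linarith⟩
    have l3 : ‖∫ v in ε..(1 - ε), f v‖ ≤ 8 * Real.exp (-Real.sqrt s.im) + 2 * K * ε := by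
      have e : ∫ v in ε..(1 - ε), f v = (G (arcPath (1 - ε)) - G (arcPath ε)) -
          (G (arcPath (1 - ε)) - G (1 - ε : ℝ)) + (G (arcPath ε) - G (ε : ℝ)) := by
        rw [i1]; ring
      rw [e, ← i2]
      refine (norm_add_le _ _).trans ?_
      have h1 := norm_sub_le (∫ v in ε..(1 - ε), bumpIntegrand s (arcPath v) *
        (1 + (1 - 2 * v : ℝ) * I)) (G (arcPath (1 - ε)) - G (1 - ε : ℝ))
      have h2 : K * (ε * (1 - ε)) ≤ K * ε := by
        refine mul_le_mul_of_nonneg_left ?_ hK0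
        nlinarith
      have h3 : K * ((1 - ε) * (1 - (1 - ε))) = K * (ε * (1 - ε)) := by ring
      linarith
    have hI := fun a b => hcont.intervalIntegrable (μ := volume) a b
    have l4 : ∫ v in (0 : ℝ)..1, f v = (∫ v in (0 : ℝ)..ε, f v) + (∫ v in ε..(1 - ε), f v) +
        ∫ v in (1 - ε)..1, f v := by
      rw [intervalIntegral.integral_add_adjacent_intervals (hI _ _) (hI _ _),
        intervalIntegral.integral_add_adjacent_intervals (hI _ _) (hI _ _)]
    have hfK' : ∀ v ∈ Icc (0 : ℝ) 1, ‖f v‖ ≤ K := by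
      intro v hv
      by_cases h : v ∈ Ioo (0 : ℝ) 1
      · exact hfK v h
      · rw [hf]; simp only; rw [bump_of_notMem h]; simpa using hK0
    have l5 : ‖∫ v in (0 : ℝ)..ε, f v‖ ≤ K * ε := by
      have := intervalIntegral.norm_integral_le_of_norm_le_const (a := 0) (b := ε) (C := K) (f := f)
        (fun v hv => by
          rw [uIoc_of_le hε0.le] at hv
          exact hfK' v ⟨hv.1.le, by linarith [hv.2]⟩)
      rwa [sub_zero, abs_of_pos hε0] at this
    have l6 : ‖∫ v in (1 - ε)..1, f v‖ ≤ K * ε := by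
      have := intervalIntegral.norm_integral_le_of_norm_le_const (a := 1 - ε) (b := 1) (C := K)
        (f := f) (fun v hv => by
          rw [uIoc_of_le (by linarith)] at hv
          exact hfK' v ⟨by linarith [hv.1], hv.2⟩)
      rwa [sub_sub_cancel, abs_of_pos hε0] at this
    rw [l4]
    refine (norm_add₃_le).trans ?_
    linarith
  refine le_of_forall_pos_le_add fun δ hδ => ?_
  have hK1 : 0 < 4 * K + 1 := by linarith
  set ε := min (1 / 4) (δ / (4 * K + 1)) with hε
  have hε0 : 0 < ε := lt_min (by norm_num) (by positivity)
  refine (key ε ⟨hε0, (min_le_left _ _).trans_lt (by norm_num)⟩).trans ?_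
  have h1 : ε ≤ δ / (4 * K + 1) := min_le_right _ _
  rw [le_div_iff₀ hK1] at h1
  nlinarith

lemma bumpMoment_conj (s : ℂ) :
    bumpMoment ((starRingEnd ℂ) s) = (starRingEnd ℂ) (bumpMoment s) := by
  rw [bumpMoment, bumpMoment, map_mul, map_inv₀, conj_ofReal]
  congr 1
  rw [intervalIntegral.integral_of_le zero_le_one, intervalIntegral.integral_of_le zero_le_one,
    ← integral_conj]
  refine setIntegral_congr_fun measurableSet_Ioc fun v hv => ?_
  have hv0 := hv.1
  simp only [map_mul, conj_ofReal]
  congr 1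
  have harg : ((1 + v : ℝ) : ℂ).arg ≠ Real.pi := by
    rw [arg_ofReal_of_nonneg (by linarith)]
    exact Real.pi_ne_zero.symm
  rw [cpow_conj _ _ harg, conj_ofReal]

lemma norm_bumpMoment_le {s : ℂ} (hs : |s.re| ≤ 2) :
    ‖bumpMoment s‖ ≤ 8 / bumpMass * Real.exp (-Real.sqrt |s.im|) := by
  wlog ht : 0 ≤ s.im generalizing s with H
  · have := H (s := (starRingEnd ℂ) s) (by simpa using hs) (by simp; linarith)
    rwa [bumpMoment_conj, RCLike.norm_conj, conj_im, abs_neg] at this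
  rw [bumpMoment, norm_mul, norm_inv, Complex.norm_real, Real.norm_of_nonneg bumpMass_pos.le,
    abs_of_nonneg ht]
  have := norm_integral_bumpIntegrand_le hs ht
  calc _ ≤ bumpMass⁻¹ * (8 * Real.exp (-Real.sqrt s.im)) :=
        mul_le_mul_of_nonneg_left this (inv_nonneg.2 bumpMass_pos.le)
    _ = _ := by ring

/-- Sub-exponential decay of the Mellin transform of `w₀` in vertical strips. -/
lemma exists_norm_mul_mellinWeight_le : ∃ C : ℝ, 1 ≤ C ∧ ∀ s : ℂ, |s.re| ≤ 2 →
    ‖s‖ * ‖mellinWeight s‖ ≤ C * Real.exp (-Real.sqrt |s.im|) := by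
  refine ⟨max 1 (5 * (8 / bumpMass)), le_max_left _ _, fun s hs => ?_⟩
  rw [← norm_mul, mul_mellinWeight, norm_mul]
  have h1 : ‖1 - (2 : ℂ) ^ (-s)‖ ≤ 5 := by
    refine (norm_sub_le _ _).trans ?_
    rw [norm_one, show (2 : ℂ) = ((2 : ℝ) : ℂ) by norm_num,
      norm_cpow_eq_rpow_re_of_pos (by norm_num)]
    have : (2 : ℝ) ^ (-s).re ≤ 2 ^ (2 : ℝ) :=
      Real.rpow_le_rpow_of_exponent_le (by norm_num) (by
        rw [neg_re]; linarith [(abs_le.1 hs).1])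
    norm_num at this ⊢
    linarith
  calc _ ≤ 5 * (8 / bumpMass * Real.exp (-Real.sqrt |s.im|)) :=
        mul_le_mul h1 (norm_bumpMoment_le hs) (norm_nonneg _) (by norm_num)
    _ ≤ _ := by
        rw [← mul_assoc]
        exact mul_le_mul_of_nonneg_right (le_max_right _ _) (Real.exp_pos _).le

end MellinWeight

end HalfIsolated

namespace HalfIsolated

/-! ### Polynomial growth of `(s - 1) ζ(s)` to the right of the imaginary axis. -/

section ZetaGrowth

open Complex Set MeasureTheory Filter Topology

/-- `∫ {t} t ^ (-s-1) dt` over `t > 1`, as a Mellin transform. -/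
noncomputable def fractMellin (s : ℂ) : ℂ :=
  mellin (fun t : ℝ => (Ioi (1 : ℝ)).indicator (fun t => ((Int.fract t : ℝ) : ℂ)) t) (-s)

lemma norm_fract_indicator_le (t : ℝ) :
    ‖(Ioi (1 : ℝ)).indicator (fun t => ((Int.fract t : ℝ) : ℂ)) t‖ ≤ 1 := by
  by_cases h : t ∈ Ioi (1 : ℝ)
  · rw [indicator_of_mem h, Complex.norm_real, Real.norm_of_nonneg (Int.fract_nonneg t)]
    exact (Int.fract_lt_one t).le
  · rw [indicator_of_notMem h]; simp

lemma measurable_fract_indicator :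
    Measurable fun t : ℝ => (Ioi (1 : ℝ)).indicator (fun t => ((Int.fract t : ℝ) : ℂ)) t :=
  (Complex.measurable_ofReal.comp measurable_fract).indicator measurableSet_Ioi

lemma differentiableAt_fractMellin {s : ℂ} (hs : 0 < s.re) : DifferentiableAt ℂ fractMellin s := by
  have h : DifferentiableAt ℂ
      (mellin (fun t : ℝ => (Ioi (1 : ℝ)).indicator (fun t => ((Int.fract t : ℝ) : ℂ)) t)) (-s) := by
    refine mellin_differentiableAt_of_isBigO_rpow (a := 0) (b := (-s).re - 1) ?_ ?_
      (by simpa using hs) ?_ (by linarith)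
    · refine LocallyIntegrable.locallyIntegrableOn ?_ _
      refine (locallyIntegrable_const (1 : ℝ)).mono
        measurable_fract_indicator.aestronglyMeasurable (Eventually.of_forall fun t => ?_)
      simpa using norm_fract_indicator_le t
    · refine Asymptotics.IsBigO.of_bound 1 (Eventually.of_forall fun t => ?_)
      simpa using norm_fract_indicator_le t
    · refine Asymptotics.IsBigO.of_bound 1 ?_
      filter_upwards [mem_nhdsWithin_of_mem_nhds (Iic_mem_nhds (show (0 : ℝ) < 1 by norm_num))]
        with x hx
      rw [indicator_of_notMem (by simpa using hx)]; simp
  exact h.comp s (differentiableAt_id.neg)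

lemma fractMellin_eq (s : ℂ) :
    fractMellin s = ∫ t in Ioi (1 : ℝ), ((Int.fract t : ℝ) : ℂ) * (t : ℂ) ^ (-(s + 1)) := by
  rw [fractMellin, mellin]
  have h : ∀ t : ℝ, (t : ℂ) ^ (-s - 1) •
      (Ioi (1 : ℝ)).indicator (fun t => ((Int.fract t : ℝ) : ℂ)) t =
      (Ioi (1 : ℝ)).indicator (fun t => ((Int.fract t : ℝ) : ℂ) * (t : ℂ) ^ (-(s + 1))) t := by
    intro t
    by_cases h : t ∈ Ioi (1 : ℝ)
    · rw [indicator_of_mem h, indicator_of_mem h, smul_eq_mul, mul_comm]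
      congr 2
      ring
    · rw [indicator_of_notMem h, indicator_of_notMem h, smul_zero]
  simp_rw [h]
  rw [setIntegral_indicator measurableSet_Ioi]
  congr 2
  ext x
  simp only [mem_inter_iff, mem_Ioi, and_iff_right_iff_imp]
  intro h; linarith

lemma norm_fract_mul_le {s : ℂ} {t : ℝ} (ht : t ∈ Ioi (1 : ℝ)) :
    ‖((Int.fract t : ℝ) : ℂ) * (t : ℂ) ^ (-(s + 1))‖ ≤ t ^ (-(s.re + 1)) := by
  have ht0 : 0 < t := lt_trans one_pos ht
  rw [norm_mul, Complex.norm_real, Real.norm_of_nonneg (Int.fract_nonneg t),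
    norm_cpow_eq_rpow_re_of_pos ht0]
  have : (-(s + 1)).re = -(s.re + 1) := by simp
  rw [this]
  exact mul_le_of_le_one_left (by positivity) (Int.fract_lt_one t).le

lemma norm_fractMellin_le {s : ℂ} (hs : 0 < s.re) : ‖fractMellin s‖ ≤ 1 / s.re := by
  rw [fractMellin_eq]
  have hi : IntegrableOn (fun t : ℝ => t ^ (-(s.re + 1))) (Ioi 1) :=
    integrableOn_Ioi_rpow_of_lt (by linarith) one_pos
  have := norm_integral_le_of_norm_le hi
    ((ae_restrict_iff' measurableSet_Ioi).2 (Eventually.of_forall fun t ht =>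
      norm_fract_mul_le (s := s) ht))
  refine this.trans (le_of_eq ?_)
  rw [integral_Ioi_rpow_of_lt (by linarith) one_pos]
  simp

/-- Abel summation with `⌊t⌋ = t - {t}`: the part `t` integrates to `1 / (s - 1)`, and the
fractional part gives `fractMellin`, which continues to `Re s > 0`. -/
lemma riemannZeta₁_eq_of_one_lt {s : ℂ} (hs : 1 < s.re) :
    riemannZeta₁ s = s - s * (s - 1) * fractMellin s := by
  have hs1 : s ≠ 1 := by rintro rfl; simp at hs
  have hsub : s - 1 ≠ 0 := sub_ne_zero.2 hs1
  have h1 : riemannZeta s =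
      s * ∫ t in Ioi (1 : ℝ), (∑ k ∈ Finset.Icc 1 ⌊t⌋₊, (1 : ℕ → ℂ) k) * (t : ℂ) ^ (-(s + 1)) := by
    rw [← LSeries_one_eq_riemannZeta hs]
    refine LSeries_eq_mul_integral' 1 (r := 1) zero_le_one hs ?_
    refine Asymptotics.IsBigO.of_bound 1 (Eventually.of_forall fun n => ?_)
    simp
  have h2 : ∀ t ∈ Ioi (1 : ℝ), (∑ k ∈ Finset.Icc 1 ⌊t⌋₊, (1 : ℕ → ℂ) k) * (t : ℂ) ^ (-(s + 1)) =
      (t : ℂ) ^ (-s) - ((Int.fract t : ℝ) : ℂ) * (t : ℂ) ^ (-(s + 1)) := by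
    intro t ht
    have ht0 : (0 : ℝ) < t := lt_trans one_pos ht
    have e1 : (∑ k ∈ Finset.Icc 1 ⌊t⌋₊, (1 : ℕ → ℂ) k) = ((t - Int.fract t : ℝ) : ℂ) := by
      simp only [Pi.one_apply, Finset.sum_const, Nat.card_Icc, add_tsub_cancel_right,
        nsmul_eq_mul, mul_one, Int.self_sub_fract]
      rw [← natCast_floor_eq_intCast_floor ht0.le]
      simp
    have e2 : (t : ℂ) ^ (-s) = t * (t : ℂ) ^ (-(s + 1)) := by
      have htc : (t : ℂ) ≠ 0 := by exact_mod_cast ht0.ne'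
      rw [show -s = 1 + -(s + 1) by ring, cpow_add _ _ htc, cpow_one]
    rw [e1, e2]; push_cast; ring
  have hi1 : IntegrableOn (fun t : ℝ => (t : ℂ) ^ (-s)) (Ioi 1) :=
    integrableOn_Ioi_cpow_of_lt (by simpa using hs) one_pos
  have hi2 : IntegrableOn (fun t : ℝ => ((Int.fract t : ℝ) : ℂ) * (t : ℂ) ^ (-(s + 1))) (Ioi 1) := by
    refine Integrable.mono' (g := fun t : ℝ => t ^ (-(s.re + 1)))
      (integrableOn_Ioi_rpow_of_lt (by linarith) one_pos) ?_
      ((ae_restrict_iff' measurableSet_Ioi).2 (Eventually.of_forall fun t ht =>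
      norm_fract_mul_le (s := s) ht))
    refine (Complex.measurable_ofReal.comp measurable_fract).aestronglyMeasurable.mul ?_
    exact (continuousOn_cpow_pos _ fun x hx => lt_trans one_pos hx).aestronglyMeasurable
      measurableSet_Ioi
  rw [setIntegral_congr_fun measurableSet_Ioi h2, integral_sub hi1 hi2, ← fractMellin_eq,
    integral_Ioi_cpow_of_lt (by simpa using hs) one_pos, riemannZeta_eq_inv_sub_mul hs1] at h1
  have h3 : riemannZeta₁ s = (s - 1) * ((s - 1)⁻¹ * riemannZeta₁ s) := by field_simp
  rw [h3, h1]
  have h4 : -s + 1 ≠ 0 := by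
    intro h; apply hsub; linear_combination -h
  simp only [ofReal_one, one_cpow]
  field_simp
  ring

lemma riemannZeta₁_eq {s : ℂ} (hs : 0 < s.re) :
    riemannZeta₁ s = s - s * (s - 1) * fractMellin s := by
  have hop : IsOpen {s : ℂ | 0 < s.re} := isOpen_lt continuous_const continuous_re
  have hf : AnalyticOnNhd ℂ riemannZeta₁ {s : ℂ | 0 < s.re} := fun z _ =>
    differentiable_riemannZeta₁.analyticAt z
  have hg : AnalyticOnNhd ℂ (fun s => s - s * (s - 1) * fractMellin s) {s : ℂ | 0 < s.re} := by
    refine DifferentiableOn.analyticOnNhd (fun z hz => ?_) hop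
    have := differentiableAt_fractMellin hz
    exact DifferentiableAt.differentiableWithinAt (by fun_prop)
  refine hf.eqOn_of_preconnected_of_eventuallyEq hg (convex_halfSpace_re_gt 0).isPreconnected
    (show (2 : ℂ) ∈ {s : ℂ | 0 < s.re} by simp) ?_ hs
  filter_upwards [(isOpen_lt continuous_const continuous_re).mem_nhds
    (show (2 : ℂ) ∈ {s : ℂ | 1 < s.re} by simp)] with z hz
  exact riemannZeta₁_eq_of_one_lt hz

lemma norm_riemannZeta₁_le {s : ℂ} (hs : 0 < s.re) :
    ‖riemannZeta₁ s‖ ≤ ‖s‖ + ‖s‖ * ‖s - 1‖ / s.re := by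
  rw [riemannZeta₁_eq hs]
  refine (norm_sub_le _ _).trans ?_
  rw [norm_mul, norm_mul]
  have := mul_le_mul_of_nonneg_left (norm_fractMellin_le hs)
    (mul_nonneg (norm_nonneg s) (norm_nonneg (s - 1)))
  rw [mul_one_div] at this
  linarith

/-- The terms after the first have total modulus at most `π² / 6 - 1`, and `2 - π² / 6 ≥ 1/3`. This
is the lower bound at the disc centre that Landau's lemma needs. -/
lemma norm_riemannZeta_two_add_ge (t : ℝ) : 1 / 3 ≤ ‖riemannZeta (2 + t * I)‖ := by
  have hre : 1 < (2 + t * I : ℂ).re := by simp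
  have hsum : HasSum (fun n : ℕ => 1 / ((n : ℝ) + 1) ^ 2) (Real.pi ^ 2 / 6) := by
    have := (hasSum_nat_add_iff' 1).2 hasSum_zeta_two
    simpa using this
  have hsum1 : HasSum (fun n : ℕ => 1 / ((n : ℝ) + 1 + 1) ^ 2) (Real.pi ^ 2 / 6 - 1) := by
    have := (hasSum_nat_add_iff' 1).2 hsum
    simpa using this
  have hz := zeta_eq_tsum_one_div_nat_add_one_cpow hre
  have hnorm : ∀ n : ℕ, ‖1 / ((n : ℂ) + 1) ^ (2 + t * I : ℂ)‖ = 1 / ((n : ℝ) + 1) ^ 2 := by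
    intro n
    rw [norm_div, norm_one, show ((n : ℂ) + 1) = ((n + 1 : ℝ) : ℂ) by push_cast; ring,
      norm_cpow_eq_rpow_re_of_pos (by positivity)]
    simp
  have hsm : Summable fun n : ℕ => 1 / ((n : ℂ) + 1) ^ (2 + t * I : ℂ) := by
    refine Summable.of_norm ?_
    simp_rw [hnorm]
    exact hsum.summable
  rw [hsm.tsum_eq_zero_add] at hz
  have htail : ‖∑' n : ℕ, 1 / (((n + 1 : ℕ) : ℂ) + 1) ^ (2 + t * I : ℂ)‖ ≤ Real.pi ^ 2 / 6 - 1 := by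
    refine tsum_of_norm_bounded hsum1 fun n => le_of_eq ?_
    rw [hnorm]
    push_cast
    ring
  have h1 : ‖(1 : ℂ) / ((0 : ℕ) + 1) ^ (2 + t * I : ℂ)‖ = 1 := by simp
  have h2 := norm_sub_le_norm_add ((1 : ℂ) / ((0 : ℕ) + 1) ^ (2 + t * I : ℂ))
    (∑' n : ℕ, 1 / (((n + 1 : ℕ) : ℂ) + 1) ^ (2 + t * I : ℂ))
  rw [h1, ← hz] at h2
  have := Real.pi_lt_d2
  nlinarith [Real.pi_pos]

lemma riemannZeta₁_eq_zero_iff (z : ℂ) : riemannZeta₁ z = 0 ↔ riemannZeta z = 0 := by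
  by_cases hz : z = 1
  · subst hz
    simp [riemannZeta_one_ne_zero]
  · rw [riemannZeta_eq_inv_sub_mul hz]
    have : (z - 1)⁻¹ ≠ 0 := inv_ne_zero (sub_ne_zero.2 hz)
    simp [this]

lemma norm_riemannZeta₁_two_add_ge (t : ℝ) : 1 / 3 ≤ ‖riemannZeta₁ (2 + t * I)‖ := by
  have hne : (2 + t * I : ℂ) ≠ 1 := by
    intro h
    have := congrArg re h
    simp at this
  have h := norm_riemannZeta_two_add_ge t
  rw [riemannZeta_eq_inv_sub_mul hne, norm_mul, norm_inv] at h
  have h1 : 1 ≤ ‖(2 + t * I : ℂ) - 1‖ := by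
    refine le_trans (le_of_eq ?_) (re_le_norm _)
    simp; norm_num
  have h2 : ‖(2 + t * I : ℂ) - 1‖⁻¹ ≤ 1 := inv_le_one_of_one_le₀ h1
  exact h.trans (mul_le_of_le_one_left (norm_nonneg _) h2)

lemma norm_riemannZeta₁_le_exp (t : ℝ) {z : ℂ} (hz : ‖z - (2 + t * I)‖ ≤ 199 / 100) :
    ‖riemannZeta₁ z‖ ≤
      Real.exp (8 * Real.log (5 + |t|)) * ‖riemannZeta₁ (2 + t * I)‖ := by
  -- The radius `1.99` about `2 + it` stays inside `Re z ≥ 1/100`, where the growth bound loses only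
  -- a factor `100`. The resulting `101 a²`, with `a = 5 + |t| ≥ 5`, is absorbed by `a ^ 8 / 3`.
  have hre : 1 / 100 ≤ z.re := by
    have := (abs_re_le_norm _).trans hz
    have h := (abs_le.1 this).1
    simp at h
    linarith
  have hnt : ‖(t : ℂ) * I‖ = |t| := by
    rw [norm_mul, norm_I, mul_one, Complex.norm_real, Real.norm_eq_abs]
  have hn : ‖z‖ ≤ 4 + |t| := by
    calc ‖z‖ = ‖(z - (2 + t * I)) + (2 + t * I)‖ := by ring_nf
      _ ≤ ‖z - (2 + t * I)‖ + (‖(2 : ℂ)‖ + ‖(t : ℂ) * I‖) :=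
        (norm_add_le _ _).trans (by gcongr; exact norm_add_le _ _)
      _ ≤ 4 + |t| := by rw [hnt]; norm_num; linarith
  have hn1 : ‖z - 1‖ ≤ 5 + |t| := by
    refine (norm_sub_le _ _).trans ?_
    rw [norm_one]; linarith
  set a := 5 + |t| with ha
  have ha5 : 5 ≤ a := by rw [ha]; linarith [abs_nonneg t]
  have h1 := norm_riemannZeta₁_le (s := z) (by linarith)
  have h2 : ‖z‖ * ‖z - 1‖ / z.re ≤ a * a / (1 / 100) := by
    gcongr
    linarith
  have h3 : ‖riemannZeta₁ z‖ ≤ 101 * a ^ 2 := by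
    have : ‖z‖ ≤ a ^ 2 := by nlinarith
    have e : a * a / (1 / 100) = 100 * a ^ 2 := by ring
    linarith
  have h4 : Real.exp (8 * Real.log a) = a ^ 8 := by
    rw [mul_comm, Real.exp_mul, Real.exp_log (by linarith)]; norm_cast
  rw [h4]
  have h5 := norm_riemannZeta₁_two_add_ge t
  have h6 : 5 ^ 6 ≤ a ^ 6 := pow_le_pow_left₀ (by norm_num) ha5 6
  calc ‖riemannZeta₁ z‖ ≤ 101 * a ^ 2 := h3
    _ ≤ a ^ 6 * (1 / 3) * a ^ 2 := by
      refine mul_le_mul_of_nonneg_right ?_ (sq_nonneg a)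
      linarith
    _ = a ^ 8 * (1 / 3) := by ring
    _ ≤ a ^ 8 * ‖riemannZeta₁ (2 + t * I)‖ := by gcongr

end ZetaGrowth

/-! ### Local zero counts and the size of the logarithmic derivative. -/

section ZetaZeros

open Complex Set Filter Topology

/-- The zeros of `ζ` in the closed disc of radius `r` about `c`. -/
noncomputable def zerosInBall (c : ℂ) (r : ℝ) : Finset ℂ :=
  ((isCompact_closedBall c r).inter_riemannZetaZeros_finite).toFinset

/-- The zeros of `ζ` in the rectangle `[a, b] × [c, d]`. -/
noncomputable def zerosInRect (a b c d : ℝ) : Finset ℂ :=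
  ((isCompact_Icc (a := a) (b := b)).reProdIm
    (isCompact_Icc (a := c) (b := d))).inter_riemannZetaZeros_finite.toFinset

lemma mem_zerosInBall {c : ℂ} {r : ℝ} {z : ℂ} :
    z ∈ zerosInBall c r ↔ riemannZeta₁ z = 0 ∧ ‖z - c‖ ≤ r := by
  rw [zerosInBall, Set.Finite.mem_toFinset, mem_inter_iff, mem_riemannZetaZeros,
    riemannZeta₁_eq_zero_iff, Metric.mem_closedBall, dist_eq_norm, and_comm]

lemma mem_zerosInRect {a b c d : ℝ} {z : ℂ} :
    z ∈ zerosInRect a b c d ↔ riemannZeta₁ z = 0 ∧ z ∈ Icc a b ×ℂ Icc c d := by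
  rw [zerosInRect, Set.Finite.mem_toFinset, mem_inter_iff, mem_riemannZetaZeros,
    riemannZeta₁_eq_zero_iff, and_comm]

/-- The multiplicity of a zero of `ζ`. -/
noncomputable def zeroMult (ρ : ℂ) : ℕ := analyticOrderNatAt riemannZeta₁ ρ

lemma riemannZeta₁_ne_zero_two_add (t : ℝ) : riemannZeta₁ (2 + t * I) ≠ 0 := fun h => by
  have := norm_riemannZeta₁_two_add_ge t
  rw [h, norm_zero] at this
  norm_num at this

lemma one_le_zeroMult {ρ : ℂ} (hρ : riemannZeta₁ ρ = 0) : 1 ≤ zeroMult ρ := by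
  rw [Nat.one_le_iff_ne_zero, zeroMult]
  intro h
  have h1 := Nat.cast_analyticOrderNatAt (analyticOrderAt_ne_top_of_entire
    differentiable_riemannZeta₁ (riemannZeta₁_ne_zero_two_add 0) ρ)
  rw [h] at h1
  exact ((differentiable_riemannZeta₁.analyticAt ρ).analyticOrderAt_eq_zero).1
    (by simpa using h1.symm) hρ

lemma log_five_add_pos (t : ℝ) : 0 < Real.log (5 + |t|) :=
  Real.log_pos (by linarith [abs_nonneg t])

lemma exists_sum_zeroMult_ball_le : ∃ C : ℝ, 1 ≤ C ∧ ∀ t : ℝ,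
    ∑ ρ ∈ zerosInBall (2 + t * I) (197 / 100), (zeroMult ρ : ℝ) ≤ C * Real.log (5 + |t|) := by
  have hl : 0 < Real.log ((199 / 100 : ℝ) / (197 / 100)) := Real.log_pos (by norm_num)
  refine ⟨max 1 (8 / Real.log ((199 / 100 : ℝ) / (197 / 100))), le_max_left _ _, fun t => ?_⟩
  have h := (landau differentiable_riemannZeta₁ (r₁ := 1) (r₂ := 197 / 100) (R := 199 / 100)
    (M := 8 * Real.log (5 + |t|)) one_pos (by norm_num) (by norm_num)
    (by have := log_five_add_pos t; positivity) (2 + t * I) (riemannZeta₁_ne_zero_two_add t)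
    (fun z hz => norm_riemannZeta₁_le_exp t (by simpa [dist_eq_norm] using hz))
    (fun z => mem_zerosInBall)).1
  rw [← le_div_iff₀ hl] at h
  refine h.trans ?_
  rw [mul_div_right_comm]
  exact mul_le_mul_of_nonneg_right (le_max_right _ _) (log_five_add_pos t).le

lemma exists_norm_logDeriv_sub_polePart_le : ∃ C : ℝ, 1 ≤ C ∧ ∀ (t : ℝ) (z : ℂ),
    ‖z - (2 + t * I)‖ ≤ 7 / 4 → riemannZeta₁ z ≠ 0 →
    ‖logDeriv riemannZeta₁ z - polePart riemannZeta₁ (zerosInBall (2 + t * I) (19 / 10)) z‖ ≤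
      C * Real.log (5 + |t|) := by
  set K : ℝ := 8 * (19 / 10) / (19 / 10 - 7 / 4) ^ 2 +
    1 / ((199 / 100 - 19 / 10) * Real.log ((199 / 100) / (19 / 10))) with hK
  refine ⟨max 1 (K * 8), le_max_left _ _, fun t z hz hz0 => ?_⟩
  have h := (landau differentiable_riemannZeta₁ (r₁ := 7 / 4) (r₂ := 19 / 10) (R := 199 / 100)
    (M := 8 * Real.log (5 + |t|)) (by norm_num) (by norm_num) (by norm_num)
    (by have := log_five_add_pos t; positivity) (2 + t * I) (riemannZeta₁_ne_zero_two_add t)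
    (fun z hz => norm_riemannZeta₁_le_exp t (by simpa [dist_eq_norm] using hz))
    (fun z => mem_zerosInBall)).2 z hz hz0
  refine h.trans ?_
  rw [← hK, ← mul_assoc]
  exact mul_le_mul_of_nonneg_right (le_max_right _ _) (log_five_add_pos t).le

/-- A bound for `ζ₁'/ζ₁` at points which are not too close to the zeros. -/
lemma exists_norm_logDeriv_le : ∃ C : ℝ, 1 ≤ C ∧ ∀ (z : ℂ) (d : ℝ), 1 / 4 ≤ z.re → z.re ≤ 2 →
    0 < d → d ≤ 1 → (∀ ρ, riemannZeta₁ ρ = 0 → 1 / 10 ≤ ρ.re → |ρ.im - z.im| ≤ 2 → d ≤ ‖z - ρ‖) →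
    ‖logDeriv riemannZeta₁ z‖ ≤ C * Real.log (5 + |z.im|) / d := by
  obtain ⟨C₁, hC₁, h₁⟩ := exists_sum_zeroMult_ball_le
  obtain ⟨C₂, hC₂, h₂⟩ := exists_norm_logDeriv_sub_polePart_le
  refine ⟨C₁ + C₂, by linarith, fun z d hz1 hz2 hd hd1 hρ => ?_⟩
  set t := z.im with ht
  have hlog := log_five_add_pos t
  have hzc : z - (2 + t * I) = ((z.re - 2 : ℝ) : ℂ) := by
    apply Complex.ext <;> simp [ht]
  have hz : ‖z - (2 + t * I)‖ ≤ 7 / 4 := by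
    rw [hzc, Complex.norm_real, Real.norm_eq_abs, abs_le]
    constructor <;> linarith
  have hball : ∀ ρ ∈ zerosInBall (2 + t * I) (19 / 10), d ≤ ‖z - ρ‖ := by
    intro ρ hm
    obtain ⟨h0, hb⟩ := mem_zerosInBall.1 hm
    refine hρ ρ h0 ?_ ?_
    · have := (abs_le.1 ((abs_re_le_norm _).trans hb)).1
      simp at this
      linarith
    · have := (abs_im_le_norm _).trans hb
      simp at this
      linarith
  have hz0 : riemannZeta₁ z ≠ 0 := by
    intro h
    have := hρ z h (by linarith) (by simp [ht])
    simp at this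
    linarith
  have hpp : ‖polePart riemannZeta₁ (zerosInBall (2 + t * I) (19 / 10)) z‖ ≤
      C₁ * Real.log (5 + |t|) / d := by
    rw [polePart]
    refine (norm_sum_le _ _).trans ?_
    calc _ ≤ ∑ ρ ∈ zerosInBall (2 + t * I) (19 / 10), (zeroMult ρ : ℝ) / d := by
          refine Finset.sum_le_sum fun ρ hm => ?_
          rw [norm_div, Complex.norm_natCast]
          exact div_le_div_of_nonneg_left (Nat.cast_nonneg _) hd (hball ρ hm)
      _ ≤ ∑ ρ ∈ zerosInBall (2 + t * I) (197 / 100), (zeroMult ρ : ℝ) / d := by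
          refine Finset.sum_le_sum_of_subset_of_nonneg (fun ρ hm => ?_) fun _ _ _ => by positivity
          rw [mem_zerosInBall] at hm ⊢
          exact ⟨hm.1, hm.2.trans (by norm_num)⟩
      _ ≤ _ := by
          rw [← Finset.sum_div]
          exact div_le_div_of_nonneg_right (h₁ t) hd.le
  have hr := h₂ t z hz hz0
  have hr2 : C₂ * Real.log (5 + |t|) ≤ C₂ * Real.log (5 + |t|) / d := by
    rw [le_div_iff₀ hd]
    exact mul_le_of_le_one_right (by positivity) hd1
  calc ‖logDeriv riemannZeta₁ z‖ = ‖(logDeriv riemannZeta₁ z -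
        polePart riemannZeta₁ (zerosInBall (2 + t * I) (19 / 10)) z) +
        polePart riemannZeta₁ (zerosInBall (2 + t * I) (19 / 10)) z‖ := by ring_nf
    _ ≤ C₂ * Real.log (5 + |t|) / d + C₁ * Real.log (5 + |t|) / d :=
        (norm_add_le _ _).trans (add_le_add (hr.trans hr2) hpp)
    _ = (C₁ + C₂) * Real.log (5 + |t|) / d := by ring

/-- Cut the rectangle into unit slabs according to the integer part of the height above the bottom
edge and apply the disc count to each. -/
lemma exists_sum_zeroMult_rect_le : ∃ C : ℝ, 1 ≤ C ∧ ∀ γ H : ℝ, 1 ≤ H →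
    ∑ ρ ∈ zerosInRect (1 / 10) 1 (γ - H) (γ + H), (zeroMult ρ : ℝ) ≤
      C * (H * Real.log (7 + |γ| + H)) := by
  obtain ⟨C₁, hC₁, h₁⟩ := exists_sum_zeroMult_ball_le
  refine ⟨3 * C₁, by linarith, fun γ H hH => ?_⟩
  set k : ℂ → ℕ := fun ρ => ⌊ρ.im - (γ - H)⌋₊ with hk
  set K : ℕ := ⌊2 * H⌋₊ + 1 with hK
  have hmaps : ∀ ρ ∈ zerosInRect (1 / 10) 1 (γ - H) (γ + H), k ρ ∈ Finset.range K := by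
    intro ρ hρ
    obtain ⟨-, -, -, h4⟩ := mem_zerosInRect.1 hρ
    rw [Finset.mem_range, hK, Nat.lt_succ_iff]
    exact Nat.floor_le_floor (by linarith)
  rw [← Finset.sum_fiberwise_of_maps_to hmaps]
  have hKle : (K : ℝ) ≤ 3 * H := by
    rw [hK]; push_cast
    have := Nat.floor_le (show 0 ≤ 2 * H by linarith)
    linarith
  calc _ ≤ ∑ j ∈ Finset.range K, C₁ * Real.log (7 + |γ| + H) := by
        refine Finset.sum_le_sum fun j hj => ?_
        set t : ℝ := γ - H + j + 1 / 2 with ht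
        have hjK : (j : ℝ) ≤ 2 * H := by
          have h := Finset.mem_range.1 hj
          rw [hK, Nat.lt_succ_iff] at h
          exact (Nat.cast_le.2 h).trans (Nat.floor_le (by linarith))
        have hjn : (0 : ℝ) ≤ j := Nat.cast_nonneg j
        have htle : |t| ≤ |γ| + H + 1 := by
          rw [ht, abs_le]
          constructor <;> linarith [neg_abs_le γ, le_abs_self γ]
        calc _ ≤ ∑ ρ ∈ zerosInBall (2 + t * I) (197 / 100), (zeroMult ρ : ℝ) := by
              refine Finset.sum_le_sum_of_subset_of_nonneg (fun ρ hm => ?_)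
                fun _ _ _ => by positivity
              rw [Finset.mem_filter, mem_zerosInRect] at hm
              obtain ⟨⟨h0, ⟨h1, h2⟩, h3, h4⟩, h5⟩ := hm
              rw [mem_zerosInBall]
              refine ⟨h0, ?_⟩
              have f1 : (j : ℝ) ≤ ρ.im - (γ - H) := by
                rw [← h5]; exact Nat.floor_le (by linarith [h3])
              have f2 : ρ.im - (γ - H) < j + 1 := by
                rw [← h5]; exact Nat.lt_floor_add_one _
              -- A slab of height one fits in the disc about `2 + it` because `1.9² + 0.5² = 3.86 <
              -- 1.97²`.
              rw [← sq_le_sq₀ (norm_nonneg _) (by norm_num), ← normSq_eq_norm_sq, normSq_apply]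
              simp only [sub_re, sub_im, add_re, add_im, mul_re, mul_im, ofReal_re, ofReal_im, I_re,
                I_im, re_ofNat, im_ofNat]
              have g1 : (ρ.re - 2) ^ 2 ≤ (19 / 10) ^ 2 := by
                rw [sq_le_sq, abs_of_nonpos (by linarith [h2]), abs_of_pos (by norm_num)]
                linarith [h1]
              have g2 : (ρ.im - t) ^ 2 ≤ (1 / 2) ^ 2 := by
                rw [sq_le_sq, abs_of_pos (show (0 : ℝ) < 1 / 2 by norm_num), abs_le, ht]
                constructor <;> linarith
              nlinarith
          _ ≤ C₁ * Real.log (5 + |t|) := h₁ t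
          _ ≤ C₁ * Real.log (7 + |γ| + H) := by
              refine mul_le_mul_of_nonneg_left (Real.log_le_log ?_ ?_) (by linarith)
              · linarith [abs_nonneg t]
              · linarith
    _ = K * (C₁ * Real.log (7 + |γ| + H)) := by simp
    _ ≤ 3 * H * (C₁ * Real.log (7 + |γ| + H)) := by
        have : 0 ≤ Real.log (7 + |γ| + H) := Real.log_nonneg (by linarith [abs_nonneg γ])
        gcongr
    _ = 3 * C₁ * (H * Real.log (7 + |γ| + H)) := by ring

end ZetaZeros

end HalfIsolated

namespace HalfIsolated

/-! ### The detector as an integral of `-ζ'/ζ` along a vertical line. -/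

section MellinRepresentation

open Complex Set MeasureTheory Filter Topology

lemma exp_neg_sqrt_le (y : ℝ) : Real.exp (-Real.sqrt |y|) ≤ 25 * (1 + y ^ 2)⁻¹ := by
  have h0 : (0 : ℝ) < 1 + y ^ 2 := by positivity
  rw [← div_eq_mul_inv, le_div_iff₀ h0, Real.exp_neg, inv_mul_le_iff₀ (Real.exp_pos _)]
  have h1 := Real.one_le_exp (Real.sqrt_nonneg |y|)
  have h2 := Real.pow_div_factorial_le_exp (x := Real.sqrt |y|) (Real.sqrt_nonneg _) 4
  have h3 : Real.sqrt |y| ^ 4 = y ^ 2 := by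
    rw [show 4 = 2 * 2 by norm_num, pow_mul, Real.sq_sqrt (abs_nonneg y), sq_abs]
  rw [h3, div_le_iff₀ (by positivity)] at h2
  norm_num [Nat.factorial] at h2
  linarith

/-- One fiftieth of the exponent is spent on integrability, through `x ^ 4 / 4! ≤ exp x` at `x =
√|y| / 50`; the other `49/50` survives as decay in `R`. -/
lemma exp_neg_sqrt_le_of_le {R y : ℝ} (hy : R ≤ |y|) :
    Real.exp (-Real.sqrt |y|) ≤
      (1 + 24 * 50 ^ 4) * Real.exp (-(49 / 50 * Real.sqrt R)) * (1 + y ^ 2)⁻¹ := by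
  have h0 : (0 : ℝ) < 1 + y ^ 2 := by positivity
  set x := Real.sqrt |y| with hx
  have hx0 : 0 ≤ x := Real.sqrt_nonneg _
  have hRx : Real.sqrt R ≤ x := Real.sqrt_le_sqrt hy
  have h3 : x ^ 4 = y ^ 2 := by
    rw [show 4 = 2 * 2 by norm_num, pow_mul, Real.sq_sqrt (abs_nonneg y), sq_abs]
  have h4 : Real.exp (-(x / 50)) * (1 + y ^ 2) ≤ 1 + 24 * 50 ^ 4 := by
    have h1 := Real.one_le_exp (show 0 ≤ x / 50 by positivity)
    have h2 := Real.pow_div_factorial_le_exp (x := x / 50) (by positivity) 4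
    rw [div_pow, h3, div_div, div_le_iff₀ (by positivity)] at h2
    norm_num [Nat.factorial] at h2
    rw [Real.exp_neg, inv_mul_le_iff₀ (Real.exp_pos _)]
    norm_num
    linarith
  have h5 : Real.exp (-x) = Real.exp (-(49 / 50 * x)) * Real.exp (-(x / 50)) := by
    rw [← Real.exp_add]; congr 1; ring
  rw [← div_eq_mul_inv, le_div_iff₀ h0, h5, mul_assoc, mul_comm]
  exact mul_le_mul h4 (Real.exp_le_exp.2 (by linarith)) (Real.exp_pos _).le (by norm_num)

/-- The kernel `W(z - ρ₀) U ^ (z - ρ₀)` of the explicit formula. -/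
noncomputable def kernel (ρ₀ : ℂ) (U : ℝ) (z : ℂ) : ℂ :=
  mellinWeight (z - ρ₀) * (U : ℂ) ^ (z - ρ₀)

lemma differentiable_kernel (ρ₀ : ℂ) {U : ℝ} (hU : 0 < U) : Differentiable ℂ (kernel ρ₀ U) := by
  have hUc : (U : ℂ) ≠ 0 := by exact_mod_cast hU.ne'
  intro z
  refine DifferentiableAt.mul ?_ ?_
  · exact (differentiable_mellinWeight (z - ρ₀)).comp z (by fun_prop)
  · exact DifferentiableAt.const_cpow (by fun_prop) (Or.inl hUc)

lemma norm_kernel (ρ₀ : ℂ) {U : ℝ} (hU : 0 < U) (z : ℂ) :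
    ‖kernel ρ₀ U z‖ = ‖mellinWeight (z - ρ₀)‖ * U ^ (z.re - ρ₀.re) := by
  rw [kernel, norm_mul, norm_cpow_eq_rpow_re_of_pos hU, sub_re]

lemma continuous_vertical {F : ℂ → ℂ} (hF : Continuous F) (b : ℝ) :
    Continuous fun y : ℝ => F (b + y * I) := hF.comp (by fun_prop)

lemma norm_mellinWeight_vertical_le {C : ℝ} (hC : ∀ s : ℂ, |s.re| ≤ 2 →
    ‖s‖ * ‖mellinWeight s‖ ≤ C * Real.exp (-Real.sqrt |s.im|)) {s : ℂ} (hs : |s.re| ≤ 2)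
    {δ : ℝ} (hδ : 0 < δ) (hδs : δ ≤ ‖s‖) :
    ‖mellinWeight s‖ ≤ C / δ * Real.exp (-Real.sqrt |s.im|) := by
  have h := hC s hs
  have h2 : δ * ‖mellinWeight s‖ ≤ C * Real.exp (-Real.sqrt |s.im|) :=
    (mul_le_mul_of_nonneg_right hδs (norm_nonneg _)).trans h
  rw [div_mul_eq_mul_div, le_div_iff₀ hδ]
  linarith

lemma integrable_kernel (ρ₀ : ℂ) {U b : ℝ} (hU : 0 < U) (hb : ρ₀.re < b) (hb2 : b ≤ ρ₀.re + 2) :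
    Integrable fun y : ℝ => kernel ρ₀ U (b + y * I) := by
  obtain ⟨C, hC1, hC⟩ := exists_norm_mul_mellinWeight_le
  have hδ : 0 < b - ρ₀.re := by linarith
  have hint : Integrable fun y : ℝ =>
      C / (b - ρ₀.re) * U ^ (b - ρ₀.re) * (25 * (1 + (y - ρ₀.im) ^ 2)⁻¹) :=
    ((integrable_inv_one_add_sq.comp_sub_right ρ₀.im).const_mul 25).const_mul _
  refine hint.mono' (continuous_vertical (differentiable_kernel ρ₀ hU).continuous
    b).aestronglyMeasurable (Eventually.of_forall fun y => ?_)
  rw [norm_kernel ρ₀ hU]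
  set z : ℂ := b + y * I with hz
  have hzre : z.re = b := by simp [hz]
  have hzim : z.im = y := by simp [hz]
  have hsre : (z - ρ₀).re = b - ρ₀.re := by simp [hzre]
  have hsim : (z - ρ₀).im = y - ρ₀.im := by simp [hzim]
  have h1 := norm_mellinWeight_vertical_le hC (s := z - ρ₀)
    (by rw [hsre, abs_of_pos hδ]; linarith) hδ (by
      rw [← hsre]; exact re_le_norm _)
  have h2 := exp_neg_sqrt_le (y - ρ₀.im)
  rw [hsim] at h1
  rw [hzre]
  calc _ ≤ (C / (b - ρ₀.re) * (25 * (1 + (y - ρ₀.im) ^ 2)⁻¹)) * U ^ (b - ρ₀.re) := by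
        gcongr
        exact h1.trans (by gcongr)
    _ = _ := by ring

lemma w₀_eq_integral (ρ₀ : ℂ) {b x : ℝ} (hx : 0 < x) (hb : ρ₀.re < b) (hb2 : b ≤ ρ₀.re + 2) :
    (w₀ x : ℂ) = 1 / (2 * Real.pi) *
      ∫ y : ℝ, (x : ℂ) ^ (-(b + y * I - ρ₀)) * mellinWeight (b + y * I - ρ₀) := by
  have hk := integrable_kernel ρ₀ (U := 1) one_pos hb hb2
  have hvert : VerticalIntegrable (mellin (fun x => (w₀ x : ℂ))) (b - ρ₀.re) := by
    have h := hk.comp_add_right ρ₀.im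
    refine h.congr (Eventually.of_forall fun y => ?_)
    simp only [kernel, ofReal_one, one_cpow, mul_one, mellinWeight]
    congr 1
    apply Complex.ext <;> simp
  have h := mellinInv_mellin_eq (b - ρ₀.re) (fun x => (w₀ x : ℂ)) hx (mellinConvergent_w₀ _)
    hvert (Complex.continuous_ofReal.comp continuous_w₀).continuousAt
  rw [← h, mellinInv]
  have h2 := integral_sub_right_eq_self (μ := volume)
    (fun y : ℝ => (x : ℂ) ^ (-(((b - ρ₀.re : ℝ) : ℂ) + y * I)) •
      mellin (fun x => (w₀ x : ℂ)) (((b - ρ₀.re : ℝ) : ℂ) + y * I)) ρ₀.im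
  rw [← h2, real_smul]
  push_cast
  congr 1
  refine integral_congr_ae (Eventually.of_forall fun y => ?_)
  have e : ((b : ℂ) - ρ₀.re) + (y - ρ₀.im) * I = b + y * I - ρ₀ := by
    apply Complex.ext <;> simp
  simp only [smul_eq_mul, mellinWeight, e]

/-- Mellin inversion term by term. The interchange is absolute: on `Re z = b > 1` the moduli of the
Dirichlet terms do not depend on the height and are summable, and the kernel is integrable. -/
lemma detector_eq_integral (ρ₀ : ℂ) {U b : ℝ} (hU : 0 < U) (hb1 : 1 < b) (hb : ρ₀.re < b)
    (hb2 : b ≤ ρ₀.re + 2) :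
    detector U ρ₀ = 1 / (2 * Real.pi) * ∫ y : ℝ,
      LSeries (fun n => (ArithmeticFunction.vonMangoldt n : ℂ)) (b + y * I) *
        kernel ρ₀ U (b + y * I) := by
  set Λ : ℕ → ℂ := fun n => (ArithmeticFunction.vonMangoldt n : ℂ) with hΛ
  set F : ℕ → ℝ → ℂ := fun n y => LSeries.term Λ (b + y * I) n * kernel ρ₀ U (b + y * I) with hF
  have hk := integrable_kernel ρ₀ hU hb hb2
  have hUc : (U : ℂ) ≠ 0 := by exact_mod_cast hU.ne'
  have hnorm : ∀ n (y : ℝ), ‖LSeries.term Λ (b + y * I) n‖ = ‖LSeries.term Λ b n‖ := by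
    intro n y
    rw [LSeries.norm_term_eq, LSeries.norm_term_eq]
    simp
  have hFint : ∀ n, Integrable (F n) := by
    intro n
    refine (hk.norm.const_mul ‖LSeries.term Λ b n‖).mono' ?_ (Eventually.of_forall fun y => ?_)
    · refine Continuous.aestronglyMeasurable (Continuous.mul ?_
        (continuous_vertical (differentiable_kernel ρ₀ hU).continuous b))
      rcases eq_or_ne n 0 with rfl | hn
      · simp only [LSeries.term_zero]; exact continuous_const
      · simp only [LSeries.term_of_ne_zero hn]
        refine Continuous.div continuous_const ?_ fun y => ?_
        · have hnc : (n : ℂ) ≠ 0 := by exact_mod_cast hn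
          exact Continuous.const_cpow (by fun_prop) (Or.inl hnc)
        · rw [cpow_ne_zero_iff]; left; exact_mod_cast hn
    · rw [hF, norm_mul, hnorm]
  have hsum : Summable fun n => ∫ y, ‖F n y‖ := by
    have : ∀ n, ∫ y, ‖F n y‖ = ‖LSeries.term Λ b n‖ * ∫ y : ℝ, ‖kernel ρ₀ U (b + y * I)‖ := by
      intro n
      rw [← integral_const_mul]
      congr 1
      ext y
      rw [hF, norm_mul, hnorm]
    simp_rw [this]
    refine Summable.mul_right _ (Summable.norm ?_)
    exact ArithmeticFunction.LSeriesSummable_vonMangoldt (s := (b : ℂ)) (by simpa using hb1)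
  have hHS := hasSum_integral_of_summable_integral_norm hFint hsum
  have hterm : ∀ n : ℕ, (ArithmeticFunction.vonMangoldt n : ℂ) / (n : ℂ) ^ ρ₀ *
      (w₀ ((n : ℝ) / U) : ℂ) = 1 / (2 * Real.pi) * ∫ y, F n y := by
    intro n
    rcases eq_or_ne n 0 with rfl | hn
    · simp [hF]
    have hn0 : (0 : ℝ) < n := by exact_mod_cast Nat.pos_of_ne_zero hn
    have hnc : (n : ℂ) ≠ 0 := by exact_mod_cast hn
    rw [w₀_eq_integral ρ₀ (div_pos hn0 hU) hb hb2, mul_left_comm, ← integral_const_mul]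
    congr 2
    ext y
    rw [hF]
    simp only [LSeries.term_of_ne_zero hn, kernel]
    set z : ℂ := b + y * I with hz
    have e1 : (((n : ℝ) / U : ℝ) : ℂ) ^ (-(z - ρ₀)) = (n : ℂ) ^ (-(z - ρ₀)) * (U : ℂ) ^ (z - ρ₀) := by
      rw [div_eq_mul_inv, ofReal_mul, mul_cpow_ofReal_nonneg hn0.le (inv_nonneg.2 hU.le),
        ofReal_natCast, ofReal_inv, inv_cpow, cpow_neg (U : ℂ), inv_inv]
      rw [arg_ofReal_of_nonneg hU.le]
      exact Real.pi_ne_zero.symm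
    have e2 : (n : ℂ) ^ (-(z - ρ₀)) = (n : ℂ) ^ ρ₀ / (n : ℂ) ^ z := by
      rw [neg_sub, cpow_sub _ _ hnc]
    have e3 : (n : ℂ) ^ ρ₀ ≠ 0 := by rw [cpow_ne_zero_iff]; left; exact hnc
    rw [e1, e2, hΛ]
    field_simp
  rw [detector]
  simp_rw [hterm]
  rw [tsum_mul_left, hHS.tsum_eq]
  congr 2
  ext y
  rw [hF]
  simp only
  rw [tsum_mul_right]
  rfl

lemma exists_norm_LSeries_vonMangoldt_le {b : ℝ} (hb : 1 < b) : ∃ C : ℝ, 1 ≤ C ∧ ∀ y : ℝ,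
    ‖LSeries (fun n => (ArithmeticFunction.vonMangoldt n : ℂ)) (b + y * I)‖ ≤ C := by
  set Λ : ℕ → ℂ := fun n => (ArithmeticFunction.vonMangoldt n : ℂ) with hΛ
  have hs : Summable fun n => ‖LSeries.term Λ b n‖ :=
    (ArithmeticFunction.LSeriesSummable_vonMangoldt (s := (b : ℂ)) (by simpa using hb)).norm
  refine ⟨max 1 (∑' n, ‖LSeries.term Λ b n‖), le_max_left _ _, fun y => ?_⟩
  refine le_trans ?_ (le_max_right _ _)
  refine tsum_of_norm_bounded hs.hasSum fun n => le_of_eq ?_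
  rw [LSeries.norm_term_eq, LSeries.norm_term_eq]
  simp

lemma LSeries_vonMangoldt_eq_logDeriv {z : ℂ} (hz : 1 < z.re) :
    LSeries (fun n => (ArithmeticFunction.vonMangoldt n : ℂ)) z =
      1 / (z - 1) - logDeriv riemannZeta₁ z := by
  have hz1 : z ≠ 1 := by rintro rfl; simp at hz
  have hsub : z - 1 ≠ 0 := sub_ne_zero.2 hz1
  have h1 : riemannZeta₁ z ≠ 0 := by
    rw [Ne, riemannZeta₁_eq_zero_iff]
    exact riemannZeta_ne_zero_of_one_lt_re hz
  rw [ArithmeticFunction.LSeries_vonMangoldt_eq_deriv_riemannZeta_div hz]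
  have h2 : riemannZeta =ᶠ[𝓝 z] fun w => (w - 1)⁻¹ * riemannZeta₁ w := by
    filter_upwards [isOpen_ne.mem_nhds hz1] with w hw
    exact riemannZeta_eq_inv_sub_mul hw
  have h3 : logDeriv riemannZeta z = logDeriv (fun w => (w - 1)⁻¹ * riemannZeta₁ w) z := by
    rw [logDeriv_apply, logDeriv_apply, h2.deriv_eq, h2.eq_of_nhds]
  have h4 : logDeriv (fun w : ℂ => (w - 1)⁻¹) z = -(1 / (z - 1)) := by
    rw [logDeriv_apply]
    have : HasDerivAt (fun w : ℂ => (w - 1)⁻¹) (-1 / (z - 1) ^ 2) z :=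
      ((hasDerivAt_id z).sub_const 1).fun_inv hsub
    rw [this.deriv]
    field_simp
  rw [neg_div, ← logDeriv_apply, h3, logDeriv_mul (f := fun w : ℂ => (w - 1)⁻¹) z
    (inv_ne_zero hsub) h1 (by fun_prop (disch := exact hsub)) (differentiable_riemannZeta₁ z), h4]
  ring

end MellinRepresentation

end HalfIsolated

namespace HalfIsolated

/-! ### Shifting the contour across a rectangle. -/

section ExplicitFormula

open Complex Set MeasureTheory Filter Topology

/-- A point of an interval which keeps its distance from a finite set. -/
lemma exists_mem_Icc_far (S : Finset ℝ) {u v : ℝ} (huv : u < v) :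
    ∃ x ∈ Icc u v, ∀ s ∈ S, (v - u) / (2 * (S.card + 1)) ≤ |x - s| := by
  by_contra! hcon
  set n := S.card with hn
  set w : ℝ := (v - u) / (2 * (n + 1)) with hw
  have hw0 : 0 < w := div_pos (by linarith) (by positivity)
  have hwn : 2 * (n + 1) * w = v - u := by rw [hw]; field_simp
  have hmem : ∀ i ∈ Finset.range (n + 1), u + (2 * i + 1) * w ∈ Icc u v := by
    intro i hi
    have hi' : (i : ℝ) ≤ n := by
      exact_mod_cast Nat.lt_succ_iff.1 (Finset.mem_range.1 hi)
    have hi0 : (0 : ℝ) ≤ i := Nat.cast_nonneg i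
    constructor
    · have : 0 ≤ (2 * (i : ℝ) + 1) * w := by positivity
      linarith
    · nlinarith
  have hch : ∀ i : ℕ, ∃ s, i ∈ Finset.range (n + 1) → s ∈ S ∧ |u + (2 * i + 1) * w - s| < w := by
    intro i
    by_cases hi : i ∈ Finset.range (n + 1)
    · obtain ⟨s, hs, h⟩ := hcon _ (hmem i hi)
      exact ⟨s, fun _ => ⟨hs, h⟩⟩
    · exact ⟨0, fun h => absurd h hi⟩
  choose f hf using hch
  obtain ⟨i, hi, j, hj, hij, hfij⟩ := Finset.exists_ne_map_eq_of_card_lt_of_maps_to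
    (s := Finset.range (n + 1)) (t := S) (by simp [hn]) (fun i hi => (hf i hi).1)
  have h1 := (hf i hi).2
  have h2 := (hf j hj).2
  rw [hfij] at h1
  have h3 : |(2 * ((i : ℝ) - j)) * w| < 2 * w := by
    have : (2 * ((i : ℝ) - j)) * w = (u + (2 * i + 1) * w - f j) - (u + (2 * j + 1) * w - f j) := by
      ring
    rw [this]
    exact (abs_sub _ _).trans_lt (by linarith)
  rw [abs_mul, abs_mul, abs_of_pos hw0, abs_of_pos (show (0 : ℝ) < 2 by norm_num)] at h3
  have h4 : |(i : ℝ) - j| < 1 := by nlinarith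
  have h5 : |(i : ℤ) - j| < 1 := by exact_mod_cast h4
  rw [Int.abs_lt_one_iff] at h5
  exact hij (by omega)

lemma norm_setIntegral_le_pi {S : Set ℝ} (hS : MeasurableSet S) {G : ℝ → ℂ} {B γ : ℝ} (hB : 0 ≤ B)
    (h : ∀ y ∈ S, ‖G y‖ ≤ B * (1 + (y - γ) ^ 2)⁻¹) : ‖∫ y in S, G y‖ ≤ B * Real.pi := by
  have hint : Integrable fun y : ℝ => B * (1 + (y - γ) ^ 2)⁻¹ :=
    (integrable_inv_one_add_sq.comp_sub_right γ).const_mul B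
  have h1 := norm_integral_le_of_norm_le hint.integrableOn
    ((ae_restrict_iff' hS).2 (Eventually.of_forall h))
  refine h1.trans ((setIntegral_le_integral hint (Eventually.of_forall fun y => ?_)).trans ?_)
  · have : (0 : ℝ) < 1 + (y - γ) ^ 2 := by positivity
    simp only [Pi.zero_apply]
    positivity
  · rw [integral_const_mul, integral_sub_right_eq_self (fun y : ℝ => (1 + y ^ 2)⁻¹),
      integral_univ_inv_one_add_sq]

/-- `ζ'/ζ`, written through `ζ₁`. -/
noncomputable def zetaLogDeriv (z : ℂ) : ℂ := logDeriv riemannZeta₁ z - 1 / (z - 1)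

/-- The part of the line `Re z = b` between heights `c` and `d` is replaced by the other three sides
plus residues at the zeros; the part outside stays as a tail. The pole at `1` plays no role because
the rectangle lies above the real axis. -/
lemma norm_detector_add_le {ρ₀ : ℂ} {U a b c d E₁ E₂ E₃ : ℝ} (hU : 0 < U) (hab : a ≤ b)
    (hc : 0 < c) (hcd : c ≤ d) (hb1 : 1 < b) (hb : ρ₀.re < b) (hb2 : b ≤ ρ₀.re + 2)
    (hbd : ∀ z ∈ rectBoundary a b c d, riemannZeta₁ z ≠ 0)
    (hhor : ∀ x ∈ Icc a b, ∀ y, y = c ∨ y = d →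
      ‖kernel ρ₀ U (x + y * I) * zetaLogDeriv (x + y * I)‖ ≤ E₁)
    (hleft : ‖∫ y in Ioc c d, kernel ρ₀ U (a + y * I) * zetaLogDeriv (a + y * I)‖ ≤ E₂)
    (htail : ‖∫ y in (Ioc c d)ᶜ, kernel ρ₀ U (b + y * I) * zetaLogDeriv (b + y * I)‖ ≤ E₃) :
    ‖detector U ρ₀ + ∑ ρ ∈ zerosInRect a b c d, (zeroMult ρ : ℂ) * kernel ρ₀ U ρ‖ ≤
      2 * (E₁ * (b - a)) + E₂ + E₃ := by
  set G : ℂ → ℂ := fun z => kernel ρ₀ U z * zetaLogDeriv z with hG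
  set S₀ := ∑ ρ ∈ zerosInRect a b c d, (zeroMult ρ : ℂ) * kernel ρ₀ U ρ with hS₀
  have hk := differentiable_kernel ρ₀ hU
  have hz1 : ∀ z ∈ Icc a b ×ℂ Icc c d, z - 1 ≠ 0 := by
    intro z hz h
    have h1 := hz.2.1
    rw [sub_eq_zero] at h
    rw [h] at h1
    simp only [one_im] at h1
    linarith
  have hcontL : ContinuousOn (fun z => kernel ρ₀ U z * logDeriv riemannZeta₁ z)
      (rectBoundary a b c d) := by
    refine hk.continuous.continuousOn.mul fun z hz => ?_
    have h1 : DifferentiableAt ℂ (deriv riemannZeta₁) z :=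
      (differentiable_riemannZeta₁.analyticAt z).deriv.differentiableAt
    exact (h1.div (differentiable_riemannZeta₁ z) (hbd z hz)).continuousAt.continuousWithinAt
  have hdP : DifferentiableOn ℂ (fun z => kernel ρ₀ U z * (-(1 / (z - 1))))
      (Icc a b ×ℂ Icc c d) := by
    intro z hz
    have h1 : DifferentiableAt ℂ (fun z : ℂ => -(1 / (z - 1))) z := by
      have := hz1 z hz
      fun_prop (disch := exact this)
    exact ((hk z).mul h1).differentiableWithinAt
  have hrect : rectInt G a b c d = 2 * Real.pi * I * S₀ := by
    have e : G = fun z => kernel ρ₀ U z * logDeriv riemannZeta₁ z +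
        kernel ρ₀ U z * (-(1 / (z - 1))) := by
      ext z; rw [hG]; simp only [zetaLogDeriv]; ring
    rw [e, rectInt_add hab hcd hcontL (hdP.continuousOn.mono fun z hz => hz.1),
      rectInt_eq_zero hab hcd hdP, add_zero,
      rectInt_mul_logDeriv hab hcd isOpen_univ (subset_univ _) hk.differentiableOn
        differentiable_riemannZeta₁ (fun z => mem_zerosInRect) hbd]
    rfl
  have hGline : ∀ y : ℝ, LSeries (fun n => (ArithmeticFunction.vonMangoldt n : ℂ)) (b + y * I) *
      kernel ρ₀ U (b + y * I) = -G (b + y * I) := by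
    intro y
    rw [LSeries_vonMangoldt_eq_logDeriv (by simpa using hb1), hG]
    simp only [zetaLogDeriv]
    ring
  have hGint : Integrable fun y : ℝ => G (b + y * I) := by
    obtain ⟨C, -, hC⟩ := exists_norm_LSeries_vonMangoldt_le hb1
    refine ((integrable_kernel ρ₀ hU hb hb2).norm.const_mul C).mono' ?_
      (Eventually.of_forall fun y => ?_)
    · refine Continuous.aestronglyMeasurable (continuous_iff_continuousAt.2 fun y => ?_)
      have hre : 1 < ((b : ℂ) + y * I).re := by simpa using hb1
      have hne : riemannZeta₁ (b + y * I) ≠ 0 := by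
        rw [Ne, riemannZeta₁_eq_zero_iff]
        exact riemannZeta_ne_zero_of_one_lt_re hre
      have hsub : ((b : ℂ) + y * I) - 1 ≠ 0 := by
        rw [sub_ne_zero]
        intro h
        rw [h] at hre
        simp at hre
      have h1 : DifferentiableAt ℂ (deriv riemannZeta₁) (b + y * I) :=
        (differentiable_riemannZeta₁.analyticAt _).deriv.differentiableAt
      have h2 : DifferentiableAt ℂ zetaLogDeriv (b + y * I) := by
        refine (h1.div (differentiable_riemannZeta₁ _) hne).sub ?_
        fun_prop (disch := exact hsub)
      have h3 : ContinuousAt G (b + y * I) := ((hk _).mul h2).continuousAt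
      exact ContinuousAt.comp (f := fun y : ℝ => (b : ℂ) + y * I) h3 (by fun_prop)
    · have h := hC y
      have h2 := congrArg norm (hGline y)
      rw [norm_mul, norm_neg] at h2
      rw [← h2]
      exact mul_le_mul_of_nonneg_right h (norm_nonneg _)
  have hD : detector U ρ₀ = -(1 / (2 * Real.pi)) * ∫ y : ℝ, G (b + y * I) := by
    rw [detector_eq_integral ρ₀ hU hb1 hb hb2]
    simp_rw [hGline]
    rw [integral_neg]
    ring
  have hsplit : ∫ y : ℝ, G (b + y * I) = (∫ y in c..d, G (b + y * I)) +
      ∫ y in (Ioc c d)ᶜ, G (b + y * I) := by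
    rw [intervalIntegral.integral_of_le hcd, integral_add_compl measurableSet_Ioc hGint]
  have hor : ∀ y, y = c ∨ y = d → ‖∫ x in a..b, G (x + y * I)‖ ≤ E₁ * (b - a) := by
    intro y hy
    have := intervalIntegral.norm_integral_le_of_norm_le_const (a := a) (b := b) (C := E₁)
      (f := fun x : ℝ => G (x + y * I)) (fun x hx => by
        rw [uIoc_of_le hab] at hx
        exact hhor x ⟨hx.1.le, hx.2⟩ y hy)
    rwa [abs_of_nonneg (by linarith)] at this
  have h1 := hor c (Or.inl rfl)
  have h2 := hor d (Or.inr rfl)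
  rw [← intervalIntegral.integral_of_le hcd] at hleft
  set A₁ := ∫ x in a..b, G (x + c * I)
  set A₂ := ∫ x in a..b, G (x + d * I)
  set A₃ := ∫ y in c..d, G (a + y * I)
  set A₄ := ∫ y in c..d, G (b + y * I)
  set A₅ := ∫ y in (Ioc c d)ᶜ, G (b + y * I)
  have hr : A₁ - A₂ + I * A₄ - I * A₃ = 2 * Real.pi * I * S₀ := hrect
  have hpi : (Real.pi : ℂ) ≠ 0 := by exact_mod_cast Real.pi_ne_zero
  have key : detector U ρ₀ + S₀ = (1 / (2 * Real.pi) : ℝ) * (-I * A₁ + I * A₂ - A₃ - A₅) := by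
    have hA4 : A₄ = 2 * Real.pi * S₀ + I * A₁ - I * A₂ + A₃ := by
      linear_combination (-I) * hr + (A₄ - A₃ - 2 * Real.pi * S₀) * I_sq
    rw [hD, hsplit, hA4]
    push_cast
    field_simp
    ring
  rw [key, norm_mul, Complex.norm_real, Real.norm_of_nonneg (by positivity)]
  have hpi1 : 1 / (2 * Real.pi) ≤ 1 := by
    rw [div_le_one (by positivity)]
    linarith [Real.pi_gt_three]
  refine (mul_le_of_le_one_left (norm_nonneg _) hpi1).trans ?_
  have e1 : ‖-I * A₁ + I * A₂ - A₃ - A₅‖ ≤ ‖A₁‖ + ‖A₂‖ + ‖A₃‖ + ‖A₅‖ := by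
    refine (norm_sub_le _ _).trans (add_le_add_left ((norm_sub_le _ _).trans (add_le_add_left
      ((norm_add_le _ _).trans ?_) _)) _)
    simp
  linarith

end ExplicitFormula

end HalfIsolated

namespace HalfIsolated

/-! ### Choosing the contour and estimating the error terms. -/

section Contour

open Complex Set MeasureTheory Filter Topology

/-- Keeps a window of half-height `g²` about the ordinate `exp g` well above the real axis. -/
lemma sq_add_le_exp {g : ℝ} (hg : 6 ≤ g) : g ^ 2 + 10 ≤ Real.exp g := by
  have h := Real.sum_le_exp_of_nonneg (x := g) (by linarith) 4
  norm_num [Finset.sum_range_succ, Nat.factorial] at h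
  nlinarith [sq_nonneg (g - 6)]

lemma re_lt_one_of_zero {ρ : ℂ} (h : riemannZeta₁ ρ = 0) : ρ.re < 1 := by
  by_contra! h1
  exact riemannZeta_ne_zero_of_one_le_re h1 ((riemannZeta₁_eq_zero_iff ρ).1 h)

/-- There are `O(g³)` zeros in the window, so by pigeonhole each of the three sides can be placed at
distance of order at least `g ^ (-3)` from all of them. With the local bound `O(g)` over this
distance, `ζ'/ζ` is `O(g⁴)` there. -/
lemma exists_contour : ∃ C : ℝ, 1 ≤ C ∧ ∀ γ g : ℝ, 6 ≤ g → γ = Real.exp g →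
    ∃ a ∈ Icc (1 / 4 : ℝ) (3 / 8), ∃ c ∈ Icc (γ - g ^ 2 + 2) (γ - g ^ 2 + 3),
      ∃ d ∈ Icc (γ + g ^ 2 - 3) (γ + g ^ 2 - 2),
      (∀ z ∈ rectBoundary a (101 / 100) c d, riemannZeta₁ z ≠ 0) ∧
      (∀ z ∈ Icc a (101 / 100) ×ℂ Icc c d, (z.re = a ∨ z.im = c ∨ z.im = d) →
        ‖zetaLogDeriv z‖ ≤ C * g ^ 4) ∧
      ∑ ρ ∈ zerosInRect a (101 / 100) c d, (zeroMult ρ : ℝ) ≤ C * g ^ 3 := by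
  obtain ⟨C₁, hC₁, h₁⟩ := exists_sum_zeroMult_rect_le
  obtain ⟨C₂, hC₂, h₂⟩ := exists_norm_logDeriv_le
  have hCC : 1 ≤ C₁ * C₂ := one_le_mul_of_one_le_of_one_le hC₁ hC₂
  refine ⟨161 * (C₁ * C₂), by linarith, fun γ g hg hγ => ?_⟩
  have hγg : g ^ 2 + 10 ≤ γ := hγ ▸ sq_add_le_exp hg
  have hγ0 : 0 < γ := by nlinarith
  have hlog : ∀ x, 0 < x → x ≤ 7 + γ + g ^ 2 → Real.log x ≤ 2 * g := by
    intro x hx hx2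
    rw [Real.log_le_iff_le_exp hx, two_mul, Real.exp_add, ← hγ]
    nlinarith
  set S := zerosInRect (1 / 10) 1 (γ - g ^ 2) (γ + g ^ 2) with hS
  have hsum : ∑ ρ ∈ S, (zeroMult ρ : ℝ) ≤ 2 * C₁ * g ^ 3 := by
    refine (h₁ γ (g ^ 2) (by nlinarith)).trans ?_
    rw [abs_of_pos hγ0]
    have h := hlog (7 + γ + g ^ 2) (by positivity) le_rfl
    calc C₁ * (g ^ 2 * Real.log (7 + γ + g ^ 2)) ≤ C₁ * (g ^ 2 * (2 * g)) := by gcongr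
      _ = _ := by ring
  have hcard : (S.card : ℝ) ≤ 2 * C₁ * g ^ 3 := by
    refine le_trans ?_ hsum
    rw [Finset.card_eq_sum_ones]
    push_cast
    refine Finset.sum_le_sum fun ρ hρ => ?_
    exact_mod_cast one_le_zeroMult (mem_zerosInRect.1 hρ).1
  -- The separation that pigeonhole gives in an interval of length `1/8`, the shortest of the three.
  set δ : ℝ := 1 / (16 * (S.card + 1)) with hδ
  have hδ0 : 0 < δ := by positivity
  have hδ1 : δ ≤ 1 := by
    rw [hδ, div_le_one (by positivity)]
    have : (0 : ℝ) ≤ S.card := Nat.cast_nonneg _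
    linarith
  have hδi : 1 / δ ≤ 80 * C₁ * g ^ 3 := by
    rw [hδ, one_div_one_div]
    have : 1 ≤ C₁ * g ^ 3 := one_le_mul_of_one_le_of_one_le hC₁ (one_le_pow₀ (by linarith))
    linarith
  have hfar : ∀ (φ : ℂ → ℝ) (u v : ℝ), u + 1 / 8 ≤ v → ∃ x ∈ Icc u v, ∀ ρ ∈ S, δ ≤ |x - φ ρ| := by
    intro φ u v huv
    obtain ⟨x, hx, h⟩ := exists_mem_Icc_far (S.image φ) (show u < v by linarith)
    refine ⟨x, hx, fun ρ hρ => le_trans ?_ (h _ (Finset.mem_image_of_mem φ hρ))⟩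
    have h1 : ((S.image φ).card : ℝ) ≤ S.card := by exact_mod_cast Finset.card_image_le
    rw [hδ, div_le_div_iff₀ (by positivity) (by positivity)]
    have : (0 : ℝ) ≤ S.card := Nat.cast_nonneg _
    nlinarith
  obtain ⟨a, ha, hfa⟩ := hfar re (1 / 4) (3 / 8) (by norm_num)
  obtain ⟨c, hc, hfc⟩ := hfar im (γ - g ^ 2 + 2) (γ - g ^ 2 + 3) (by linarith)
  obtain ⟨d, hd, hfd⟩ := hfar im (γ + g ^ 2 - 3) (γ + g ^ 2 - 2) (by linarith)
  have hsep : ∀ z ∈ Icc a (101 / 100) ×ℂ Icc c d, (z.re = a ∨ z.im = c ∨ z.im = d) →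
      ∀ ρ, riemannZeta₁ ρ = 0 → 1 / 10 ≤ ρ.re → |ρ.im - z.im| ≤ 2 → δ ≤ ‖z - ρ‖ := by
    intro z hz hz2 ρ hρ hρ1 hρ2
    rw [mem_reProdIm] at hz
    have h2 := abs_le.1 hρ2
    have hρS : ρ ∈ S := by
      rw [hS, mem_zerosInRect, mem_reProdIm]
      exact ⟨hρ, ⟨hρ1, (re_lt_one_of_zero hρ).le⟩, by linarith [hz.2.1, hc.1, h2.1],
        by linarith [hz.2.2, hd.2, h2.2]⟩
    have hre := abs_re_le_norm (z - ρ)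
    have him := abs_im_le_norm (z - ρ)
    rw [sub_re] at hre
    rw [sub_im] at him
    rcases hz2 with h | h | h
    · exact (hfa ρ hρS).trans (h ▸ hre)
    · exact (hfc ρ hρS).trans (h ▸ him)
    · exact (hfd ρ hρS).trans (h ▸ him)
  refine ⟨a, ha, c, hc, d, hd, ?_, ?_, ?_⟩
  · intro z hz h0
    by_cases hzb : z.re = 101 / 100
    · have := re_lt_one_of_zero h0
      linarith
    · have h1 := hsep z hz.1 (by have := hz.2; tauto) z h0
        (by have := (mem_reProdIm.1 hz.1).1.1; linarith [ha.1]) (by simp)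
      simp only [sub_self, norm_zero] at h1
      linarith
  · intro z hz hz2
    have hz' := mem_reProdIm.1 hz
    have him1 : 1 ≤ z.im := by linarith [hz'.2.1, hc.1]
    have h := h₂ z δ (by linarith [hz'.1.1, ha.1]) (by linarith [hz'.1.2]) hδ0 hδ1
      (hsep z hz hz2)
    have h3 : Real.log (5 + |z.im|) ≤ 2 * g := by
      rw [abs_of_pos (by linarith)]
      exact hlog _ (by linarith) (by linarith [hz'.2.2, hd.2])
    have h4 : ‖1 / (z - 1)‖ ≤ 1 := by
      rw [norm_div, norm_one]
      have : 1 ≤ ‖z - 1‖ := by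
        have := abs_im_le_norm (z - 1)
        rw [sub_im, one_im, sub_zero] at this
        exact him1.trans ((le_abs_self _).trans this)
      rw [div_le_one (by linarith)]
      exact this
    have h5 : 1 ≤ g ^ 4 := one_le_pow₀ (by linarith)
    refine (norm_sub_le _ _).trans ?_
    calc ‖logDeriv riemannZeta₁ z‖ + ‖1 / (z - 1)‖
        ≤ C₂ * Real.log (5 + |z.im|) * (1 / δ) + 1 := by
          rw [mul_one_div]; exact add_le_add h h4
      _ ≤ C₂ * (2 * g) * (80 * C₁ * g ^ 3) + 1 := by gcongr
      _ = 160 * (C₁ * C₂) * g ^ 4 + 1 := by ring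
      _ ≤ _ := by nlinarith
  · refine (Finset.sum_le_sum_of_subset_of_nonneg (t := S) ?_ fun _ _ _ => Nat.cast_nonneg _).trans
      (hsum.trans ?_)
    · intro ρ hρ
      rw [mem_zerosInRect, mem_reProdIm] at hρ
      rw [hS, mem_zerosInRect, mem_reProdIm]
      exact ⟨hρ.1, ⟨by linarith [hρ.2.1.1, ha.1], (re_lt_one_of_zero hρ.1).le⟩,
        by linarith [hρ.2.2.1, hc.1], by linarith [hρ.2.2.2, hd.2]⟩
    · have : C₁ ≤ C₁ * C₂ := le_mul_of_one_le_right (by linarith) hC₂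
      gcongr
      linarith

set_option maxHeartbeats 800000 in
/-- Truncated explicit formula for the smoothed sum at a zero of `ζ`. -/
lemma explicit_formula : ∃ C : ℝ, 1 ≤ C ∧ ∀ (ρ₀ : ℂ) (g : ℝ), riemannZeta ρ₀ = 0 →
    49 / 100 ≤ ρ₀.re → 6 ≤ g → ρ₀.im = Real.exp g → ∃ Z : Finset ℂ, ρ₀ ∈ Z ∧
      (∀ ρ ∈ Z, riemannZeta ρ = 0 ∧ 0 < ρ.re ∧ ρ.re < 1 ∧ ‖ρ - ρ₀‖ ≤ g ^ 2) ∧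
      ∑ ρ ∈ Z, (zeroMult ρ : ℝ) ≤ C * g ^ 3 ∧
      ∀ U : ℝ, 1 ≤ U → ‖detector U ρ₀ + ∑ ρ ∈ Z, (zeroMult ρ : ℂ) * kernel ρ₀ U ρ‖ ≤
        C * g ^ 4 * (U ^ (101 / 100 - ρ₀.re) * Real.exp (-(49 / 50 * Real.sqrt (g ^ 2 - 3))) +
          U ^ (-(1 / 10) : ℝ)) := by
  obtain ⟨K, hK, hcont⟩ := exists_contour
  obtain ⟨C₃, hC₃, h₃⟩ := exists_norm_mul_mellinWeight_le
  obtain ⟨C₄, hC₄, h₄⟩ := exists_norm_LSeries_vonMangoldt_le (b := 101 / 100) (by norm_num)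
  set M : ℝ := 1 + 24 * 50 ^ 4 with hM
  have hM1 : 1 ≤ M := by norm_num [hM]
  have hP : 1 ≤ K * C₃ * C₄ * M := one_le_mul_of_one_le_of_one_le
    (one_le_mul_of_one_le_of_one_le (one_le_mul_of_one_le_of_one_le hK hC₃) hC₄) hM1
  have hKM : K ≤ K * C₃ * C₄ * M := by
    rw [mul_assoc, mul_assoc]
    exact le_mul_of_one_le_right (by linarith) (one_le_mul_of_one_le_of_one_le hC₃
      (one_le_mul_of_one_le_of_one_le hC₄ hM1))
  refine ⟨1002 * (K * C₃ * C₄ * M), by linarith, fun ρ₀ g hζ hβ hg hγ => ?_⟩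
  obtain ⟨a, ha, c, hc, d, hd, hbd, hF, hsum⟩ := hcont ρ₀.im g hg hγ
  have hγg : g ^ 2 + 10 ≤ ρ₀.im := hγ ▸ sq_add_le_exp hg
  have hz0 : riemannZeta₁ ρ₀ = 0 := (riemannZeta₁_eq_zero_iff _).2 hζ
  have hβ1 := re_lt_one_of_zero hz0
  have hgg : 36 ≤ g ^ 2 := by nlinarith
  set R := g ^ 2 - 3 with hR
  have hcd : c ≤ d := by linarith [hc.2, hd.1]
  have hab : a ≤ 101 / 100 := by linarith [ha.2]
  have hg4 : 1 ≤ g ^ 4 := one_le_pow₀ (by linarith)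
  refine ⟨zerosInRect a (101 / 100) c d, ?_, ?_, ?_, ?_⟩
  · rw [mem_zerosInRect, mem_reProdIm]
    exact ⟨hz0, ⟨by linarith [ha.2], by linarith⟩, by linarith [hc.2], by linarith [hd.1]⟩
  · intro ρ hρ
    rw [mem_zerosInRect, mem_reProdIm] at hρ
    have h1 := re_lt_one_of_zero hρ.1
    refine ⟨(riemannZeta₁_eq_zero_iff _).1 hρ.1, by linarith [hρ.2.1.1, ha.1], h1, ?_⟩
    refine (norm_le_abs_re_add_abs_im _).trans ?_
    have e1 : |(ρ - ρ₀).re| ≤ 1 := by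
      rw [sub_re, abs_le]; constructor <;> linarith [hρ.2.1.1, ha.1]
    have e2 : |(ρ - ρ₀).im| ≤ g ^ 2 - 2 := by
      rw [sub_im, abs_le]; constructor <;> linarith [hρ.2.2.1, hc.1, hρ.2.2.2, hd.2]
    linarith
  · refine hsum.trans ?_
    have : 0 ≤ g := by linarith
    gcongr
    linarith
  intro U hU
  have hU0 : 0 < U := by linarith
  set A := U ^ (101 / 100 - ρ₀.re) with hA
  set E := Real.exp (-(49 / 50 * Real.sqrt R)) with hE
  set B := U ^ (-(1 / 10) : ℝ) with hB
  have hA0 : 0 < A := by positivity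
  have hE0 : 0 < E := Real.exp_pos _
  have hB0 : 0 < B := by positivity
  have hexpR : ∀ y : ℝ, R ≤ |y| → Real.exp (-Real.sqrt |y|) ≤ E := by
    intro y hy
    refine Real.exp_le_exp.2 (neg_le_neg ?_)
    have := Real.sqrt_le_sqrt hy
    linarith [Real.sqrt_nonneg R]
  have hWre : ∀ x y : ℝ, ((x : ℂ) + y * I - ρ₀).re = x - ρ₀.re := by intro x y; simp
  have hWim : ∀ x y : ℝ, ((x : ℂ) + y * I - ρ₀).im = y - ρ₀.im := by intro x y; simp
  have hzre : ∀ x y : ℝ, ((x : ℂ) + y * I).re = x := by intro x y; simp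
  have hzim : ∀ x y : ℝ, ((x : ℂ) + y * I).im = y := by intro x y; simp
  -- On the horizontal sides and the tail the kernel has decayed to `exp (-(49/50) √R)`. On the left
  -- side the saving is `U ^ (-1/10)`, as `a ≤ 3/8` and `Re ρ₀ ≥ 49/100`. The factors `10` and `100`
  -- are inverse distances of the vertical lines from `ρ₀`.
  have hkey := norm_detector_add_le (ρ₀ := ρ₀) (U := U) (a := a) (b := 101 / 100) (c := c) (d := d)
    (E₁ := C₃ * E * A * (K * g ^ 4)) (E₂ := C₃ * 10 * B * (K * g ^ 4) * 25 * Real.pi)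
    (E₃ := C₃ * 100 * (M * E) * A * C₄ * Real.pi)
    hU0 hab (by linarith [hc.1]) hcd (by norm_num) (by linarith) (by linarith) hbd ?_ ?_ ?_
  · refine hkey.trans ?_
    have hpi := Real.pi_le_four
    have hpi0 := Real.pi_pos
    have q1 : C₃ * K ≤ K * C₃ * C₄ * M := by
      rw [mul_assoc, mul_comm C₃]
      exact le_mul_of_one_le_right (by positivity) (one_le_mul_of_one_le_of_one_le hC₄ hM1)
    have q2 : C₃ * M * C₄ ≤ K * C₃ * C₄ * M := by
      have : C₃ * M * C₄ ≤ K * (C₃ * M * C₄) := le_mul_of_one_le_left (by positivity) hK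
      linarith
    set Q := K * C₃ * C₄ * M
    have e1 : 2 * (C₃ * E * A * (K * g ^ 4) * (101 / 100 - a)) ≤ 2 * (Q * g ^ 4 * (A * E)) := by
      have h1 : C₃ * E * A * (K * g ^ 4) * (101 / 100 - a) ≤ C₃ * E * A * (K * g ^ 4) * 1 := by
        gcongr
        linarith [ha.1]
      have h2 : C₃ * K * (g ^ 4 * (A * E)) ≤ Q * (g ^ 4 * (A * E)) := by gcongr
      nlinarith
    have e2 : C₃ * 10 * B * (K * g ^ 4) * 25 * Real.pi ≤ 1000 * (Q * g ^ 4 * B) := by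
      have h1 : C₃ * K * (250 * (g ^ 4 * B)) * Real.pi ≤ Q * (250 * (g ^ 4 * B)) * 4 := by gcongr
      nlinarith
    have e3 : C₃ * 100 * (M * E) * A * C₄ * Real.pi ≤ 400 * (Q * g ^ 4 * (A * E)) := by
      have h1 : C₃ * M * C₄ * (100 * (1 * (A * E))) * Real.pi ≤
        Q * (100 * (g ^ 4 * (A * E))) * 4 := by gcongr
      nlinarith
    have h5 : 0 ≤ Q * g ^ 4 * (A * E) := by positivity
    have h6 : 0 ≤ Q * g ^ 4 * B := by positivity
    nlinarith
  · intro x hx y hy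
    have hyR : R ≤ |y - ρ₀.im| := by
      rcases hy with rfl | rfl
      · rw [abs_of_nonpos] <;> linarith [hc.2]
      · rw [abs_of_nonneg] <;> linarith [hd.1]
    have hs : 1 ≤ ‖(x : ℂ) + y * I - ρ₀‖ := by
      refine le_trans ?_ (abs_im_le_norm _)
      rw [hWim]; linarith
    have hW := norm_mellinWeight_vertical_le h₃ (s := (x : ℂ) + y * I - ρ₀)
      (by rw [hWre, abs_le]; constructor <;> linarith [hx.1, hx.2, ha.1]) one_pos hs
    rw [hWim, div_one] at hW
    have hFz := hF ((x : ℂ) + y * I) (by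
      rw [mem_reProdIm, hzre, hzim]
      exact ⟨hx, by rcases hy with rfl | rfl; exacts [⟨le_rfl, hcd⟩, ⟨hcd, le_rfl⟩]⟩)
      (by rw [hzre, hzim]; tauto)
    rw [norm_mul, norm_kernel _ hU0, hzre]
    gcongr
    · exact hW.trans (by gcongr; exact hexpR _ hyR)
    · exact Real.rpow_le_rpow_of_exponent_le hU (by linarith [hx.2])
  · refine norm_setIntegral_le_pi measurableSet_Ioc (γ := ρ₀.im) (by positivity) fun y hy => ?_
    have hs : 1 / 10 ≤ ‖(a : ℂ) + y * I - ρ₀‖ := by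
      refine le_trans ?_ (abs_re_le_norm _)
      rw [hWre, abs_of_nonpos] <;> linarith [ha.2]
    have hW := norm_mellinWeight_vertical_le h₃ (s := (a : ℂ) + y * I - ρ₀)
      (by rw [hWre, abs_le]; constructor <;> linarith [ha.1, ha.2]) (by norm_num) hs
    rw [hWim] at hW
    have hFz := hF ((a : ℂ) + y * I) (by
      rw [mem_reProdIm, hzre, hzim]
      exact ⟨⟨le_rfl, hab⟩, hy.1.le, hy.2⟩) (by rw [hzre]; tauto)
    rw [norm_mul, norm_kernel _ hU0, hzre]
    have hexp := exp_neg_sqrt_le (y - ρ₀.im)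
    have hpos : 0 < (1 + (y - ρ₀.im) ^ 2)⁻¹ := by positivity
    calc ‖mellinWeight (a + y * I - ρ₀)‖ * U ^ (a - ρ₀.re) * ‖zetaLogDeriv (a + y * I)‖
        ≤ (C₃ / (1 / 10) * (25 * (1 + (y - ρ₀.im) ^ 2)⁻¹)) * B * (K * g ^ 4) := by
          gcongr
          · exact hW.trans (by gcongr)
          · exact Real.rpow_le_rpow_of_exponent_le hU (by linarith [ha.2])
      _ = _ := by ring
  · refine norm_setIntegral_le_pi measurableSet_Ioc.compl (γ := ρ₀.im) (by positivity)
      fun y hy => ?_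
    have hyR : R ≤ |y - ρ₀.im| := by
      rw [mem_compl_iff, mem_Ioc, not_and_or, not_lt, not_le] at hy
      rcases hy with hy | hy
      · rw [abs_of_nonpos] <;> linarith [hc.2]
      · rw [abs_of_nonneg] <;> linarith [hd.1]
    have hcast : (((101 / 100 : ℝ) : ℂ)) = 101 / 100 := by push_cast; ring
    have hs : 1 / 100 ≤ ‖((101 / 100 : ℝ) : ℂ) + y * I - ρ₀‖ := by
      refine le_trans ?_ (abs_re_le_norm _)
      rw [hWre, abs_of_nonneg] <;> linarith
    have hW := norm_mellinWeight_vertical_le h₃ (s := ((101 / 100 : ℝ) : ℂ) + y * I - ρ₀)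
      (by rw [hWre, abs_le]; constructor <;> linarith) (by norm_num) hs
    rw [hWim] at hW
    have hFz : ‖zetaLogDeriv (((101 / 100 : ℝ) : ℂ) + y * I)‖ ≤ C₄ := by
      refine le_trans (le_of_eq ?_) (h₄ y)
      rw [LSeries_vonMangoldt_eq_logDeriv (by rw [hzre]; norm_num), zetaLogDeriv, norm_sub_rev]
    rw [norm_mul, norm_kernel _ hU0, hzre]
    have hexp := exp_neg_sqrt_le_of_le hyR
    have hpos : 0 < (1 + (y - ρ₀.im) ^ 2)⁻¹ := by positivity
    calc ‖mellinWeight (((101 / 100 : ℝ) : ℂ) + y * I - ρ₀)‖ * U ^ (101 / 100 - ρ₀.re) *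
          ‖zetaLogDeriv (((101 / 100 : ℝ) : ℂ) + y * I)‖
        ≤ (C₃ / (1 / 100) * (M * E * (1 + (y - ρ₀.im) ^ 2)⁻¹)) * A * C₄ := by
          gcongr
          exact hW.trans (by gcongr)
      _ = _ := by ring

end Contour

end HalfIsolated

namespace HalfIsolated

/-! ### Non-cancellation on the imaginary axis, rounding to a grid, and reflection of zeros. -/

section LowerBound

open Complex Set Filter Topology

/-- On the positive imaginary axis the exponential sum cannot cancel. -/
lemma exists_norm_sum_imag_ge : ∃ c r : ℝ, 0 < c ∧ c ≤ 1 ∧ 0 < r ∧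
    ∀ {ι : Type} (Z : Finset ι) (m : ι → ℕ) (s : ι → ℂ) (i₀ : ι) (L : ℝ), 0 < L → 1 / r ≤ L →
      i₀ ∈ Z → 1 ≤ m i₀ → s i₀ = 0 → (∀ i ∈ Z, 0 ≤ (s i).im ∧ |(s i).re| ≤ 1 / (10 * L) ∧
        |(s i).re| ≤ 2) → 12 * (∑ i ∈ Z, (m i : ℝ)) * Real.exp (-(L * r / 2)) ≤ c →
      c ≤ ‖∑ i ∈ Z, m i * mellinWeight (s i) * exp (s i * L * (13 / 10 * I))‖ := by
  obtain ⟨w, hw, hw0⟩ := exists_mellinWeight_zero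
  have hcont : ContinuousAt mellinWeight 0 := differentiable_mellinWeight.continuous.continuousAt
  obtain ⟨r, hr, hball⟩ := Metric.continuousAt_iff.1 hcont (w / 4) (by linarith)
  simp only [dist_eq_norm, sub_zero, hw0] at hball
  refine ⟨min 1 (w / 2), r, lt_min one_pos (by linarith), min_le_left _ _, hr, ?_⟩
  intro ι Z m s i₀ L hL hLr hi₀ hm hs₀ hs hsum
  have hcw : 12 * (∑ i ∈ Z, (m i : ℝ)) * Real.exp (-(L * r / 2)) ≤ w / 2 :=
    hsum.trans (min_le_right _ _)
  refine (min_le_right _ _).trans ?_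
  have hrL : 1 / (10 * L) ≤ r / 10 := by
    rw [div_le_iff₀ hr] at hLr
    rw [div_le_div_iff₀ (by positivity) (by norm_num)]
    linarith
  set t : ι → ℂ := fun i => m i * mellinWeight (s i) * exp (s i * L * (13 / 10 * I)) with ht
  have hexp : ∀ i, s i * L * (13 / 10 * I) =
      ((-(13 / 10 * L * (s i).im) : ℝ) : ℂ) + ((13 / 10 * L * (s i).re : ℝ) : ℂ) * I := by
    intro i
    conv_lhs => rw [← re_add_im (s i)]
    push_cast
    linear_combination (13 / 10 * L * ((s i).im : ℂ)) * I_sq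
  have hterm : ∀ i ∈ Z, -(12 * (m i : ℝ) * Real.exp (-(L * r / 2))) ≤ (t i).re := by
    intro i hi
    obtain ⟨h1, h2, h3⟩ := hs i hi
    by_cases hnear : ‖s i‖ < r
    -- A close zero has phase at most `0.13`, so cosine at least `1/2`, and `W` within `w / 4` of `w
    -- = W(0)`. Its term has real part of size at least `w / 2 - w / 4 > 0` up to a positive factor.
    · refine le_trans (neg_nonpos.2 (by positivity)) ?_
      have hb := hball hnear
      set φ := 13 / 10 * L * (s i).re with hφ
      have hφ1 : |φ| ≤ 1 / 5 := by
        rw [hφ, abs_mul, abs_of_pos (by positivity)]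
        calc 13 / 10 * L * |(s i).re| ≤ 13 / 10 * L * (1 / (10 * L)) := by gcongr
          _ = 13 / 100 := by field_simp; norm_num
          _ ≤ _ := by norm_num
      have hcos : 1 / 2 ≤ Real.cos φ := by
        have := Real.one_sub_sq_div_two_le_cos (x := φ)
        have h5 : φ ^ 2 ≤ (1 / 5) ^ 2 := sq_le_sq' (by linarith [(abs_le.1 hφ1).1])
          (abs_le.1 hφ1).2
        linarith
      have hti : t i = ((m i * Real.exp (-(13 / 10 * L * (s i).im)) : ℝ) : ℂ) *
          (mellinWeight (s i) * exp (φ * I)) := by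
        simp only [ht]
        rw [hexp, ← hφ, exp_add]
        push_cast
        ring
      rw [hti, re_ofReal_mul]
      refine mul_nonneg (by positivity) ?_
      have hd : mellinWeight (s i) * exp (φ * I) =
          w * exp (φ * I) + (mellinWeight (s i) - w) * exp (φ * I) := by ring
      have hn : ‖(mellinWeight (s i) - w) * exp (φ * I)‖ ≤ w / 4 := by
        rw [norm_mul, norm_exp_ofReal_mul_I, mul_one]
        exact hb.le
      have hre := (abs_le.1 ((abs_re_le_norm _).trans hn)).1
      rw [hd, add_re, re_ofReal_mul, exp_ofReal_mul_I_re]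
      nlinarith
    -- Since `|Re s|` is at most `r / 10`, a point with `‖s‖ ≥ r` must be high up, so its term is
    -- damped by `exp (-L r / 2)`.
    · have him : r / 2 ≤ (s i).im := by
        have := norm_le_abs_re_add_abs_im (s i)
        rw [abs_of_nonneg h1] at this
        linarith [not_lt.1 hnear]
      have hn : ‖t i‖ ≤ 12 * (m i : ℝ) * Real.exp (-(L * r / 2)) := by
        simp only [ht]
        rw [norm_mul, norm_mul, Complex.norm_natCast, norm_exp, hexp]
        have hW := norm_mellinWeight_le h3
        have hE : Real.exp (((-(13 / 10 * L * (s i).im) : ℝ) : ℂ) +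
            ((13 / 10 * L * (s i).re : ℝ) : ℂ) * I).re ≤ Real.exp (-(L * r / 2)) := by
          rw [Real.exp_le_exp, add_re, ofReal_re, re_ofReal_mul, I_re, mul_zero, add_zero]
          nlinarith
        calc (m i : ℝ) * ‖mellinWeight (s i)‖ * _ ≤ m i * 12 * Real.exp (-(L * r / 2)) := by gcongr
          _ = _ := by ring
      exact (abs_le.1 ((abs_re_le_norm _).trans hn)).1
  have ht₀ : w ≤ (t i₀).re := by
    have : t i₀ = ((m i₀ * w : ℝ) : ℂ) := by simp [ht, hs₀, hw0]
    rw [this, ofReal_re]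
    have : (1 : ℝ) ≤ m i₀ := by exact_mod_cast hm
    nlinarith
  classical
  have hre : w / 2 ≤ (∑ i ∈ Z, t i).re := by
    rw [re_sum, ← Finset.add_sum_erase _ _ hi₀]
    have h1 : -(∑ i ∈ Z, 12 * (m i : ℝ) * Real.exp (-(L * r / 2))) ≤
        ∑ i ∈ Z.erase i₀, (t i).re := by
      rw [← Finset.sum_neg_distrib, ← Finset.add_sum_erase _ _ hi₀]
      have h0 : -(12 * (m i₀ : ℝ) * Real.exp (-(L * r / 2))) ≤ 0 := neg_nonpos.2 (by positivity)
      have := Finset.sum_le_sum (s := Z.erase i₀) fun i hi => hterm i (Finset.mem_of_mem_erase hi)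
      linarith
    rw [← Finset.sum_mul, ← Finset.mul_sum] at h1
    linarith
  exact hre.trans ((le_abs_self _).trans (abs_re_le_norm _))

/-- For real `u` in `[0, 2L]` the real part of `s u` is at most `1/5`, so each exponential stays
below `3` and its derivative below `3 ‖s‖`. The factor `‖s‖` is harmless later because `‖s‖ ‖W(s)‖`
is bounded. -/
lemma norm_sum_exp_sub_le {ι : Type} (Z : Finset ι) (a s : ι → ℂ) {L x y B : ℝ} (hL : 0 < L)
    (hx : x ∈ Icc 0 (2 * L)) (hy : y ∈ Icc 0 (2 * L)) (hs : ∀ i ∈ Z, |(s i).re| ≤ 1 / (10 * L))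
    (hB : ∑ i ∈ Z, ‖a i‖ * ‖s i‖ ≤ B) :
    ‖∑ i ∈ Z, a i * exp (s i * x) - ∑ i ∈ Z, a i * exp (s i * y)‖ ≤ 3 * B * |x - y| := by
  rw [← Finset.sum_sub_distrib]
  have hi : ∀ i ∈ Z, ‖a i * exp (s i * x) - a i * exp (s i * y)‖ ≤
      ‖a i‖ * ‖s i‖ * (3 * |x - y|) := by
    intro i hi
    rw [← mul_sub, norm_mul, mul_assoc]
    refine mul_le_mul_of_nonneg_left ?_ (norm_nonneg _)
    have h := (convex_Icc (0 : ℝ) (2 * L)).norm_image_sub_le_of_norm_hasDerivWithin_le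
      (f := fun u : ℝ => exp (s i * u)) (f' := fun u : ℝ => exp (s i * u) * (s i * 1))
      (C := ‖s i‖ * 3) (fun u _ => ?_) (fun u hu => ?_) hy hx
    · rw [Real.norm_eq_abs] at h
      linarith
    · exact ((ofRealCLM.hasDerivAt.const_mul (s i)).cexp).hasDerivWithinAt
    · rw [norm_mul, mul_one, mul_comm, norm_exp]
      refine mul_le_mul_of_nonneg_left ?_ (norm_nonneg _)
      refine le_trans (Real.exp_le_exp.2 ?_) Real.exp_one_lt_three.le
      rw [re_mul_ofReal]
      calc (s i).re * u ≤ |(s i).re| * u := mul_le_mul_of_nonneg_right (le_abs_self _) hu.1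
        _ ≤ 1 / (10 * L) * (2 * L) := mul_le_mul (hs i hi) hu.2 hu.1 (by positivity)
        _ = 1 / 5 := by field_simp; norm_num
        _ ≤ 1 := by norm_num
  refine (norm_sum_le_of_le _ hi).trans ?_
  rw [← Finset.sum_mul]
  calc (∑ i ∈ Z, ‖a i‖ * ‖s i‖) * (3 * |x - y|) ≤ B * (3 * |x - y|) := by gcongr
    _ = _ := by ring

/-- Round down, except within `η` of the left endpoint, where rounding up stays inside the interval.
-/
lemma exists_int_mul_near {L t η : ℝ} (hη : 0 < η) (hL : η ≤ L / 4)
    (ht : t ∈ Icc L (8 / 5 * L)) : ∃ j : ℤ, (j * η) ∈ Icc L (8 / 5 * L) ∧ |j * η - t| ≤ η := by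
  by_cases h : L + η ≤ t
  · refine ⟨⌊t / η⌋, ?_⟩
    have h1 := Int.floor_le (t / η)
    have h2 := Int.lt_floor_add_one (t / η)
    rw [le_div_iff₀ hη] at h1
    rw [div_lt_iff₀ hη] at h2
    have h3 : (⌊t / η⌋ + 1) * η = ⌊t / η⌋ * η + η := by ring
    refine ⟨⟨by linarith, by linarith [ht.2]⟩, ?_⟩
    rw [abs_le]; constructor <;> linarith
  · refine ⟨⌈t / η⌉, ?_⟩
    have h1 := Int.le_ceil (t / η)
    have h2 := Int.ceil_lt_add_one (t / η)
    rw [div_le_iff₀ hη] at h1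
    have h3 : (⌈t / η⌉ : ℝ) * η < (t / η + 1) * η := mul_lt_mul_of_pos_right h2 hη
    have h4 : (t / η + 1) * η = t + η := by field_simp
    push Not at h
    refine ⟨⟨by linarith [ht.1], by linarith [ht.2]⟩, ?_⟩
    rw [abs_le]; constructor <;> linarith

lemma re_pos_of_zero {ρ : ℂ} (h : riemannZeta ρ = 0) (him : ρ.im ≠ 0) : 0 < ρ.re := by
  by_contra! h0
  have h1 : ∀ n : ℕ, ρ ≠ -n := fun n hn => him (by rw [hn]; simp)
  have h2 : ρ ≠ 1 := fun hn => him (by rw [hn]; simp)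
  have h3 := riemannZeta_one_sub h1 h2
  rw [h, mul_zero] at h3
  exact riemannZeta_ne_zero_of_one_le_re (by rw [sub_re, one_re]; linarith) h3

lemma riemannZeta_one_sub_conj_eq_zero {ρ : ℂ} (h : riemannZeta ρ = 0) (him : ρ.im ≠ 0) :
    riemannZeta (1 - (starRingEnd ℂ) ρ) = 0 := by
  have h1 : ∀ n : ℕ, (starRingEnd ℂ) ρ ≠ -n := fun n hn => him (by
    have := congrArg im hn
    simpa using this)
  have h2 : (starRingEnd ℂ) ρ ≠ 1 := fun hn => him (by
    have := congrArg im hn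
    simpa using this)
  rw [riemannZeta_one_sub h1 h2, riemannZeta_conj, h]
  simp

/-- The reflection `1 - conj ρ₀` is a zero at the same height and at distance less than one, so the
isolation condition applies to it. The first alternative gives `|1 - 2β₀| ≤ 1/50`, the second `β₀ ≥
1/2`. -/
lemma re_ge_of_isYHalfIsolated {Y : ℝ} {ρ₀ : ℂ} (h : IsYHalfIsolated Y ρ₀)
    (hY : 5 ≤ Real.log Y) (him : ρ₀.im ≠ 0) (hg : 1 ≤ Real.log |ρ₀.im|) : 49 / 100 ≤ ρ₀.re := by
  have h0 := re_pos_of_zero h.1 him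
  have h1 := re_lt_one_of_zero ((riemannZeta₁_eq_zero_iff _).2 h.1)
  have hd : 1 - (starRingEnd ℂ) ρ₀ - ρ₀ = ((1 - 2 * ρ₀.re : ℝ) : ℂ) := by
    apply Complex.ext <;> simp
    ring
  have hre : (1 - (starRingEnd ℂ) ρ₀).re = 1 - ρ₀.re := by simp
  rcases h.2 _ (riemannZeta_one_sub_conj_eq_zero h.1 him) (by
    rw [hd, norm_real, Real.norm_eq_abs]
    refine le_trans ?_ (one_le_pow₀ hg)
    rw [abs_le]; constructor <;> linarith) with h2 | h2
  · have h3 : 1 / (10 * Real.log Y) ≤ 1 / 50 := by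
      apply one_div_le_one_div_of_le <;> linarith
    have h4 := (abs_le.1 (h2.1.trans h3)).2
    rw [hre] at h4
    linarith
  · rw [hre] at h2
    have : 0 ≤ Real.log (Real.log |ρ₀.im|) ^ 2 / Real.log Y := by positivity
    linarith

end LowerBound

end HalfIsolated

namespace HalfIsolated

/-! ### A large value of the sum over nearby zeros at a grid point. -/

section Detection

open Complex Set

lemma exp_neg_le_inv_pow {l v : ℝ} (hl : 0 < l) (hv : 200 * Real.log l ≤ v) :
    Real.exp (-v) ≤ 1 / l ^ 200 := by
  rw [Real.exp_neg, ← one_div]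
  refine one_div_le_one_div_of_le (by positivity) ?_
  rw [← Real.exp_log (show 0 < l ^ 200 by positivity), Real.log_pow]
  exact Real.exp_le_exp.2 (by exact_mod_cast hv)

lemma kernel_exp (ρ₀ ρ : ℂ) (y : ℝ) :
    kernel ρ₀ (Real.exp y) ρ = mellinWeight (ρ - ρ₀) * exp ((ρ - ρ₀) * y) := by
  rw [kernel, cpow_def_of_ne_zero (by exact_mod_cast (Real.exp_pos y).ne'), ← ofReal_log
    (Real.exp_pos y).le, Real.log_exp, mul_comm (y : ℂ)]

/-- The zeros close to `ρ₀` produce a large value of the sum over zeros at a grid point. -/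
lemma exists_grid_sum_ge : ∃ c r K : ℝ, 0 < c ∧ 0 < r ∧ 1 ≤ K ∧ ∀ (Z : Finset ℂ) (ρ₀ : ℂ)
    (L S η : ℝ), 1 ≤ L → 1 / r ≤ L → 1 ≤ S → 12 * S * Real.exp (-(L * r / 2)) ≤ c →
    riemannZeta₁ ρ₀ = 0 → ρ₀ ∈ Z →
    (∀ ρ ∈ Z, ρ₀.im ≤ ρ.im ∧ |ρ.re - ρ₀.re| ≤ 1 / (10 * L)) →
    ∑ ρ ∈ Z, (zeroMult ρ : ℝ) ≤ S → 0 < η → η ≤ L / 4 →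
    ∃ j : ℤ, j * η ∈ Icc L (8 / 5 * L) ∧ c / S ^ 20 - K * S * η ≤
      ‖∑ ρ ∈ Z, (zeroMult ρ : ℂ) * kernel ρ₀ (Real.exp (j * η)) ρ‖ := by
  obtain ⟨C, hC, hWC⟩ := exists_norm_mul_mellinWeight_le
  obtain ⟨c, r, hc, hc1, hr, hlow⟩ := exists_norm_sum_imag_ge
  have hconst : 1 ≤ 2 * Real.exp 5 * 12 := by
    have := Real.one_le_exp (x := 5) (by norm_num)
    linarith
  have hcc : c / 2 * (c / (2 * Real.exp 5 * 12)) ^ 20 ≤ c := by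
    have h1 : (c / (2 * Real.exp 5 * 12)) ^ 20 ≤ 1 := by
      refine pow_le_one₀ (by positivity) ?_
      rw [div_le_one (by positivity)]
      linarith
    nlinarith
  refine ⟨c / 2 * (c / (2 * Real.exp 5 * 12)) ^ 20, r, 3 * C, by positivity, hr, by linarith, ?_⟩
  intro Z ρ₀ L S η hL hLr hS hSc hζ hρ₀ hZ hsum hη hηL
  have hL0 : 0 < L := by linarith
  have hre2 : ∀ ρ ∈ Z, |(ρ - ρ₀).re| ≤ 2 := by
    intro ρ hρ
    rw [sub_re]
    refine (hZ ρ hρ).2.trans ?_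
    rw [div_le_iff₀ (by positivity)]
    linarith
  have h1 := hlow Z zeroMult (fun ρ => ρ - ρ₀) ρ₀ L hL0 hLr hρ₀ (one_le_zeroMult hζ) (sub_self _)
    (fun ρ hρ => ⟨by rw [sub_im]; linarith [(hZ ρ hρ).1], by rw [sub_re]; exact (hZ ρ hρ).2,
      hre2 ρ hρ⟩) (le_trans (by gcongr) (hSc.trans hcc))
  have hmW : ∑ ρ ∈ Z, ‖(zeroMult ρ : ℂ) * mellinWeight (ρ - ρ₀)‖ ≤ 12 * S := by
    calc ∑ ρ ∈ Z, ‖(zeroMult ρ : ℂ) * mellinWeight (ρ - ρ₀)‖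
        ≤ ∑ ρ ∈ Z, 12 * (zeroMult ρ : ℝ) := by
          refine Finset.sum_le_sum fun ρ hρ => ?_
          rw [norm_mul, Complex.norm_natCast, mul_comm]
          gcongr
          exact norm_mellinWeight_le (hre2 ρ hρ)
      _ ≤ _ := by rw [← Finset.mul_sum]; gcongr
  -- Scaling the exponents by `L` brings the real parts down to `1/10`, and the total mass is at
  -- most `12 S`; the loss `S ^ 20` comes from the barrier gap `1/20`.
  obtain ⟨x, hx, hxge⟩ := exists_norm_sum_exp_ge Z (fun ρ => zeroMult ρ * mellinWeight (ρ - ρ₀))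
    (fun ρ => (ρ - ρ₀) * L) (M := 12 * S) (c₀ := c) (fun ρ hρ => ⟨by
      rw [im_mul_ofReal, sub_im]
      exact mul_nonneg (by linarith [(hZ ρ hρ).1]) hL0.le, by
      rw [re_mul_ofReal, sub_re, abs_mul, abs_of_pos hL0]
      calc |ρ.re - ρ₀.re| * L ≤ 1 / (10 * L) * L := by gcongr; exact (hZ ρ hρ).2
        _ = _ := by field_simp⟩) hmW (by linarith) hc hc1 h1
  have htI : L * x ∈ Icc L (8 / 5 * L) := ⟨by nlinarith [hx.1], by nlinarith [hx.2]⟩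
  obtain ⟨j, hj, hjt⟩ := exists_int_mul_near hη hηL htI
  refine ⟨j, hj, ?_⟩
  have hLip := norm_sum_exp_sub_le Z (fun ρ => zeroMult ρ * mellinWeight (ρ - ρ₀))
    (fun ρ => ρ - ρ₀) (L := L) (x := L * x) (y := j * η) (B := C * S) hL0
    ⟨by linarith [htI.1], by linarith [htI.2]⟩ ⟨by linarith [hj.1], by linarith [hj.2]⟩
    (fun ρ hρ => by rw [sub_re]; exact (hZ ρ hρ).2) (by
      calc ∑ ρ ∈ Z, ‖(zeroMult ρ : ℂ) * mellinWeight (ρ - ρ₀)‖ * ‖ρ - ρ₀‖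
          ≤ ∑ ρ ∈ Z, C * (zeroMult ρ : ℝ) := by
            refine Finset.sum_le_sum fun ρ hρ => ?_
            have h3 := hWC _ (hre2 ρ hρ)
            have h4 : Real.exp (-Real.sqrt |(ρ - ρ₀).im|) ≤ 1 :=
              Real.exp_le_one_iff.2 (neg_nonpos.2 (Real.sqrt_nonneg _))
            have h5 : ‖ρ - ρ₀‖ * ‖mellinWeight (ρ - ρ₀)‖ ≤ C := h3.trans (by nlinarith)
            rw [norm_mul, Complex.norm_natCast]
            calc (zeroMult ρ : ℝ) * ‖mellinWeight (ρ - ρ₀)‖ * ‖ρ - ρ₀‖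
                = zeroMult ρ * (‖ρ - ρ₀‖ * ‖mellinWeight (ρ - ρ₀)‖) := by ring
              _ ≤ zeroMult ρ * C := by gcongr
              _ = _ := mul_comm _ _
        _ ≤ _ := by rw [← Finset.mul_sum]; gcongr)
  have e1 : ∑ ρ ∈ Z, (zeroMult ρ : ℂ) * mellinWeight (ρ - ρ₀) * exp ((ρ - ρ₀) * L * x) =
      ∑ ρ ∈ Z, (zeroMult ρ : ℂ) * mellinWeight (ρ - ρ₀) * exp ((ρ - ρ₀) * (L * x : ℝ)) := by
    refine Finset.sum_congr rfl fun ρ _ => ?_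
    push_cast
    rw [mul_assoc (ρ - ρ₀)]
  rw [e1] at hxge
  have e2 : ∑ ρ ∈ Z, (zeroMult ρ : ℂ) * kernel ρ₀ (Real.exp (j * η)) ρ =
      ∑ ρ ∈ Z, (zeroMult ρ : ℂ) * mellinWeight (ρ - ρ₀) * exp ((ρ - ρ₀) * (j * η : ℝ)) := by
    refine Finset.sum_congr rfl fun ρ _ => ?_
    rw [kernel_exp, mul_assoc]
  rw [e2]
  have e3 : c / 2 * (c / (2 * Real.exp 5 * (12 * S))) ^ 20 =
      c / 2 * (c / (2 * Real.exp 5 * 12)) ^ 20 / S ^ 20 := by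
    rw [← mul_assoc, ← div_div, div_pow, mul_div_assoc]
  rw [e3] at hxge
  have e4 : 3 * (C * S) * |L * x - j * η| ≤ 3 * C * S * η := by
    rw [abs_sub_comm, ← mul_assoc]
    gcongr
  have := norm_sub_norm_le
    (∑ ρ ∈ Z, (zeroMult ρ : ℂ) * mellinWeight (ρ - ρ₀) * exp ((ρ - ρ₀) * (L * x : ℝ)))
    (∑ ρ ∈ Z, (zeroMult ρ : ℂ) * mellinWeight (ρ - ρ₀) * exp ((ρ - ρ₀) * (j * η : ℝ)))
  linarith

end Detection

end HalfIsolated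

namespace HalfIsolated

/-! ### Counting the lengths and assembling the detection bound. -/

section Main

open Complex Set

/-- With `ε = (log T) ^ (-150)` one has `log (1 + ε) ≥ ε / 2`, so `U ≤ T²` forces `j ≤ 4 (log T) ^
151`; negative `j` are excluded since the lower endpoint is at least `1`. -/
lemma lengths_subset_image {T : ℝ} (hT : 5 ≤ Real.log T) :
    lengths T ⊆ (fun j : ℤ => (1 + 1 / Real.log T ^ 150) ^ j) ''
      (Finset.Icc 0 ⌊4 * Real.log T ^ 151⌋ : Finset ℤ) := by
  rintro U ⟨⟨hU1, hU2⟩, j, rfl⟩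
  set l := Real.log T with hl
  have hl0 : 0 < l := by linarith
  set ε := 1 / l ^ 150 with hε
  have hε0 : 0 < ε := by positivity
  have hε1 : ε ≤ 1 := by
    rw [hε, div_le_one (by positivity)]
    exact one_le_pow₀ (by linarith)
  have hlog : ε / 2 ≤ Real.log (1 + ε) := by
    refine le_trans ?_ (Real.le_log_one_add_of_nonneg hε0.le)
    rw [div_le_div_iff₀ (by norm_num) (by linarith)]
    nlinarith
  have hq : 0 < (1 + ε) ^ j := by positivity
  simp only at hU1 hU2
  have h1 : 0 ≤ j * Real.log (1 + ε) := by
    rw [← Real.log_zpow]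
    refine Real.log_nonneg (le_trans (Real.one_le_exp ?_) hU1)
    have := Real.log_nonneg (show 1 ≤ l by linarith)
    positivity
  have h2 : j * Real.log (1 + ε) ≤ 2 * l := by
    rw [← Real.log_zpow, hl]
    have := Real.log_le_log hq hU2
    rwa [Real.log_pow] at this
  have hj0 : (0 : ℝ) ≤ j := nonneg_of_mul_nonneg_left h1 (by linarith)
  refine ⟨j, ?_, rfl⟩
  rw [Finset.coe_Icc, mem_Icc, Int.le_floor]
  refine ⟨by exact_mod_cast hj0, ?_⟩
  have h3 : j * (ε / 2) ≤ 2 * l := (mul_le_mul_of_nonneg_left hlog hj0).trans h2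
  rw [hε, div_div, mul_one_div, div_le_iff₀ (by positivity)] at h3
  linarith

lemma lengths_finite_card {T : ℝ} (hT : 5 ≤ Real.log T) :
    (lengths T).Finite ∧ ((lengths T).ncard : ℝ) ≤ Real.log T ^ 152 := by
  have hsub := lengths_subset_image hT
  have hfin := ((Finset.Icc 0 ⌊4 * Real.log T ^ 151⌋ : Finset ℤ).finite_toSet.image
    fun j : ℤ => (1 + 1 / Real.log T ^ 150) ^ j)
  refine ⟨hfin.subset hsub, ?_⟩
  set l := Real.log T
  have hl1 : 1 ≤ l ^ 151 := one_le_pow₀ (by linarith)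
  have h1 : (lengths T).ncard ≤ (⌊4 * l ^ 151⌋ + 1).toNat := by
    refine (ncard_le_ncard hsub hfin).trans ((ncard_image_le (Finset.finite_toSet _)).trans ?_)
    rw [ncard_coe_finset, Int.card_Icc, sub_zero]
  have h2 : (0 : ℤ) ≤ ⌊4 * l ^ 151⌋ + 1 := by
    have : (0 : ℤ) ≤ ⌊4 * l ^ 151⌋ := Int.floor_nonneg.2 (by positivity)
    omega
  have h3 : (((⌊4 * l ^ 151⌋ + 1).toNat : ℕ) : ℝ) = (⌊4 * l ^ 151⌋ : ℝ) + 1 := by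
    have : (((⌊4 * l ^ 151⌋ + 1).toNat : ℤ) : ℝ) = ((⌊4 * l ^ 151⌋ + 1 : ℤ) : ℝ) := by
      rw [Int.toNat_of_nonneg h2]
    push_cast at this
    exact_mod_cast this
  have h4 : ((lengths T).ncard : ℝ) ≤ ((⌊4 * l ^ 151⌋ + 1).toNat : ℕ) := by exact_mod_cast h1
  rw [h3] at h4
  have h5 := Int.floor_le (4 * l ^ 151)
  have h6 : l ^ 152 = l ^ 151 * l := by ring
  rw [h6]
  nlinarith

/-- The bounds for the zeros far to the left and for the truncation errors. -/
lemma error_bounds {l g L y β : ℝ} (hl : 4000 ≤ Real.log l) (hl0 : 0 < l) (hlg : l ≤ g)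
    (hL : Real.log l ^ 3 ≤ L) (hLl : L ≤ l) (hy : y ∈ Icc L (8 / 5 * L)) (hβ : 49 / 100 ≤ β)
    (hβ1 : β < 1) :
    Real.exp y ^ (101 / 100 - β) * Real.exp (-(49 / 50 * Real.sqrt (g ^ 2 - 3))) ≤ 1 / l ^ 200 ∧
    Real.exp y ^ (-(1 / 10) : ℝ) ≤ 1 / l ^ 200 ∧
    Real.exp (-(Real.log g ^ 2)) ≤ 1 / l ^ 200 := by
  set x := Real.log l with hx
  have hlx : 2000 * x ≤ l := by
    have h := Real.quadratic_le_exp_of_nonneg (x := x) (by linarith)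
    rw [Real.exp_log hl0] at h
    nlinarith
  have hg0 : 0 < g := by linarith
  have hxg : x ≤ Real.log g := Real.log_le_log hl0 hlg
  refine ⟨?_, ?_, ?_⟩
  · have hsq : 99 / 100 * g ≤ Real.sqrt (g ^ 2 - 3) := by
      refine Real.le_sqrt_of_sq_le ?_
      nlinarith
    rw [← Real.exp_mul, ← Real.exp_add]
    refine le_trans (Real.exp_le_exp.2 (?_ : _ ≤ -(200 * x))) (exp_neg_le_inv_pow hl0 le_rfl)
    have hL0 : 0 ≤ L := le_trans (by positivity) hL
    -- The growth exponent `1.6 · 0.52 = 0.832` loses to the decay exponent `0.98 · 0.99 = 0.9702`.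
    -- The surplus times `g` exceeds `200 log l`, since `g ≥ l ≥ 2000 log l`.
    have : y * (101 / 100 - β) ≤ (8 / 5 * g) * (52 / 100) :=
      mul_le_mul (by linarith [hy.2]) (by linarith) (by linarith) (by positivity)
    linarith
  · rw [← Real.exp_mul, mul_neg]
    refine exp_neg_le_inv_pow hl0 ?_
    have h1 : x ^ 3 ≤ y := hL.trans hy.1
    have h2 : 2000 * x ≤ x ^ 3 := by
      have : x ^ 3 = x ^ 2 * x := by ring
      rw [this]
      have : 2000 ≤ x ^ 2 := by nlinarith
      gcongr
    linarith
  · refine exp_neg_le_inv_pow hl0 ?_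
    nlinarith

set_option maxHeartbeats 1000000 in
lemma exists_detector_ge : ∃ l₀ : ℝ, Real.exp 4000 ≤ l₀ ∧ ∀ T : ℝ, 0 < T → l₀ ≤ Real.log T →
    ∀ Y : ℝ, 1 < Y → Real.log (Real.log T) ^ 3 ≤ Real.log Y → Real.log Y ≤ Real.log T →
      ∀ ρ₀ : ℂ, IsYHalfIsolated Y ρ₀ → ρ₀.im ∈ Icc T (2 * T) →
        ∃ U ∈ lengths T ∩ Icc Y (Y ^ 2), 1 / Real.log T ^ 100 ≤ ‖detector U ρ₀‖ := by
  obtain ⟨C, hC, hEF⟩ := explicit_formula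
  obtain ⟨c, r, K, hc, hr, hK, hgrid⟩ := exists_grid_sum_ge
  -- The four summands are the target lower bound, the grid error, the zeros to the left and the
  -- truncation error, each in units of `l ^ (-100)`.
  set D : ℝ := 1 + 8 * C * K + 12 * (8 * C) + 32 * C with hD
  set κ : ℝ := c / (8 * C) ^ 20 with hκ
  have hκ0 : 0 < κ := by positivity
  -- The first summand makes `log l` large absolutely and against `1 / r`. The second makes the
  -- damped zeros fit under `c`, and the third lets one power of `l` absorb `D / κ`.
  refine ⟨Real.exp (4000 + 400 / r) + 96 * C / c + D / κ, ?_, ?_⟩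
  · have h1 : Real.exp 4000 ≤ Real.exp (4000 + 400 / r) :=
      Real.exp_le_exp.2 (le_add_of_nonneg_right (by positivity))
    have h2 : 0 ≤ 96 * C / c := by positivity
    have h3 : 0 ≤ D / κ := by positivity
    linarith
  intro T hT0 hT Y hY hYl hYu ρ₀ hiso him
  set l := Real.log T with hl
  set L := Real.log Y with hL
  set γ := ρ₀.im with hγ
  set g := Real.log γ with hg
  have hpos1 : 0 < 96 * C / c := by positivity
  have hpos2 : 0 < D / κ := by positivity
  have hlexp : Real.exp (4000 + 400 / r) ≤ l := by linarith
  have hl0 : 0 < l := (Real.exp_pos _).trans_le hlexp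
  have hx : 4000 + 400 / r ≤ Real.log l := (Real.le_log_iff_exp_le hl0).2 hlexp
  have hl1 : 96 * C / c ≤ l := by linarith [Real.exp_pos (4000 + 400 / r)]
  have hl2 : D / κ ≤ l := by linarith [Real.exp_pos (4000 + 400 / r)]
  set x := Real.log l with hxdef
  have hr4 : 0 < 400 / r := by positivity
  have hx4 : 4000 ≤ x := by linarith
  have hxr : 400 / r ≤ x := by linarith
  have hlx : x < l := by linarith [Real.log_le_sub_one_of_pos hl0]
  have hx3 : x ≤ x ^ 3 := le_self_pow₀ (by linarith) (by norm_num)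
  have hxL : x ≤ L := hx3.trans hYl
  have hL0 : 0 < L := by linarith
  have hγ0 : 0 < γ := hT0.trans_le him.1
  have hlg : l ≤ g := Real.log_le_log hT0 him.1
  have hgl : g ≤ 2 * l := by
    have h1 : g ≤ Real.log (2 * T) := Real.log_le_log hγ0 him.2
    rw [Real.log_mul (by norm_num) hT0.ne'] at h1
    have := Real.log_two_lt_d9
    linarith
  have hg0 : 0 < g := by linarith
  have habs : |γ| = γ := abs_of_pos hγ0
  have hβ : 49 / 100 ≤ ρ₀.re := re_ge_of_isYHalfIsolated hiso (by linarith) hγ0.ne'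
    (by rw [← hγ, habs]; linarith)
  have hζ₁ : riemannZeta₁ ρ₀ = 0 := (riemannZeta₁_eq_zero_iff _).2 hiso.1
  have hβ1 := re_lt_one_of_zero hζ₁
  obtain ⟨Z, hρ₀Z, hZ, hZm, hZU⟩ := hEF ρ₀ g hiso.1 hβ (by linarith) (Real.exp_log hγ0).symm
  set S := 8 * C * l ^ 3 with hS
  have hl31 : 1 ≤ l ^ 3 := one_le_pow₀ (by linarith)
  have hS1 : 1 ≤ S := by rw [hS]; nlinarith
  have hZS : ∑ ρ ∈ Z, (zeroMult ρ : ℝ) ≤ S := by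
    refine hZm.trans ?_
    calc C * g ^ 3 ≤ C * (2 * l) ^ 3 := by gcongr
      _ = S := by rw [hS]; ring
  classical
  -- `P` is alternative (1), giving the one-sided main sum. Every other zero in `Z` lies within the
  -- isolation radius and hence satisfies (2).
  set P : ℂ → Prop := fun ρ => |ρ.re - ρ₀.re| ≤ 1 / (10 * L) ∧ γ ≤ ρ.im with hP
  have hZ₁S : ∑ ρ ∈ Z.filter P, (zeroMult ρ : ℝ) ≤ S :=
    (Finset.sum_le_sum_of_subset_of_nonneg (Finset.filter_subset _ _)
      fun _ _ _ => Nat.cast_nonneg _).trans hZS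
  have hfar : ∀ ρ ∈ Z, ¬ P ρ → ρ.re ≤ ρ₀.re - Real.log g ^ 2 / L := by
    intro ρ hρ hnP
    have h := hiso.2 ρ (hZ ρ hρ).1 (by rw [← hγ, habs]; exact (hZ ρ hρ).2.2.2)
    rw [← hγ, habs] at h
    exact h.resolve_left hnP
  set ε : ℝ := 1 / l ^ 150 with hε
  have hε0 : 0 < ε := by positivity
  have hε1 : ε ≤ 1 := by
    rw [hε, div_le_one (by positivity)]
    exact one_le_pow₀ (by linarith)
  -- With this spacing, exponentials of grid points are exactly the integer powers that make up the
  -- set of lengths.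
  set η := Real.log (1 + ε) with hη
  have hη0 : 0 < η := Real.log_pos (by linarith)
  have hηε : η ≤ ε := by
    have := Real.log_le_sub_one_of_pos (show 0 < 1 + ε by linarith)
    linarith
  have hLr2 : 200 * x ≤ L * r / 2 := by
    have h1 : 400 ≤ x * r := by rwa [div_le_iff₀ hr] at hxr
    have h2 : x ^ 2 * (x * r) ≤ L * r := by
      have : x ^ 2 * (x * r) = x ^ 3 * r := by ring
      rw [this]
      gcongr
    nlinarith
  obtain ⟨j, hj, hjS⟩ := hgrid (Z.filter P) ρ₀ L S η (by linarith)
    (le_trans (by gcongr; norm_num) (hxr.trans hxL)) hS1 (by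
      have h1 := exp_neg_le_inv_pow hl0 hLr2
      calc 12 * S * Real.exp (-(L * r / 2)) ≤ 12 * S * (1 / l ^ 200) := by gcongr
        _ = 96 * C * (l ^ 3 / l ^ 200) := by rw [hS]; ring
        _ ≤ 96 * C * (1 / l) := by
          refine mul_le_mul_of_nonneg_left ?_ (by positivity)
          rw [div_le_div_iff₀ (by positivity) hl0, one_mul, ← pow_succ]
          exact pow_le_pow_right₀ (by linarith) (by norm_num)
        _ ≤ c := by
          rw [mul_one_div, div_le_iff₀ hl0]
          rw [div_le_iff₀ hc] at hl1
          linarith)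
    hζ₁ (Finset.mem_filter.2 ⟨hρ₀Z, by simp only [sub_self, abs_zero]; positivity, le_rfl⟩)
    (fun ρ hρ => ⟨(Finset.mem_filter.1 hρ).2.2, (Finset.mem_filter.1 hρ).2.1⟩) hZ₁S hη0
    (by linarith)
  set y : ℝ := j * η with hy
  set U := Real.exp y with hU
  have hUj : (1 + ε) ^ j = U := by
    rw [hU, hy, hη, ← Real.log_zpow, Real.exp_log (by positivity)]
  have hYL : Y = Real.exp L := (Real.exp_log (by linarith)).symm
  have hTl : T = Real.exp l := (Real.exp_log hT0).symm
  refine ⟨U, ⟨⟨⟨Real.exp_le_exp.2 (hYl.trans hj.1), ?_⟩, j, hUj⟩, ?_, ?_⟩, ?_⟩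
  · rw [hTl, ← Real.exp_nat_mul]
    refine Real.exp_le_exp.2 ?_
    push_cast
    linarith [hj.2]
  · rw [hYL]
    exact Real.exp_le_exp.2 hj.1
  · rw [hYL, ← Real.exp_nat_mul]
    refine Real.exp_le_exp.2 ?_
    push_cast
    linarith [hj.2]
  obtain ⟨hE1, hE2, hE3⟩ := error_bounds hx4 hl0 hlg hYl hYu hj hβ hβ1
  have hmain := hZU U (Real.one_le_exp (hL0.le.trans hj.1))
  rw [← Finset.sum_filter_add_sum_filter_not Z P] at hmain
  have hU0 : 0 < U := Real.exp_pos y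
  have hS₂ : ‖∑ ρ ∈ Z.filter fun ρ => ¬ P ρ, (zeroMult ρ : ℂ) * kernel ρ₀ U ρ‖ ≤
      12 * S * (1 / l ^ 200) := by
    refine (norm_sum_le _ _).trans ?_
    calc ∑ ρ ∈ Z.filter fun ρ => ¬ P ρ, ‖(zeroMult ρ : ℂ) * kernel ρ₀ U ρ‖
        ≤ ∑ ρ ∈ Z.filter fun ρ => ¬ P ρ, (zeroMult ρ : ℝ) * (12 * (1 / l ^ 200)) := by
          refine Finset.sum_le_sum fun ρ hρ => ?_
          obtain ⟨hρZ, hnP⟩ := Finset.mem_filter.1 hρ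
          have h1 := hfar ρ hρZ hnP
          have h2 := hZ ρ hρZ
          rw [norm_mul, Complex.norm_natCast, norm_kernel _ hU0]
          gcongr
          · refine norm_mellinWeight_le ?_
            rw [sub_re, abs_le]
            constructor <;> linarith [h2.2.1, h2.2.2.1]
          · refine le_trans ?_ hE3
            rw [hU, ← Real.exp_mul]
            refine Real.exp_le_exp.2 ?_
            have h3 : y * (ρ.re - ρ₀.re) ≤ y * (-(Real.log g ^ 2 / L)) :=
              mul_le_mul_of_nonneg_left (by linarith) (hL0.le.trans hj.1)
            have h4 : L * (Real.log g ^ 2 / L) ≤ y * (Real.log g ^ 2 / L) :=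
              mul_le_mul_of_nonneg_right hj.1 (by positivity)
            have h5 : L * (Real.log g ^ 2 / L) = Real.log g ^ 2 := by field_simp
            linarith
      _ ≤ S * (12 * (1 / l ^ 200)) := by
          rw [← Finset.sum_mul]
          gcongr
          exact (Finset.sum_le_sum_of_subset_of_nonneg (Finset.filter_subset _ _)
            fun _ _ _ => Nat.cast_nonneg _).trans hZS
      _ = _ := by ring
  have hpow : ∀ m n : ℕ, m + 100 ≤ n → l ^ m / l ^ n ≤ 1 / l ^ 100 := by
    intro m n hmn
    rw [div_le_div_iff₀ (by positivity) (by positivity), one_mul, ← pow_add]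
    exact pow_le_pow_right₀ (by linarith) hmn
  have b1 : K * S * η ≤ 8 * C * K * (1 / l ^ 100) := by
    calc K * S * η ≤ K * S * ε := by gcongr
      _ = 8 * C * K * (l ^ 3 / l ^ 150) := by rw [hS, hε]; ring
      _ ≤ _ := mul_le_mul_of_nonneg_left (hpow 3 150 (by norm_num)) (by positivity)
  have b2 : 12 * S * (1 / l ^ 200) ≤ 12 * (8 * C) * (1 / l ^ 100) := by
    calc 12 * S * (1 / l ^ 200) = 12 * (8 * C) * (l ^ 3 / l ^ 200) := by rw [hS]; ring
      _ ≤ _ := mul_le_mul_of_nonneg_left (hpow 3 200 (by norm_num)) (by positivity)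
  have b3 : C * g ^ 4 * (U ^ (101 / 100 - ρ₀.re) *
      Real.exp (-(49 / 50 * Real.sqrt (g ^ 2 - 3))) + U ^ (-(1 / 10) : ℝ)) ≤
      32 * C * (1 / l ^ 100) := by
    calc _ ≤ C * (2 * l) ^ 4 * (1 / l ^ 200 + 1 / l ^ 200) := by gcongr
      _ = 32 * C * (l ^ 4 / l ^ 200) := by ring
      _ ≤ _ := mul_le_mul_of_nonneg_left (hpow 4 200 (by norm_num)) (by positivity)
  -- `S` is of order `l³`, so the main sum is at least of order `l ^ (-60)`, which leaves ample room
  -- above `l ^ (-100)`.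
  have b4 : D * (1 / l ^ 100) ≤ c / S ^ 20 := by
    have h1 : c / S ^ 20 = κ * (1 / l ^ 60) := by
      rw [hS, hκ, mul_pow, ← pow_mul, ← div_div, mul_one_div]
    rw [h1, mul_one_div, mul_one_div, div_le_div_iff₀ (by positivity) (by positivity)]
    rw [div_le_iff₀ hκ0] at hl2
    calc D * l ^ 60 ≤ (l * κ) * l ^ 60 := by gcongr
      _ = κ * l ^ 61 := by ring
      _ ≤ κ * l ^ 100 := by
        gcongr
        · linarith
        · norm_num
  set V₁ := ∑ ρ ∈ Z.filter P, (zeroMult ρ : ℂ) * kernel ρ₀ U ρ with hV₁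
  set V₂ := ∑ ρ ∈ Z.filter fun ρ => ¬ P ρ, (zeroMult ρ : ℂ) * kernel ρ₀ U ρ
  have htri : ‖V₁‖ ≤ ‖detector U ρ₀ + (V₁ + V₂)‖ + ‖detector U ρ₀‖ + ‖V₂‖ := by
    have : V₁ = (detector U ρ₀ + (V₁ + V₂)) - detector U ρ₀ - V₂ := by ring
    calc ‖V₁‖ = ‖(detector U ρ₀ + (V₁ + V₂)) - detector U ρ₀ - V₂‖ := by rw [← this]
      _ ≤ _ := (norm_sub_le _ _).trans (by gcongr; exact norm_sub_le _ _)
  have hDexp : D * (1 / l ^ 100) = 1 / l ^ 100 + 8 * C * K * (1 / l ^ 100) +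
      12 * (8 * C) * (1 / l ^ 100) + 32 * C * (1 / l ^ 100) := by rw [hD]; ring
  linarith

end Main

end HalfIsolated

/-! ### The theorem: both detection statements from one core bound. -/

theorem theorem4 :
    (ContDiff ℝ ∞ HalfIsolated.w₀ ∧ (∀ x : ℝ, 0 ≤ HalfIsolated.w₀ x) ∧
      tsupport HalfIsolated.w₀ ⊆ Set.Icc (1 / 2 : ℝ) 2) ∧
    (∃ C : ℝ, 1 ≤ C ∧ ∃ T₀ : ℝ, ∀ T : ℝ, T₀ ≤ T →
      ∀ ρ₀ : ℂ, HalfIsolated.IsHalfIsolated ρ₀ → ρ₀.im ∈ Set.Icc T (2 * T) →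
        ∃ Y ∈ Set.Icc (T ^ (Real.log (Real.log T) ^ 3 / Real.log T))
            (T ^ (5 / Real.log (Real.log T))),
          Real.log T ^ (-C) ≤ ‖HalfIsolated.detector Y ρ₀‖) ∧
    (∃ c : ℝ, 0 < c ∧ ∃ T₀ : ℝ, ∀ T : ℝ, T₀ ≤ T →
      HalfIsolated.lengths T ⊆ Set.Icc (Real.exp (Real.log (Real.log T) ^ 3)) (T ^ 2) ∧
      (HalfIsolated.lengths T).Finite ∧
      ((HalfIsolated.lengths T).ncard : ℝ) ≤ Real.log T ^ 152 ∧
      ∀ Y : ℝ, 1 < Y → Real.log (Real.log T) ^ 3 ≤ Real.log Y → Real.log Y ≤ Real.log T →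
        ∀ ρ₀ : ℂ, HalfIsolated.IsYHalfIsolated Y ρ₀ → ρ₀.im ∈ Set.Icc T (2 * T) →
          ∃ U ∈ HalfIsolated.lengths T ∩ Set.Icc Y (Y ^ 2),
            c / Real.log T ^ 100 ≤ ‖HalfIsolated.detector U ρ₀‖) := by
  obtain ⟨l₀, hl₀, hcore⟩ := HalfIsolated.exists_detector_ge
  have hlarge : ∀ T : ℝ, Real.exp l₀ ≤ T → 0 < T ∧ l₀ ≤ Real.log T := fun T hT =>
    ⟨(Real.exp_pos _).trans_le hT,
      (Real.le_log_iff_exp_le ((Real.exp_pos _).trans_le hT)).2 hT⟩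
  have hl₀5 : 5 ≤ l₀ := by
    have := Real.add_one_le_exp 4000
    linarith
  refine ⟨⟨HalfIsolated.contDiff_w₀, HalfIsolated.w₀_nonneg, HalfIsolated.tsupport_w₀_subset⟩,
    ⟨100, by norm_num, Real.exp l₀, fun T hT ρ₀ ⟨Y, hY, hYl, hYu, hiso⟩ him => ?_⟩,
    ⟨1, one_pos, Real.exp l₀, fun T hT => ?_⟩⟩
  · obtain ⟨hT0, hTl⟩ := hlarge T hT
    set l := Real.log T with hl
    have hl0 : 0 < l := by linarith
    have hx : 4000 ≤ Real.log l := (Real.le_log_iff_exp_le hl0).2 (hl₀.trans hTl)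
    have hγ0 : 0 < ρ₀.im := hT0.trans_le him.1
    rw [abs_of_pos hγ0] at hYl hYu
    set g := Real.log ρ₀.im with hg
    have hlg : l ≤ g := Real.log_le_log hT0 him.1
    have hgl : g ≤ 2 * l := by
      have h1 : g ≤ Real.log (2 * T) := Real.log_le_log hγ0 him.2
      rw [Real.log_mul (by norm_num) hT0.ne'] at h1
      have := Real.log_two_lt_d9
      linarith
    have hlog : Real.log l ≤ Real.log g := Real.log_le_log hl0 hlg
    -- The hypothesis on `Y` is in terms of `g = log γ₀` and is transferred to `l = log T` through
    -- `l ≤ g ≤ 2l`. Then `U ≤ Y²` gives `log U ≤ 4 l / log l`, within the allowed `5 l / log l`.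
    have hYx : Real.log Y ≤ 2 * l / Real.log l := hYu.trans (by gcongr)
    have hYll : Real.log Y ≤ l := by
      refine hYx.trans ?_
      rw [div_le_iff₀ (by linarith)]
      nlinarith
    obtain ⟨U, ⟨-, hU1, hU2⟩, hU⟩ := hcore T hT0 hTl Y hY (le_trans (by gcongr) hYl) hYll ρ₀
      hiso him
    have hYL : Y = Real.exp (Real.log Y) := (Real.exp_log (by linarith)).symm
    refine ⟨U, ⟨?_, ?_⟩, ?_⟩
    · refine le_trans ?_ hU1
      rw [Real.rpow_def_of_pos hT0, ← hl, mul_div_cancel₀ _ hl0.ne', hYL]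
      exact Real.exp_le_exp.2 (le_trans (by gcongr) hYl)
    · refine hU2.trans ?_
      rw [Real.rpow_def_of_pos hT0, ← hl, hYL, ← Real.exp_nat_mul]
      refine Real.exp_le_exp.2 ?_
      have h4 : l * (5 / Real.log l) = 5 / 2 * (2 * l / Real.log l) := by ring
      have h5 : 0 ≤ 2 * l / Real.log l := by positivity
      push_cast
      linarith
    · refine le_trans (le_of_eq ?_) hU
      rw [Real.rpow_neg hl0.le, one_div]
      norm_cast
  · obtain ⟨hT0, hTl⟩ := hlarge T hT
    obtain ⟨hfin, hcard⟩ := HalfIsolated.lengths_finite_card (T := T) (by linarith)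
    exact ⟨Set.inter_subset_left, hfin, hcard, hcore T hT0 hTl⟩
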